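/- Let $d\ge 0$, $V=\mathbb C^d$, $\mathcal O=\mathbb C[x_1,\dots,x_d]$, and let $\mathfrak X^k(V)=\bigwedge^k_{\mathcal O}\mathrm{Der}_{\mathbb C}(\mathcal O)$ be the module of polynomial $k$-vector fields. Let $\varphi\in\mathcal O$ be a Koszul polynomial, i.e. the Koszul complex $\cdots\to\mathfrak X^2(V)\to\mathfrak X(V)\to\mathcal O\to 0$ with differential $\iota_{\mathrm d\varphi}$ is exact except in degree $0$. Let $\mathcal F_\varphi=\{X\in\mathfrak X(V): X[\varphi]=0\}$. A *Lie $\infty$-algebroid* over a commutative algebra $A$ is a graded module $(\mathcal E_{i})_{i\le -1}$ of projective $A$-modules with graded symmetric brackets $\ell_n$ ($n\ge 1$) of degree $+1$ satisfying the higher Jacobi identities and an $A$-linear anchor $\rho:\mathcal E_{-1}\to\mathrm{Der}(A)$ (extended by $0$), such that $\ell_n$ is $A$-multilinear for $n\ne 2$, $\ell_2(x,fy)=\rho(x)[f]\,y+f\,\ell_2(x,y)$, $\rho\circ\ell_1=0$ on $\mathcal E_{-2}$, and $\rho(\ell_2(x,y))=[\rho(x),\rho(y)]$ on $\mathcal E_{-1}$.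 It is a *universal Lie $\infty$-algebroid* of a Lie-Rinehart algebra $L$ over $A$ through an $A$-linear hook $\pi:\mathcal E_{-1}\to L$ if $\rho_L\circ\pi=\rho$, $[\pi(x),\pi(y)]=\pi(\ell_2(x,y))$ on $\mathcal E_{-1}$, and $\cdots\xrightarrow{\ell_1}\mathcal E_{-2}\xrightarrow{\ell_1}\mathcal E_{-1}\xrightarrow{\pi}L\to 0$ is a projective resolution of $L$. Put $\mathcal E_{-i}=\mathfrak X^{i+1}(V)$ for $i\ge 1$. For $I\subseteq\{1,\dots,d\}$ let $\partial_I$ be the exterior product, in increasing order, of the $\partial/\partial x_i$, $i\in I$. On elements $\partial_{I_1},\dots,\partial_{I_n}$ with $|I_k|\ge 2$ define $$\{\partial_{I_1},\dots,\partial_{I_n}\}_n=\sum_{i_1\in I_1,\dots,i_n\in I_n}\epsilon(i_1,\dots,i_n)\,\frac{\partial^n\varphi}{\partial x_{i_1}\cdots\partial x_{i_n}}\;\partial_{I_1\setminus i_1}\wedge\cdots\wedge\partial_{I_n\setminus i_n},$$ where $\epsilon(i_1,\dots,i_n)$ is the product over $k$ of the signatures of the permutations that bring $i_k$ to the first slot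 of $I_k$, with the convention that $\{\partial_I\}_1=0$ when $|I|=2$. Let $\rho=-\iota_{\mathrm d\varphi}:\mathfrak X^2(V)\to\mathfrak X(V)$, that is $\rho(\partial_i\wedge\partial_j)=\frac{\partial\varphi}{\partial x_j}\partial_i-\frac{\partial\varphi}{\partial x_i}\partial_j$. Extend the brackets $\mathcal O$-multilinearly for $n\neq 2$, and by graded symmetry and the Leibniz rule for $n=2$. Then this structure is a universal Lie $\infty$-algebroid of $\mathcal F_\varphi$ through the hook $\pi=\rho:\mathcal E_{-1}\to\mathcal F_\varphi$. Moreover, its brackets, anchor and hook pass to the quotients $\mathcal E_{-i}/\varphi\,\mathcal E_{-i}$ (restriction to the zero locus $W$ of $\varphi$, with $\mathcal O_W=\mathcal O/\mathcal O\varphi$), and the restricted structure is a universal Lie $\infty$-algebroid over $\mathcal O/\mathcal O\varphi$ of the restricted Lie-Rinehart algebra $\mathfrak i_W^*\mathcal F_\varphi=\mathcal F_\varphi/\varphi\,\mathcal F_\varphi$, through the induced hook. -/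

import Mathlib

open MvPolynomial

noncomputable section

/-! ### Restriction of a Lie-Rinehart algebra along a Lie-Rinehart ideal -/

section Restriction

variable {A L : Type*} [CommRing A] [LieRing L] [Module A L] [LieRingModule L A]

/-- An ideal `I` of `A` is a Lie-Rinehart ideal for `L` if the anchor of `L` maps `I` to `I`. -/
class IsLieRinehartIdeal (L : Type*) {A : Type*} [CommRing A] [LieRing L] [Module A L]
    [LieRingModule L A] (I : Ideal A) : Prop where
  lie_mem : ∀ (x : L) (f : A), f ∈ I → ⁅x, f⁆ ∈ I

/-- The underlying module `L / I L` of the restriction of `L` with respect to `I`; it is a module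
over `A / I`. -/
abbrev LRRestriction (L : Type*) {A : Type*} [CommRing A] [LieRing L] [Module A L]
    (I : Ideal A) : Type _ := L ⧸ (I • (⊤ : Submodule A L))

variable [LieRinehartRing A L] (I : Ideal A)

theorem lie_mem_of_mem_smul_top {x : L} (f : A) (hx : x ∈ I • (⊤ : Submodule A L)) :
    ⁅x, f⁆ ∈ I := by
  induction hx using Submodule.smul_induction_on' with
  | smul r hr n hn =>
    rw [LieRinehartRing.lie_smul_eq_mul]; exact I.mul_mem_right _ hr
  | add y _ z _ h1 h2 => rw [add_lie]; exact add_mem h1 h2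

variable [IsLieRinehartIdeal L I]

theorem lie_mem_smul_top_right (x : L) {y : L} (hy : y ∈ I • (⊤ : Submodule A L)) :
    ⁅x, y⁆ ∈ I • (⊤ : Submodule A L) := by
  induction hy using Submodule.smul_induction_on' with
  | smul r hr n hn =>
    rw [LieRinehartRing.leibniz_smul_right]
    exact add_mem (Submodule.smul_mem_smul hr trivial)
      (Submodule.smul_mem_smul (IsLieRinehartIdeal.lie_mem x r hr) trivial)
  | add y _ z _ h1 h2 => rw [lie_add]; exact add_mem h1 h2

theorem lie_mem_smul_top_left {x : L} (y : L) (hx : x ∈ I • (⊤ : Submodule A L)) :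
    ⁅x, y⁆ ∈ I • (⊤ : Submodule A L) := by
  rw [← lie_skew]; exact neg_mem (lie_mem_smul_top_right I y hx)

instance : Bracket (LRRestriction L I) (LRRestriction L I) where
  bracket := Quotient.map₂ (fun x y : L => ⁅x, y⁆) (by
    intro x x' hx y y' hy
    have hx' : x - x' ∈ I • (⊤ : Submodule A L) := (Submodule.quotientRel_def _).1 hx
    have hy' : y - y' ∈ I • (⊤ : Submodule A L) := (Submodule.quotientRel_def _).1 hy
    refine (Submodule.quotientRel_def _).2 ?_
    have : ⁅x, y⁆ - ⁅x', y'⁆ = ⁅x - x', y⁆ + ⁅x', y - y'⁆ := by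
      rw [sub_lie, lie_sub]; abel
    rw [this]
    exact add_mem (lie_mem_smul_top_left I _ hx') (lie_mem_smul_top_right I _ hy'))

/-- The bracket of `L / I L` is induced by the bracket of `L`. -/
theorem LRRestriction.lie_mk (x y : L) :
    (⁅(Submodule.Quotient.mk x : LRRestriction L I),
      (Submodule.Quotient.mk y : LRRestriction L I)⁆ : LRRestriction L I) =
      Submodule.Quotient.mk ⁅x, y⁆ := rfl

instance : LieRing (LRRestriction L I) where
  add_lie := by
    rintro ⟨x⟩ ⟨y⟩ ⟨z⟩; exact congrArg Submodule.Quotient.mk (add_lie x y z)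
  lie_add := by
    rintro ⟨x⟩ ⟨y⟩ ⟨z⟩; exact congrArg Submodule.Quotient.mk (lie_add x y z)
  lie_self := by
    rintro ⟨x⟩; exact congrArg Submodule.Quotient.mk (lie_self x)
  leibniz_lie := by
    rintro ⟨x⟩ ⟨y⟩ ⟨z⟩; exact congrArg Submodule.Quotient.mk (leibniz_lie x y z)

instance : Bracket (LRRestriction L I) (A ⧸ I) where
  bracket := Quotient.map₂ (fun (x : L) (f : A) => ⁅x, f⁆) (by
    intro x x' hx f f' hf
    have hx' : x - x' ∈ I • (⊤ : Submodule A L) := (Submodule.quotientRel_def _).1 hx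
    have hf' : f - f' ∈ I := (Submodule.quotientRel_def _).1 hf
    refine (Submodule.quotientRel_def _).2 ?_
    have : ⁅x, f⁆ - ⁅x', f'⁆ = ⁅x - x', f⁆ + ⁅x', f - f'⁆ := by
      rw [sub_lie, lie_sub]; abel
    rw [this]
    exact add_mem (lie_mem_of_mem_smul_top I _ hx') (IsLieRinehartIdeal.lie_mem _ _ hf'))

/-- The anchor of `L / I L` is induced by the anchor of `L`. -/
theorem LRRestriction.lie_mk_mk (x : L) (f : A) :
    (⁅(Submodule.Quotient.mk x : LRRestriction L I), Ideal.Quotient.mk I f⁆ : A ⧸ I) =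
      Ideal.Quotient.mk I ⁅x, f⁆ := rfl

instance : LieRingModule (LRRestriction L I) (A ⧸ I) where
  add_lie := by
    rintro ⟨x⟩ ⟨y⟩ ⟨z⟩; exact congrArg (Ideal.Quotient.mk I) (add_lie x y z)
  lie_add := by
    rintro ⟨x⟩ ⟨y⟩ ⟨z⟩; exact congrArg (Ideal.Quotient.mk I) (lie_add x y z)
  leibniz_lie := by
    rintro ⟨x⟩ ⟨y⟩ ⟨z⟩; exact congrArg (Ideal.Quotient.mk I) (leibniz_lie x y z)

instance : LieRinehartRing (A ⧸ I) (LRRestriction L I) where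
  lie_smul_eq_mul' := by
    rintro ⟨a⟩ ⟨b⟩ ⟨x⟩
    exact congrArg (Ideal.Quotient.mk I) (LieRinehartRing.lie_smul_eq_mul a b x)
  leibniz_mul_right' := by
    rintro ⟨x⟩ ⟨a⟩ ⟨b⟩
    exact congrArg (Ideal.Quotient.mk I) (LieRinehartRing.leibniz_mul_right x a b)
  leibniz_smul_right' := by
    rintro ⟨x⟩ ⟨y⟩ ⟨a⟩
    exact congrArg Submodule.Quotient.mk (LieRinehartRing.leibniz_smul_right x y a)

variable (K : Type*) [CommRing K] [Algebra K A] [LieAlgebra K L] [LieRinehartAlgebra K A L]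

instance : LieAlgebra K (LRRestriction L I) where
  lie_smul := by
    rintro t ⟨x⟩ ⟨y⟩; exact congrArg Submodule.Quotient.mk (lie_smul t x y)

instance : IsScalarTower K (A ⧸ I) (LRRestriction L I) where
  smul_assoc := by
    rintro t ⟨a⟩ ⟨x⟩; exact congrArg Submodule.Quotient.mk (smul_assoc t a x)

instance : LieModule K (LRRestriction L I) (A ⧸ I) where
  smul_lie := by
    rintro t ⟨x⟩ ⟨a⟩; exact congrArg (Ideal.Quotient.mk I) (smul_lie t x a)
  lie_smul := by
    rintro t ⟨x⟩ ⟨a⟩; exact congrArg (Ideal.Quotient.mk I) (lie_smul t x a)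

instance : LieRinehartAlgebra K (A ⧸ I) (LRRestriction L I) where

end Restriction

/-! ### Lie ∞-algebroids -/

/-- The Koszul sign `ε(σ; x₁, …, xₙ)` of a permutation of homogeneous elements of degrees
`deg 0, …, deg (n - 1)`, defined by `x_{σ 1} ⊙ ⋯ ⊙ x_{σ n} = ε(σ) x₁ ⊙ ⋯ ⊙ xₙ`: each inversion
contributes `(-1)^{|x||y|}`. -/
def koszulSign {n : ℕ} (σ : Equiv.Perm (Fin n)) (deg : Fin n → ℤ) : ℤˣ :=
  ∏ a : Fin n, ∏ b : Fin n,
    if a < b ∧ σ b < σ a then Int.negOnePow (deg (σ a) * deg (σ b)) else 1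

/-- `σ` is an `(i, n - i)`-shuffle: increasing on the first `i` and on the last `n - i` indices. -/
def IsShuffle {n : ℕ} (i : ℕ) (σ : Equiv.Perm (Fin n)) : Prop :=
  ∀ a b : Fin n, a < b → (b.val < i ∨ i ≤ a.val) → σ a < σ b

/-- The data underlying a Lie ∞-algebroid over the `K`-algebra `A` on a graded `A`-module `E`:
the homogeneous components `E_d = grading d`, the `n`-ary brackets as `K`-multilinear maps, and the
anchor (extended by zero to the components of degree different from `-1`). -/
structure LieInftyData (K A E : Type*) [CommRing K] [CommRing A] [Algebra K A]
    [AddCommGroup E] [Module K E] [Module A E] where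
  grading : ℤ → Submodule A E
  bracket : (n : ℕ) → MultilinearMap K (fun _ : Fin n => E) E
  anchor : E →ₗ[A] Derivation K A A

namespace LieInftyData

variable {K A E : Type*} [CommRing K] [CommRing A] [Algebra K A]
    [AddCommGroup E] [Module K E] [Module A E]

open Classical in
/-- The left-hand side of the higher Jacobi identity at homogeneous elements `x` of degrees `deg`,
`∑_{i=1}^{n} ∑_{σ ∈ Sh(i,n-i)} ε(σ) ℓ_{n-i+1}(ℓ_i(x_{σ 1}, …, x_{σ i}), x_{σ(i+1)}, …, x_{σ n})`;
the summation index `i : Fin n` stands for the arity `i + 1` of the inner bracket. -/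
def jacobiator (E' : LieInftyData K A E) {n : ℕ} (x : Fin n → E) (deg : Fin n → ℤ) : E :=
  ∑ i : Fin n, ∑ σ ∈ (Finset.univ : Finset (Equiv.Perm (Fin n))).filter (IsShuffle (i.val + 1)),
    koszulSign σ deg •
      E'.bracket (n - (i.val + 1) + 1)
        (Fin.cons (E'.bracket (i.val + 1) fun a => x (σ (Fin.castLE i.isLt a)))
          fun b : Fin (n - (i.val + 1)) => x (σ ⟨i.val + 1 + b.val, by have := b.isLt; omega⟩))

/-- The axioms of a (negatively graded) Lie ∞-algebroid. -/
structure IsLieInftyAlgebroid (E' : LieInftyData K A E) : Prop where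
  isInternal : DirectSum.IsInternal E'.grading
  grading_nonneg : ∀ d : ℤ, 0 ≤ d → E'.grading d = ⊥
  projective : ∀ d : ℤ, Module.Projective A (E'.grading d)
  /-- The brackets have degree `+1`. -/
  bracket_mem : ∀ (n : ℕ) (x : Fin n → E) (deg : Fin n → ℤ), (∀ i, x i ∈ E'.grading (deg i)) →
    E'.bracket n x ∈ E'.grading ((∑ i, deg i) + 1)
  /-- The brackets are graded symmetric. -/
  bracket_perm : ∀ (n : ℕ) (x : Fin n → E) (deg : Fin n → ℤ), (∀ i, x i ∈ E'.grading (deg i)) →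
    ∀ σ : Equiv.Perm (Fin n), E'.bracket n (fun i => x (σ i)) = koszulSign σ deg • E'.bracket n x
  jacobi : ∀ (n : ℕ) (x : Fin n → E) (deg : Fin n → ℤ), 1 ≤ n →
    (∀ i, x i ∈ E'.grading (deg i)) → E'.jacobiator x deg = 0
  bracket_smul : ∀ (n : ℕ), n ≠ 2 → ∀ (x : Fin n → E) (i : Fin n) (f : A) (y : E),
    E'.bracket n (Function.update x i (f • y)) = f • E'.bracket n (Function.update x i y)
  leibniz : ∀ (x y : E) (f : A),
    E'.bracket 2 ![x, f • y] = E'.anchor x f • y + f • E'.bracket 2 ![x, y]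
  anchor_of_ne : ∀ d : ℤ, d ≠ -1 → ∀ x ∈ E'.grading d, E'.anchor x = 0
  anchor_bracket_one : ∀ x ∈ E'.grading (-2), E'.anchor (E'.bracket 1 ![x]) = 0
  anchor_bracket_two : ∀ x ∈ E'.grading (-1), ∀ y ∈ E'.grading (-1),
    E'.anchor (E'.bracket 2 ![x, y]) = ⁅E'.anchor x, E'.anchor y⁆

variable {L : Type*} [LieRing L] [LieAlgebra K L] [Module A L] [LieRingModule L A]
  [LieRinehartRing A L] [LieRinehartAlgebra K A L]

/-- `E'` terminates at the Lie-Rinehart algebra `L` through the hook `π : E_{-1} → L` (extended by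
zero to the other components). -/
structure TerminatesAt (E' : LieInftyData K A E) (π : E →ₗ[A] L) : Prop where
  hook_of_ne : ∀ d : ℤ, d ≠ -1 → ∀ x ∈ E'.grading d, π x = 0
  anchor_hook : ∀ x ∈ E'.grading (-1), ∀ f : A, ⁅π x, f⁆ = E'.anchor x f
  lie_hook : ∀ x ∈ E'.grading (-1), ∀ y ∈ E'.grading (-1),
    ⁅π x, π y⁆ = π (E'.bracket 2 ![x, y])

/-- `E'` is a universal Lie ∞-algebroid of the Lie-Rinehart algebra `L` through the hook `π`: it is
a Lie ∞-algebroid that terminates at `L` through `π`, and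
`⋯ → E_{-3} → E_{-2} → E_{-1} → L → 0`, with differentials `ℓ₁` and augmentation `π`, is a
projective resolution (projectivity being part of the axioms of a Lie ∞-algebroid). -/
structure IsUniversal (E' : LieInftyData K A E) (π : E →ₗ[A] L) : Prop where
  isLieInftyAlgebroid : E'.IsLieInftyAlgebroid
  terminatesAt : E'.TerminatesAt π
  hook_surjective : ∀ a : L, ∃ x ∈ E'.grading (-1), π x = a
  exact_hook : ∀ x ∈ E'.grading (-1),
    π x = 0 ↔ ∃ y ∈ E'.grading (-2), E'.bracket 1 ![y] = x
  exact_bracket : ∀ d : ℤ, d ≤ -2 → ∀ x ∈ E'.grading d,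
    E'.bracket 1 ![x] = 0 ↔ ∃ y ∈ E'.grading (d - 1), E'.bracket 1 ![y] = x

/-- `R` is the restriction of `E'` with respect to the ideal `I`: it lives on `E / I E`, its
components are the images of those of `E'` and all its structure maps are induced by those
of `E'`. These conditions determine `R`. -/
structure IsRestriction [IsScalarTower K A E] (E' : LieInftyData K A E) (I : Ideal A)
    (R : LieInftyData K (A ⧸ I) (E ⧸ (I • (⊤ : Submodule A E)))) : Prop where
  grading : ∀ (d : ℤ) (y : E ⧸ (I • (⊤ : Submodule A E))),
    y ∈ R.grading d ↔ ∃ x ∈ E'.grading d, Submodule.Quotient.mk x = y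
  bracket : ∀ (n : ℕ) (x : Fin n → E),
    R.bracket n (fun i => Submodule.Quotient.mk (x i)) = Submodule.Quotient.mk (E'.bracket n x)
  anchor : ∀ (x : E) (f : A),
    R.anchor (Submodule.Quotient.mk x) (Ideal.Quotient.mk I f) =
      Ideal.Quotient.mk I (E'.anchor x f)

end LieInftyData

/-! ### Polyvector fields on `ℂ^d` and Koszul polynomials -/

/-- Polynomial functions on `V = ℂ^d`. -/
abbrev PolyFun (d : ℕ) : Type := MvPolynomial (Fin d) ℂ

/-- Polynomial vector fields on `V = ℂ^d`. -/
abbrev VF (d : ℕ) : Type := Derivation ℂ (PolyFun d) (PolyFun d)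

/-- All polyvector fields on `V = ℂ^d`; the `k`-vector fields are
`⋀[PolyFun d]^k (VF d) : Submodule (PolyFun d) (PV d)`. -/
abbrev PV (d : ℕ) : Type := ExteriorAlgebra (PolyFun d) (VF d)

/-- The differential `df`, as the linear form `X ↦ X[f]` on vector fields. -/
def dForm {d : ℕ} (f : PolyFun d) : Module.Dual (PolyFun d) (VF d) where
  toFun X := X f
  map_add' _ _ := rfl
  map_smul' _ _ := rfl

/-- The contraction `ι_{df}` of polyvector fields:
`ι_{df}(X₁ ∧ ⋯ ∧ X_k) = ∑_j (-1)^{j-1} X_j[f] X₁ ∧ ⋯ X̂_j ⋯ ∧ X_k`. -/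
def contract {d : ℕ} (f : PolyFun d) : PV d →ₗ[PolyFun d] PV d :=
  CliffordAlgebra.contractLeft (Q := (0 : QuadraticForm (PolyFun d) (VF d))) (dForm f)

/-- `φ` is a Koszul polynomial: the Koszul complex
`⋯ → 𝔛³(V) → 𝔛²(V) → 𝔛(V) → 𝒪 → 0` with differential `ι_{dφ}` is exact except in degree `0`. -/
def IsKoszul {d : ℕ} (φ : PolyFun d) : Prop :=
  ∀ k : ℕ, ∀ P ∈ ⋀[PolyFun d]^(k + 1) (VF d),
    contract φ P = 0 ↔ ∃ Q ∈ ⋀[PolyFun d]^(k + 2) (VF d), contract φ Q = P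

/-- The Lie-Rinehart algebra `𝓕_φ` of vector fields annihilating `φ`. -/
def foliation {d : ℕ} (φ : PolyFun d) : LieRinehartSubalgebra (PolyFun d) (VF d) where
  carrier := {X | X φ = 0}
  add_mem' {X Y} hX hY := by
    have hX' : X φ = 0 := hX
    have hY' : Y φ = 0 := hY
    simp [hX', hY']
  zero_mem' := by simp
  smul_mem' f X hX := by
    have hX' : X φ = 0 := hX
    simp [hX']
  lie_mem' {X Y} hX hY := by
    have hX' : X φ = 0 := hX
    have hY' : Y φ = 0 := hY
    simp [Derivation.commutator_apply, hX', hY']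

instance {d : ℕ} (φ : PolyFun d) :
    IsLieRinehartIdeal (foliation φ) (Ideal.span {φ} : Ideal (PolyFun d)) where
  lie_mem X f hf := by
    obtain ⟨g, rfl⟩ := Ideal.mem_span_singleton'.1 hf
    have hX : X.1 φ = 0 := X.2
    have : ⁅X, g * φ⁆ = X.1 g * φ := by
      change X.1 (g * φ) = _
      simp [hX, mul_comm]
    rw [this]
    exact Ideal.mem_span_singleton'.2 ⟨_, rfl⟩

/-- The coordinate vector fields `∂/∂x_i` form a basis of the vector fields. -/
def vfBasis (d : ℕ) : Module.Basis (Fin d) (PolyFun d) (VF d) :=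
  Module.Basis.ofEquivFun
    { toFun := fun D i => D (X i)
      map_add' := fun _ _ => rfl
      map_smul' := fun _ _ => rfl
      invFun := fun f => mkDerivation ℂ f
      left_inv := fun D => derivation_ext fun i => by simp
      right_inv := fun f => by funext i; simp }

/-- The basis `∂_I`, `I ⊆ {1, …, d}`, of the polyvector fields. -/
abbrev pvBasis (d : ℕ) : Module.Basis (Finset (Fin d)) (PolyFun d) (PV d) :=
  (vfBasis d).ExteriorAlgebra

/-- The coefficientwise derivative `∇_X (∑_I f_I ∂_I) = ∑_I X[f_I] ∂_I`. -/
def coeffDeriv {d : ℕ} : VF d →ₗ[ℂ] PV d →ₗ[ℂ] PV d :=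
  LinearMap.mk₂ ℂ (fun X P => ∑ I, X ((pvBasis d).repr P I) • pvBasis d I)
    (fun X Y P => by simp [add_smul, Finset.sum_add_distrib])
    (fun c X P => by simp [Finset.smul_sum])
    (fun X P Q => by simp [add_smul, Finset.sum_add_distrib])
    (fun c X P => by
      have h : ∀ I, (pvBasis d).repr (c • P) I = c • (pvBasis d).repr P I := fun I => by
        rw [← algebraMap_smul (PolyFun d) c P, map_smul, Finsupp.smul_apply, algebraMap_smul]
      simp [h, Finset.smul_sum])

/-! ### The Lie ∞-algebroid of a Koszul polynomial -/

/-- The graded module `E = ⨁_{i ≥ 1} E_{-i}`, `E_{-i} = 𝔛^{i+1}(V)`, of polyvector fields all of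
whose components have order at least `2`. -/
def koszulModule (d : ℕ) : Submodule (PolyFun d) (PV d) :=
  ⨆ k : ℕ, ⋀[PolyFun d]^(k + 2) (VF d)

/-- The projection of the polyvector fields on `E` that forgets functions and vector fields. -/
def koszulProj (d : ℕ) : PV d →ₗ[PolyFun d] koszulModule d :=
  (pvBasis d).constr (PolyFun d) fun I =>
    if h : 2 ≤ I.card then
      ⟨pvBasis d I, Submodule.mem_iSup_of_mem (I.card - 2) (by
        rw [ExteriorAlgebra.basis_apply_ofCard (vfBasis d) (n := I.card - 2 + 2) (by omega)]
        exact ExteriorAlgebra.ιMulti_range _ _ ⟨_, rfl⟩)⟩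
    else 0

/-- The iterated partial derivative `φ_{i₁ ⋯ iₙ}`. -/
def iterPartial {d n : ℕ} (φ : PolyFun d) (i : Fin n → Fin d) : PolyFun d :=
  (List.ofFn i).foldr (fun j f => pderiv j f) φ

/-- The `𝒪`-multilinear brackets
`(P₁, …, Pₙ) ↦ ∑_{i₁, …, iₙ} φ_{i₁ ⋯ iₙ} (ι_{dx_{i₁}} P₁) ∧ ⋯ ∧ (ι_{dx_{iₙ}} Pₙ)`, projected on `E`.
On the basis elements `∂_{I₁}, …, ∂_{Iₙ}` this is the sum over `i₁ ∈ I₁, …, iₙ ∈ Iₙ` of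
`φ_{i₁ ⋯ iₙ} ε₁ ⋯ εₙ ∂_{I₁ \ i₁} ∧ ⋯ ∧ ∂_{Iₙ \ iₙ}`, where `ε_k` is the signature of the permutation
that brings `i_k` to the first slot of `I_k`. -/
def koszulBracketLin {d : ℕ} (φ : PolyFun d) (n : ℕ) :
    MultilinearMap (PolyFun d) (fun _ : Fin n => koszulModule d) (koszulModule d) :=
  (koszulProj d).compMultilinearMap
    (∑ i : Fin n → Fin d, iterPartial φ i •
      (MultilinearMap.mkPiAlgebraFin (PolyFun d) n (PV d)).compLinearMap fun k =>
        contract (X (i k)) ∘ₗ (koszulModule d).subtype)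

/-- The anchor `ρ = -ι_{dφ} : 𝔛²(V) → 𝔛(V)`, extended by zero to the other components of `E`, i.e.
`-1` times the component of `ι_{dφ}` in `𝔛(V)`. On bivector fields,
`ρ(∂_i ∧ ∂_j) = φ_j ∂_i - φ_i ∂_j`. -/
def koszulAnchor {d : ℕ} (φ : PolyFun d) : koszulModule d →ₗ[PolyFun d] VF d :=
  -(ExteriorAlgebra.ιInv ∘ₗ contract φ ∘ₗ (koszulModule d).subtype)

/-- A bilinear map as a multilinear map. -/
def multilinearOfBilinear {K M N : Type*} [CommRing K] [AddCommGroup M] [Module K M]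
    [AddCommGroup N] [Module K N] (B : M →ₗ[K] M →ₗ[K] N) :
    MultilinearMap K (fun _ : Fin 2 => M) N where
  toFun x := B (x 0) (x 1)
  map_update_add' m i x y := by
    rename_i inst
    rw [Subsingleton.elim inst (instDecidableEqFin 2)]
    fin_cases i <;> simp
  map_update_smul' m i c x := by
    rename_i inst
    rw [Subsingleton.elim inst (instDecidableEqFin 2)]
    fin_cases i <;> simp

/-- The part of the binary bracket that differentiates coefficients,
`(P, Q) ↦ ∇_{ρ(P)} Q + (-1)^{|P|} ∇_{ρ(Q)} P` with `|P| = 1 - p` for a `p`-vector field `P`; note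
that `(-1)^{|P|} P = -involute P`. -/
def koszulBracketAnchor {d : ℕ} (φ : PolyFun d) :
    koszulModule d →ₗ[ℂ] koszulModule d →ₗ[ℂ] koszulModule d :=
  LinearMap.mk₂ ℂ
    (fun P Q => koszulProj d (coeffDeriv (koszulAnchor φ P) Q.1
      - coeffDeriv (koszulAnchor φ Q) (CliffordAlgebra.involute P.1)))
    (fun P P' Q => by
      simp only [map_add, Submodule.coe_add, LinearMap.add_apply, map_sub]; abel)
    (fun c P Q => by
      have h1 : koszulAnchor φ (c • P) = c • koszulAnchor φ P :=
        (koszulAnchor φ).map_smul_of_tower c P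
      have h2 : CliffordAlgebra.involute (c • P).1 = c • CliffordAlgebra.involute P.1 :=
        (CliffordAlgebra.involute (Q := (0 : QuadraticForm (PolyFun d) (VF d)))
          ).toLinearMap.map_smul_of_tower c P.1
      rw [h1, h2, map_smul, map_smul, LinearMap.smul_apply, ← smul_sub]
      exact (koszulProj d).map_smul_of_tower c _)
    (fun P Q Q' => by
      simp only [map_add, Submodule.coe_add, LinearMap.add_apply, map_sub]; abel)
    (fun c P Q => by
      have h1 : koszulAnchor φ (c • Q) = c • koszulAnchor φ Q :=
        (koszulAnchor φ).map_smul_of_tower c Q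
      have h2 : (c • Q).1 = c • Q.1 := rfl
      rw [h1, h2, map_smul, map_smul, LinearMap.smul_apply, ← smul_sub]
      exact (koszulProj d).map_smul_of_tower c _)

/-- The structure on `E_{-i} = 𝔛^{i+1}(V)`, `i ≥ 1`, attached to `φ`: the brackets are `𝒪`-multilinear
for `n ≠ 2`, and the binary bracket is the extension by the Leibniz rule of its values on the `∂_I`. -/
def koszulLieInfty {d : ℕ} (φ : PolyFun d) :
    LieInftyData ℂ (PolyFun d) (koszulModule d) where
  grading e := if e ≤ -1 then
      (⋀[PolyFun d]^(1 - e).toNat (VF d)).comap (koszulModule d).subtype else ⊥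
  bracket
    | 2 => (koszulBracketLin φ 2).restrictScalars ℂ
        + multilinearOfBilinear (koszulBracketAnchor φ)
    | n => (koszulBracketLin φ n).restrictScalars ℂ
  anchor := koszulAnchor φ

theorem ιInv_algebraMap {R M : Type*} [CommRing R] [AddCommGroup M] [Module R M] (r : R) :
    ExteriorAlgebra.ιInv (algebraMap R (ExteriorAlgebra R M) r) = 0 := by
  let _ : Module Rᵐᵒᵖ M := Module.compHom _ ((RingHom.id R).fromOpposite mul_comm)
  have _ : IsCentralScalar R M := ⟨fun r m => rfl⟩
  change (ExteriorAlgebra.toTrivSqZeroExt (algebraMap R (ExteriorAlgebra R M) r)).snd = 0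
  rw [AlgHom.commutes]
  rfl

theorem ιInv_ι_mul {R M : Type*} [CommRing R] [AddCommGroup M] [Module R M] (m : M)
    (x : ExteriorAlgebra R M) :
    ExteriorAlgebra.ιInv (ExteriorAlgebra.ι R m * x) = ExteriorAlgebra.algebraMapInv x • m := by
  let _ : Module Rᵐᵒᵖ M := Module.compHom _ ((RingHom.id R).fromOpposite mul_comm)
  have _ : IsCentralScalar R M := ⟨fun r m => rfl⟩
  have h : (TrivSqZeroExt.fstHom R R M).comp ExteriorAlgebra.toTrivSqZeroExt =
      ExteriorAlgebra.algebraMapInv := by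
    apply ExteriorAlgebra.hom_ext
    ext m
    simp [ExteriorAlgebra.algebraMapInv]
  change (ExteriorAlgebra.toTrivSqZeroExt (ExteriorAlgebra.ι R m * x)).snd = _
  rw [map_mul, ExteriorAlgebra.toTrivSqZeroExt_ι, TrivSqZeroExt.snd_mul, ← h]
  simp

theorem apply_ιInv_contract {d : ℕ} (φ : PolyFun d) (P : PV d) :
    (ExteriorAlgebra.ιInv (contract φ P) : VF d) φ = 0 := by
  have key : ∀ Q : PV d, (ExteriorAlgebra.ιInv Q : VF d) φ =
      ExteriorAlgebra.algebraMapInv (contract φ Q) := by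
    intro Q
    induction Q using CliffordAlgebra.left_induction with
    | algebraMap r =>
      have h1 : contract φ (algebraMap (PolyFun d) (PV d) r) = 0 :=
        CliffordAlgebra.contractLeft_algebraMap
          (Q := (0 : QuadraticForm (PolyFun d) (VF d))) (dForm φ) r
      have h2 : (ExteriorAlgebra.ιInv (algebraMap (PolyFun d) (PV d) r) : VF d) = 0 :=
        ιInv_algebraMap r
      rw [h1]
      exact (DFunLike.congr_fun h2 φ).trans (map_zero _).symm
    | add x y hx hy => simp only [map_add, Derivation.add_apply, hx, hy]
    | ι_mul x m hx =>
      have h1 : contract φ (ExteriorAlgebra.ι (PolyFun d) m * x) =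
          m φ • x - ExteriorAlgebra.ι (PolyFun d) m * contract φ x :=
        CliffordAlgebra.contractLeft_ι_mul
          (Q := (0 : QuadraticForm (PolyFun d) (VF d))) (dForm φ) m x
      have h2 : ExteriorAlgebra.ιInv (ExteriorAlgebra.ι (PolyFun d) m * x) =
          ExteriorAlgebra.algebraMapInv x • m := ιInv_ι_mul m x
      change (ExteriorAlgebra.ιInv (ExteriorAlgebra.ι (PolyFun d) m * x) : VF d) φ =
        ExteriorAlgebra.algebraMapInv (contract φ (ExteriorAlgebra.ι (PolyFun d) m * x))
      rw [h1, h2]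
      simp [ExteriorAlgebra.algebraMapInv, mul_comm]
  rw [key]
  simp [contract, CliffordAlgebra.contractLeft_contractLeft]

/-- The hook of the resolution of `𝓕_φ`: the anchor `ρ = -ι_{dφ}`, seen as a map to `𝓕_φ`. -/
def koszulHook {d : ℕ} (φ : PolyFun d) : koszulModule d →ₗ[PolyFun d] foliation φ where
  toFun P := ⟨koszulAnchor φ P, by
    change (koszulAnchor φ P) φ = 0
    simp [koszulAnchor, apply_ιInv_contract]⟩
  map_add' P Q := Subtype.ext (map_add _ P Q)
  map_smul' f P := Subtype.ext (map_smul _ f P)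

end

/-!
The proof compares the brackets `ℓₙ` on `E` with the untruncated brackets
`Λₙ(P₁, …, Pₙ) = ∑ φ_{i₁ ⋯ iₙ} (ι_{dx_{i₁}} P₁) ∧ ⋯ ∧ (ι_{dx_{iₙ}} Pₙ)`
(`fullBracket`), which are defined and `𝒪`-multilinear on all polyvector fields.

*Jacobi identities for `Λ`* (`fullBracket_jacobi`). Contractions are odd derivations, and so
`Λ(Λ(P_S), P_{Sᶜ})`, reordered with its Koszul sign, is the sum over `l ∈ S`, over coordinates `j` and
over multi-indices `w`, of the coefficient `(∂_j ∂_{w|Sᶜ} φ) (∂_{w|S} φ)` times the product of the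
`ι_{dx_{w k}} P_k` whose `l`-th factor is contracted once more, with `dx_j`. The last product changes
sign when `j` and `w l` are exchanged, whereas the coefficient, summed over all `S` containing `l`,
does not: replacing `S` by `{l} ∪ Sᶜ` exchanges the two roles. Hence the total is zero. The
bookkeeping of the signs is done by writing the contraction as the upper right entry of a product
of upper triangular `2 × 2` matrices with graded commuting factors, to which
`prod_ofFn_comp_perm` applies.

*From `Λ` to `ℓ`* (`coe_bracket`). On `E` one has `ℓₙ = Λₙ + cₙ`, where `c₁ = ι ∘ ρ` removes the
component of `Λ₁ = ι_{dφ}` in the vector fields, `c₂(P, Q) = ∇_{ρ P} Q + (-1)^{|P|} ∇_{ρ Q} P` is the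
part required by the Leibniz rule, and `cₙ = 0` for `n ≥ 3`; here `∇` is the flat connection that
differentiates coefficients. By the identities for `Λ` only the terms containing some `cᵢ` remain in
the Jacobiator of `ℓ`. Since
`Λₙ₊₁(Y, P₁, …, Pₙ) = ∇_Y Λₙ(P₁, …, Pₙ) - ∑ₖ Λₙ(P₁, …, ∇_Y P_k, …, Pₙ)`
for a vector field `Y` (`fullBracket_cons_ι`), these terms cancel in pairs, up to a remainder
(`coe_jacobiator_add_two`) that is zero for degree reasons for `n ≥ 4`, by the compatibility of the
anchor with the binary bracket for `n = 2`, and by the flatness of `∇` for `n = 3`. For `n = 1` the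
identity is `ρ(φ) = 0` and `ρ ∘ ℓ₁ = 0`.

*Universality* over `𝒪` is then the exactness of the Koszul complex. The restriction to the zero locus
of `φ` exists because the anchor preserves the ideal of `φ`, all axioms being inherited by the
quotient; exactness modulo `φ` follows from exactness over `𝒪` because `φ` is a nonzerodivisor on `E`
and on the foliation (`LieInftyData.IsUniversal.restrict_span_singleton`). If `φ = 0`, being Koszul
forces `E = 0`.
-/

noncomputable section

/-! ### Koszul signs and products of graded commuting families -/

/-- The permutation with `0 ↦ m` and `k + 1 ↦ m.succAbove (τ k)`. -/
def consPerm {n : ℕ} (m : Fin (n + 1)) (τ : Equiv.Perm (Fin n)) : Equiv.Perm (Fin (n + 1)) :=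
  (Equiv.Perm.decomposeFin.symm (0, τ)).trans m.cycleRange.symm

@[simp] theorem consPerm_zero {n : ℕ} (m : Fin (n + 1)) (τ : Equiv.Perm (Fin n)) :
    consPerm m τ 0 = m := by
  simp [consPerm]

@[simp] theorem consPerm_succ {n : ℕ} (m : Fin (n + 1)) (τ : Equiv.Perm (Fin n)) (k : Fin n) :
    consPerm m τ k.succ = m.succAbove (τ k) := by
  simp [consPerm]

theorem exists_eq_consPerm {n : ℕ} (σ : Equiv.Perm (Fin (n + 1))) :
    ∃ m τ, σ = consPerm m τ := by
  obtain ⟨⟨p, τ⟩, h⟩ := Equiv.Perm.decomposeFin.symm.surjective (σ.trans (σ 0).cycleRange)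
  refine ⟨σ 0, τ, ?_⟩
  have hp : p = 0 := by
    have := congrArg (fun e => e 0) h
    simpa using this
  subst hp
  ext1 x
  simp [consPerm, h]

/-- The sign picked up by moving the `m`-th entry to the first place. -/
def frontSign {n : ℕ} (deg : Fin (n + 1) → ℤ) (m : Fin (n + 1)) : ℤˣ :=
  ∏ k : Fin n, if m.succAbove k < m then Int.negOnePow (deg m * deg (m.succAbove k)) else 1

theorem koszulSign_consPerm {n : ℕ} (m : Fin (n + 1)) (τ : Equiv.Perm (Fin n))
    (deg : Fin (n + 1) → ℤ) :
    koszulSign (consPerm m τ) deg =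
      frontSign deg m * koszulSign τ fun k => deg (m.succAbove k) := by
  unfold koszulSign frontSign
  rw [Fin.prod_univ_succ]
  congr 1
  · rw [Fin.prod_univ_succ]
    simpa using Equiv.prod_comp τ fun k =>
      if m.succAbove k < m then Int.negOnePow (deg m * deg (m.succAbove k)) else 1
  · refine Finset.prod_congr rfl fun a _ => ?_
    rw [Fin.prod_univ_succ]
    simp [Fin.succAbove_lt_succAbove_iff]

@[simp] theorem koszulSign_one {n : ℕ} (deg : Fin n → ℤ) : koszulSign 1 deg = 1 := by
  unfold koszulSign
  refine Finset.prod_eq_one fun a _ => Finset.prod_eq_one fun b _ => if_neg ?_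
  rintro ⟨h, h'⟩
  exact lt_asymm h h'

theorem frontSign_zero {n : ℕ} (deg : Fin (n + 1) → ℤ) : frontSign deg 0 = 1 := by
  simp [frontSign]

theorem frontSign_succ {n : ℕ} (deg : Fin (n + 2) → ℤ) (m : Fin (n + 1)) :
    frontSign deg m.succ =
      Int.negOnePow (deg m.succ * deg 0) * frontSign (fun k => deg k.succ) m := by
  simp [frontSign, Fin.prod_univ_succ]

/-- Moving the `m`-th factor of a product of graded commuting elements to the front. -/
theorem mul_prod_ofFn_succAbove {B : Type*} [Ring B] {n : ℕ} (y : Fin (n + 1) → B)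
    (deg : Fin (n + 1) → ℤ)
    (hy : ∀ a b, y a * y b = Int.negOnePow (deg a * deg b) • (y b * y a)) (m : Fin (n + 1)) :
    y m * (List.ofFn fun k => y (m.succAbove k)).prod =
      frontSign deg m • (List.ofFn y).prod := by
  induction n with
  | zero =>
    obtain rfl : m = 0 := Fin.fin_one_eq_zero m
    simp [frontSign_zero]
  | succ n ih =>
    induction m using Fin.cases with
    | zero => simp [frontSign_zero]
    | succ m =>
      have h := ih (fun k => y k.succ) (fun k => deg k.succ) (fun a b => hy _ _) m
      rw [List.ofFn_succ, List.ofFn_succ (f := y), List.prod_cons, List.prod_cons, frontSign_succ,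
        Fin.succ_succAbove_zero, ← mul_assoc, hy, smul_mul_assoc, mul_assoc, mul_smul,
        ← mul_smul_comm (frontSign _ m), ← h]
      simp

/-- A permutation of the factors of a product of graded commuting elements produces the
Koszul sign. -/
theorem prod_ofFn_comp_perm {B : Type*} [Ring B] {n : ℕ} (y : Fin n → B) (deg : Fin n → ℤ)
    (hy : ∀ a b, y a * y b = Int.negOnePow (deg a * deg b) • (y b * y a))
    (σ : Equiv.Perm (Fin n)) :
    (List.ofFn fun k => y (σ k)).prod = koszulSign σ deg • (List.ofFn y).prod := by
  induction n with
  | zero =>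
    rw [Subsingleton.elim σ 1]; simp
  | succ n ih =>
    obtain ⟨m, τ, rfl⟩ := exists_eq_consPerm σ
    rw [List.ofFn_succ, List.prod_cons, koszulSign_consPerm, mul_comm, mul_smul,
      ← mul_prod_ofFn_succAbove y deg hy, ← mul_smul_comm,
      ← ih (fun k => y (m.succAbove k)) _ (fun a b => hy _ _) τ]
    simp

/-! ### Graded structure of the exterior algebra -/

section Exterior

variable {R M : Type*} [CommRing R] [AddCommGroup M] [Module R M]

theorem ι_mem_exteriorPower_one (m : M) : ExteriorAlgebra.ι R m ∈ ⋀[R]^1 M := by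
  rw [ExteriorAlgebra.exteriorPower, pow_one]; exact ⟨m, rfl⟩

theorem exteriorPower_mul_mem {p q : ℕ} {x y : ExteriorAlgebra R M} (hx : x ∈ ⋀[R]^p M)
    (hy : y ∈ ⋀[R]^q M) : x * y ∈ ⋀[R]^(p + q) M := by
  rw [ExteriorAlgebra.exteriorPower, pow_add]; exact Submodule.mul_mem_mul hx hy

/-- Induction on homogeneous elements of the exterior algebra, one factor at a time. -/
theorem exteriorPower_induction {C : ∀ (p : ℕ) (x : ExteriorAlgebra R M), x ∈ ⋀[R]^p M → Prop}
    (algebraMap : ∀ r, C 0 (algebraMap R _ r) (by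
      rw [ExteriorAlgebra.exteriorPower, pow_zero]; exact Submodule.algebraMap_mem r))
    (add : ∀ p x y hx hy, C p x hx → C p y hy → C p (x + y) (add_mem hx hy))
    (ι_mul : ∀ p m x hx, C p x hx → C (p + 1) (ExteriorAlgebra.ι R m * x) (by
      rw [add_comm]; exact exteriorPower_mul_mem (ι_mem_exteriorPower_one m) hx))
    {p : ℕ} {x : ExteriorAlgebra R M} (hx : x ∈ ⋀[R]^p M) : C p x hx := by
  induction hx using Submodule.pow_induction_on_left' with
  | algebraMap r => exact algebraMap r
  | add x y i hx hy h1 h2 => exact add _ _ _ hx hy h1 h2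
  | mem_mul m hm i x hx h => obtain ⟨m, rfl⟩ := hm; exact ι_mul _ _ _ hx h

theorem ι_mul_eq_smul_mul_ι {q : ℕ} {y : ExteriorAlgebra R M} (hy : y ∈ ⋀[R]^q M) (m : M) :
    ExteriorAlgebra.ι R m * y = Int.negOnePow q • (y * ExteriorAlgebra.ι R m) := by
  induction hy using exteriorPower_induction with
  | algebraMap r => simpa using (Algebra.commutes r _).symm
  | add p x y _ _ h1 h2 => rw [mul_add, h1, h2, add_mul, smul_add]
  | ι_mul p m' x hx h =>
    have h' := ExteriorAlgebra.ι_add_mul_swap (R := R) m m'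
    rw [← mul_assoc, eq_neg_of_add_eq_zero_left h', neg_mul, mul_assoc, h, mul_smul_comm, mul_assoc]
    push_cast
    rw [Int.negOnePow_succ, Units.neg_smul]

/-- The exterior algebra is graded commutative. -/
theorem exteriorPower_mul_comm {p q : ℕ} {x y : ExteriorAlgebra R M} (hx : x ∈ ⋀[R]^p M)
    (hy : y ∈ ⋀[R]^q M) : x * y = Int.negOnePow (p * q) • (y * x) := by
  induction hx using exteriorPower_induction with
  | algebraMap r => simpa using Algebra.commutes r _
  | add p x y _ _ h1 h2 => rw [add_mul, h1, h2, mul_add, smul_add]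
  | ι_mul p m x hx h =>
    rw [mul_assoc, h, mul_smul_comm, ← mul_assoc, ι_mul_eq_smul_mul_ι hy, smul_mul_assoc,
      smul_smul, mul_assoc, ← Int.negOnePow_add]
    push_cast
    rw [add_mul, one_mul]

theorem involute_exteriorPower {p : ℕ} {x : ExteriorAlgebra R M} (hx : x ∈ ⋀[R]^p M) :
    CliffordAlgebra.involute x = Int.negOnePow p • x := by
  induction hx using exteriorPower_induction with
  | algebraMap r =>
    simp [(CliffordAlgebra.involute (Q := (0 : QuadraticForm R M))).commutes r]
  | add p x y _ _ h1 h2 => rw [map_add, h1, h2, smul_add]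
  | ι_mul p m x hx h =>
    rw [map_mul, h, mul_smul_comm]
    have : CliffordAlgebra.involute (ExteriorAlgebra.ι R m) = -ExteriorAlgebra.ι R m :=
      CliffordAlgebra.involute_ι m
    rw [this]
    push_cast
    rw [Int.negOnePow_succ, Units.neg_smul, neg_mul, smul_neg]

/-- Contractions are odd derivations of the exterior algebra. -/
theorem contractLeft_mul (θ : Module.Dual R M) (x y : ExteriorAlgebra R M) :
    CliffordAlgebra.contractLeft (Q := (0 : QuadraticForm R M)) θ (x * y) =
      CliffordAlgebra.contractLeft (Q := (0 : QuadraticForm R M)) θ x * y +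
        CliffordAlgebra.involute x *
          CliffordAlgebra.contractLeft (Q := (0 : QuadraticForm R M)) θ y := by
  induction x using CliffordAlgebra.left_induction with
  | algebraMap r =>
    rw [CliffordAlgebra.contractLeft_algebraMap_mul, CliffordAlgebra.contractLeft_algebraMap,
      AlgHom.commutes, zero_mul, zero_add]
  | add a b ha hb => simp only [add_mul, map_add, ha, hb]; abel
  | ι_mul x m hx =>
    rw [mul_assoc, CliffordAlgebra.contractLeft_ι_mul, CliffordAlgebra.contractLeft_ι_mul, hx,
      map_mul, CliffordAlgebra.involute_ι]
    simp only [mul_add, sub_mul, smul_mul_assoc, mul_assoc, neg_mul]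
    abel

/-- Contractions lower the degree by one; in degree zero, where `p - 1` truncates, they vanish. -/
theorem contractLeft_mem {p : ℕ} (θ : Module.Dual R M) {x : ExteriorAlgebra R M}
    (hx : x ∈ ⋀[R]^p M) :
    CliffordAlgebra.contractLeft (Q := (0 : QuadraticForm R M)) θ x ∈ ⋀[R]^(p - 1) M := by
  suffices h : ∀ q, p = q + 1 →
      CliffordAlgebra.contractLeft (Q := (0 : QuadraticForm R M)) θ x ∈ ⋀[R]^q M by
    cases p with
    | zero =>
      obtain ⟨r, rfl⟩ := Submodule.mem_one.1 (by simpa [ExteriorAlgebra.exteriorPower] using hx)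
      erw [CliffordAlgebra.contractLeft_algebraMap]
      exact zero_mem _
    | succ p => exact h p rfl
  induction hx using exteriorPower_induction with
  | algebraMap r => intro q h; omega
  | add p x y _ _ h1 h2 => intro q h; rw [map_add]; exact add_mem (h1 q h) (h2 q h)
  | ι_mul p m x hx h =>
    intro q hq
    obtain rfl : p = q := by omega
    erw [CliffordAlgebra.contractLeft_ι_mul]
    refine sub_mem (Submodule.smul_mem _ _ hx) ?_
    cases p with
    | zero =>
      obtain ⟨r, rfl⟩ := Submodule.mem_one.1 (by simpa [ExteriorAlgebra.exteriorPower] using hx)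
      erw [CliffordAlgebra.contractLeft_algebraMap, mul_zero]
      exact zero_mem _
    | succ p =>
      rw [add_comm]
      exact exteriorPower_mul_mem (ι_mem_exteriorPower_one m) (h p rfl)

end Exterior

/-! ### Contractions and the flat connection on polyvector fields -/

section Nabla

variable {d : ℕ}

theorem pderiv_pderiv_comm {σ A : Type*} [CommRing A] (i j : σ) (f : MvPolynomial σ A) :
    pderiv i (pderiv j f) = pderiv j (pderiv i f) := by
  classical
  let D (i : σ) : Derivation A (MvPolynomial σ A) (MvPolynomial σ A) := pderiv i
  have h : ⁅D i, D j⁆ = 0 := derivation_ext fun k => by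
    rw [Derivation.commutator_apply]
    simp [D, pderiv_X, Pi.single_apply, apply_ite]
  have := congrArg (fun D => D f) h
  simpa [Derivation.commutator_apply, sub_eq_zero] using this

theorem derivation_eq_sum (D : VF d) (f : PolyFun d) : D f = ∑ i, D (X i) * pderiv i f := by
  have hs : ∀ g : PolyFun d, (∑ i, D (X i) • (pderiv i : VF d)) g = ∑ i, D (X i) * pderiv i g :=
    fun g => map_sum (dForm g) _ _
  have : D = ∑ i, D (X i) • (pderiv i : VF d) := derivation_ext fun k => by
    rw [hs]; simp [pderiv_X, Pi.single_apply]
  conv_lhs => rw [this]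
  exact hs f

theorem contract_eq_sum (f : PolyFun d) (P : PV d) :
    contract f P = ∑ i, pderiv i f • contract (X i) P := by
  have : dForm f = ∑ i, pderiv i f • dForm (X i : PolyFun d) := by
    refine LinearMap.ext fun D => ?_
    rw [LinearMap.sum_apply]
    change D f = ∑ i, pderiv i f * D (X i)
    rw [derivation_eq_sum]
    exact Finset.sum_congr rfl fun i _ => mul_comm _ _
  simp [contract, this]

theorem contract_contract (f g : PolyFun d) (P : PV d) :
    contract f (contract g P) = -contract g (contract f P) :=
  CliffordAlgebra.contractLeft_comm (Q := (0 : QuadraticForm (PolyFun d) (VF d))) _ _ P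

theorem contract_mul (f : PolyFun d) (P Q : PV d) :
    contract f (P * Q) = contract f P * Q + CliffordAlgebra.involute P * contract f Q :=
  contractLeft_mul _ _ _

theorem contract_mem {p : ℕ} (f : PolyFun d) {P : PV d} (hP : P ∈ ⋀[PolyFun d]^p (VF d)) :
    contract f P ∈ ⋀[PolyFun d]^(p - 1) (VF d) :=
  contractLeft_mem _ hP

theorem contract_ι (f : PolyFun d) (Y : VF d) :
    contract f (ExteriorAlgebra.ι (PolyFun d) Y) = algebraMap (PolyFun d) (PV d) (Y f) :=
  CliffordAlgebra.contractLeft_ι (Q := (0 : QuadraticForm (PolyFun d) (VF d))) _ _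

theorem contract_ι_mul (f : PolyFun d) (Y : VF d) (P : PV d) :
    contract f (ExteriorAlgebra.ι (PolyFun d) Y * P) =
      Y f • P - ExteriorAlgebra.ι (PolyFun d) Y * contract f P :=
  CliffordAlgebra.contractLeft_ι_mul (Q := (0 : QuadraticForm (PolyFun d) (VF d))) _ _ _

theorem contract_algebraMap (f r : PolyFun d) :
    contract f (algebraMap (PolyFun d) (PV d) r) = 0 :=
  CliffordAlgebra.contractLeft_algebraMap (Q := (0 : QuadraticForm (PolyFun d) (VF d))) _ _

/-- A property of polyvector fields stable under sums and under multiples by functions holds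
everywhere if it holds for the `∂_I`. -/
theorem pv_induction {C : PV d → Prop} (basis : ∀ I, C (pvBasis d I))
    (add : ∀ P Q, C P → C Q → C (P + Q)) (smul : ∀ (f : PolyFun d) P, C P → C (f • P)) (P : PV d) :
    C P := by
  have h : P ∈ Submodule.span (PolyFun d) (Set.range (pvBasis d)) := by
    rw [(pvBasis d).span_eq]; trivial
  induction h using Submodule.span_induction with
  | mem x hx => obtain ⟨I, rfl⟩ := hx; exact basis I
  | zero => simpa using smul 0 _ (basis ∅)
  | add x y _ _ h1 h2 => exact add _ _ h1 h2
  | smul f x _ h => exact smul _ _ h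

theorem pvBasis_empty : pvBasis d ∅ = 1 := by
  rw [ExteriorAlgebra.basis_apply_ofCard (vfBasis d) (n := 0) rfl]
  simp [ExteriorAlgebra.ιMulti_family]

theorem pvBasis_singleton (i : Fin d) :
    pvBasis d {i} = ExteriorAlgebra.ι (PolyFun d) (vfBasis d i) := by
  rw [ExteriorAlgebra.basis_apply_ofCard (vfBasis d) (n := 1) (Finset.card_singleton i)]
  have : ∀ k, Set.powersetCard.ofFinEmbEquiv.symm
      (Set.powersetCard.ofCard (Finset.card_singleton i)) k = i := by
    intro k
    exact Finset.mem_singleton.1 ((Set.powersetCard.mem_range_ofFinEmbEquiv_symm_iff_mem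
      (Set.powersetCard.ofCard (Finset.card_singleton i)) _).1 ⟨k, rfl⟩)
  simp [ExteriorAlgebra.ιMulti_family, ExteriorAlgebra.ιMulti_apply, this]

theorem coeffDeriv_apply (Y : VF d) (P : PV d) :
    coeffDeriv Y P = ∑ I, Y ((pvBasis d).repr P I) • pvBasis d I := rfl

@[simp] theorem coeffDeriv_basis (Y : VF d) (I : Finset (Fin d)) :
    coeffDeriv Y (pvBasis d I) = 0 := by
  rw [coeffDeriv_apply]
  refine Finset.sum_eq_zero fun J _ => ?_
  rw [Module.Basis.repr_self, Finsupp.single_apply]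
  split_ifs <;> simp

theorem coeffDeriv_smul (Y : VF d) (f : PolyFun d) (P : PV d) :
    coeffDeriv Y (f • P) = Y f • P + f • coeffDeriv Y P := by
  have hP : Y f • P = ∑ I, Y f • (pvBasis d).repr P I • pvBasis d I := by
    rw [← Finset.smul_sum, Module.Basis.sum_repr]
  rw [hP]
  simp only [coeffDeriv_apply, Finset.smul_sum, ← Finset.sum_add_distrib]
  refine Finset.sum_congr rfl fun I _ => ?_
  rw [map_smul, Finsupp.smul_apply, smul_eq_mul, Derivation.leibniz, add_smul, smul_smul,
    smul_eq_mul, smul_eq_mul, smul_smul, mul_comm (Y f), add_comm]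

theorem smul_coeffDeriv (f : PolyFun d) (Y : VF d) (P : PV d) :
    coeffDeriv (f • Y) P = f • coeffDeriv Y P := by
  simp only [coeffDeriv_apply, Finset.smul_sum, Derivation.smul_apply, smul_eq_mul, mul_smul]

/-- Products of the `∂_I` have constant coefficients. -/
theorem coeffDeriv_basis_mul (Y : VF d) (I J : Finset (Fin d)) :
    coeffDeriv Y (pvBasis d I * pvBasis d J) = 0 := by
  let s : Set.powersetCard (Fin d) I.card := Set.powersetCard.ofCard rfl
  let t : Set.powersetCard (Fin d) J.card := Set.powersetCard.ofCard rfl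
  by_cases h : Disjoint s.val t.val
  · have := ExteriorAlgebra.basis_mul_of_disjoint (vfBasis d) s t h
    change pvBasis d I * pvBasis d J = _ at this
    rw [this]
    rcases Int.units_eq_one_or (Set.powersetCard.permOfDisjoint h).sign with h | h <;> simp [h]
  · have := ExteriorAlgebra.basis_mul_of_not_disjoint (vfBasis d) s t h
    change pvBasis d I * pvBasis d J = _ at this
    rw [this, map_zero]

theorem coeffDeriv_mul (Y : VF d) (P Q : PV d) :
    coeffDeriv Y (P * Q) = coeffDeriv Y P * Q + P * coeffDeriv Y Q := by
  induction P using pv_induction with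
  | add P P' h h' => simp only [add_mul, map_add, h, h']; abel
  | smul f P h =>
    simp only [smul_mul_assoc, coeffDeriv_smul, h, add_mul, smul_add]; abel
  | basis I =>
    induction Q using pv_induction with
    | add P P' h h' => simp only [mul_add, map_add, h, h']; abel
    | smul f P h =>
      simp only [mul_smul_comm, coeffDeriv_smul, h, mul_add, smul_add]; abel
    | basis J => simp [coeffDeriv_basis_mul]

theorem coeffDeriv_algebraMap (Y : VF d) (f : PolyFun d) :
    coeffDeriv Y (algebraMap (PolyFun d) (PV d) f) = algebraMap (PolyFun d) (PV d) (Y f) := by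
  rw [Algebra.algebraMap_eq_smul_one, Algebra.algebraMap_eq_smul_one, ← pvBasis_empty,
    coeffDeriv_smul, coeffDeriv_basis, smul_zero, add_zero]

/-- The coefficientwise derivative of vector fields. -/
def vfDeriv (Y Z : VF d) : VF d := mkDerivation ℂ fun i => Y (Z (X i))

theorem vfDeriv_X (Y Z : VF d) (i : Fin d) : vfDeriv Y Z (X i) = Y (Z (X i)) := by
  simp [vfDeriv]

theorem vfDeriv_sub_vfDeriv (Y Z : VF d) : vfDeriv Y Z - vfDeriv Z Y = ⁅Y, Z⁆ :=
  derivation_ext fun i => by simp [vfDeriv_X, Derivation.commutator_apply]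

theorem coeffDeriv_ι (Y Z : VF d) :
    coeffDeriv Y (ExteriorAlgebra.ι (PolyFun d) Z) =
      ExteriorAlgebra.ι (PolyFun d) (vfDeriv Y Z) := by
  have h : ∀ Z : VF d, Z = ∑ i, Z (X i) • vfBasis d i := fun Z =>
    ((vfBasis d).sum_repr Z).symm
  have h1 : ∀ i, coeffDeriv Y (ExteriorAlgebra.ι (PolyFun d) (vfBasis d i)) = 0 := fun i => by
    rw [← pvBasis_singleton, coeffDeriv_basis]
  conv_lhs => rw [h Z]
  conv_rhs => rw [h (vfDeriv Y Z)]
  simp only [map_sum, map_smul, coeffDeriv_smul, h1, smul_zero, add_zero, vfDeriv_X]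

theorem coeffDeriv_mem {p : ℕ} (Y : VF d) {P : PV d} (hP : P ∈ ⋀[PolyFun d]^p (VF d)) :
    coeffDeriv Y P ∈ ⋀[PolyFun d]^p (VF d) := by
  induction hP using exteriorPower_induction with
  | algebraMap r =>
    rw [coeffDeriv_algebraMap, ExteriorAlgebra.exteriorPower, pow_zero]
    exact Submodule.algebraMap_mem _
  | add p P Q _ _ h1 h2 => rw [map_add]; exact add_mem h1 h2
  | ι_mul p m P hP h =>
    rw [coeffDeriv_mul, coeffDeriv_ι, add_comm p]
    exact add_mem (exteriorPower_mul_mem (ι_mem_exteriorPower_one _) hP)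
      (exteriorPower_mul_mem (ι_mem_exteriorPower_one _) h)

theorem coeffDeriv_contract (Y : VF d) (i : Fin d) (P : PV d) :
    coeffDeriv Y (contract (X i) P) = contract (X i) (coeffDeriv Y P) := by
  induction P using CliffordAlgebra.left_induction with
  | algebraMap r =>
    change coeffDeriv Y (contract (X i) (algebraMap _ (PV d) r)) =
      contract (X i) (coeffDeriv Y (algebraMap _ (PV d) r))
    rw [contract_algebraMap, coeffDeriv_algebraMap, contract_algebraMap, map_zero]
  | add a b ha hb => simp only [map_add, ha, hb]
  | ι_mul P m h =>
    change coeffDeriv Y (contract (X i) (ExteriorAlgebra.ι _ m * P)) =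
      contract (X i) (coeffDeriv Y (ExteriorAlgebra.ι _ m * P))
    rw [coeffDeriv_mul, coeffDeriv_ι, map_add, contract_ι_mul, contract_ι_mul, contract_ι_mul,
      map_sub, coeffDeriv_smul, coeffDeriv_mul, coeffDeriv_ι, h, vfDeriv_X]
    abel

/-- The coefficientwise derivative is a flat connection. -/
theorem coeffDeriv_lie (Y Z : VF d) (P : PV d) :
    coeffDeriv ⁅Y, Z⁆ P = coeffDeriv Y (coeffDeriv Z P) - coeffDeriv Z (coeffDeriv Y P) := by
  induction P using pv_induction with
  | basis I => simp
  | add P Q h1 h2 => simp only [map_add, h1, h2]; abel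
  | smul f P h =>
    simp only [coeffDeriv_smul, map_add, h, Derivation.commutator_apply, sub_smul, smul_sub]
    abel

end Nabla

/-! ### Shuffles -/

section Shuffle

/-- The set of the first `i` values of a permutation. -/
def headSet {n : ℕ} (i : ℕ) (σ : Equiv.Perm (Fin n)) : Finset (Fin n) :=
  (Finset.univ.filter fun a : Fin n => a.val < i).map σ.toEmbedding

theorem apply_mem_headSet {n i : ℕ} {σ : Equiv.Perm (Fin n)} {a : Fin n} :
    σ a ∈ headSet i σ ↔ a.val < i := by
  simp [headSet]

/-- A shuffle is determined by the set of its first values. -/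
theorem isShuffle_ext {n i : ℕ} {σ τ : Equiv.Perm (Fin n)} (hσ : IsShuffle i σ)
    (hτ : IsShuffle i τ) (h : headSet i σ = headSet i τ) : σ = τ := by
  have key : StrictMono (fun a => τ.symm (σ a)) := by
    intro a b hab
    have hiff : ∀ a, (τ.symm (σ a)).val < i ↔ a.val < i := fun a => by
      rw [← apply_mem_headSet (σ := τ), Equiv.apply_symm_apply, ← h, apply_mem_headSet]
    by_cases hc : b.val < i ∨ i ≤ a.val
    · by_contra hlt
      rw [not_lt] at hlt
      have hne : τ.symm (σ b) ≠ τ.symm (σ a) := fun h' =>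
        hab.ne' (σ.injective (τ.symm.injective h'))
      have := hτ _ _ (lt_of_le_of_ne hlt hne) (by
        rcases hc with hc | hc
        · exact Or.inl ((hiff a).2 (lt_trans hab hc))
        · exact Or.inr (not_lt.1 fun h' => by
            have := (hiff b).1 h'
            have : a.val < b.val := hab
            omega))
      rw [Equiv.apply_symm_apply, Equiv.apply_symm_apply] at this
      exact lt_asymm this (hσ a b hab hc)
    · push Not at hc
      have h1 := (hiff a).2 hc.2
      have h2 := mt (hiff b).1 (not_lt.2 hc.1)
      change (τ.symm (σ a)).val < (τ.symm (σ b)).val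
      omega
  have h2 : (fun a => τ.symm (σ a)) = id := by
    have := Subsingleton.elim (StrictMono.orderIsoOfSurjective _ key
      (τ.symm.surjective.comp σ.surjective)) (OrderIso.refl _)
    funext a
    exact congrArg (fun e : Fin n ≃o Fin n => e a) this
  ext1 a
  have := congrFun h2 a
  simpa using congrArg τ this

/-- Every subset is the set of first values of a shuffle. -/
theorem exists_isShuffle {n : ℕ} (S : Finset (Fin n)) :
    ∃ σ : Equiv.Perm (Fin n), IsShuffle S.card σ ∧ headSet S.card σ = S := by
  have hc : S.card + Sᶜ.card = n := by rw [Finset.card_add_card_compl, Fintype.card_fin]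
  let e := finSumEquivOfFinset (s := S) rfl (rfl : Sᶜ.card = Sᶜ.card)
  let σ : Equiv.Perm (Fin n) := (finCongr hc.symm).trans (finSumFinEquiv.symm.trans e)
  have hl : ∀ a (h : a.val < S.card), σ a = S.orderEmbOfFin rfl ⟨a, h⟩ := by
    intro a h
    have : (finCongr hc.symm) a = finSumFinEquiv (Sum.inl ⟨a, h⟩) := by ext; simp
    change e (finSumFinEquiv.symm ((finCongr hc.symm) a)) = _
    rw [this, Equiv.symm_apply_apply]
    simp [e]
  have hr : ∀ a (h : S.card ≤ a.val), σ a = Sᶜ.orderEmbOfFin rfl ⟨a - S.card, by omega⟩ := by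
    intro a h
    have : (finCongr hc.symm) a = finSumFinEquiv (Sum.inr ⟨a - S.card, by omega⟩) := by
      ext; simp; omega
    change e (finSumFinEquiv.symm ((finCongr hc.symm) a)) = _
    rw [this, Equiv.symm_apply_apply]
    simp [e]
  refine ⟨σ, ?_, ?_⟩
  · rintro a b hab (h | h)
    · have : a.val < b.val := hab
      rw [hl a (by omega), hl b h]
      exact (S.orderEmbOfFin rfl).strictMono hab
    · have hab' : a.val < b.val := hab
      rw [hr a h, hr b (by omega)]
      exact (Sᶜ.orderEmbOfFin rfl).strictMono (Fin.lt_def.2 (by simp; omega))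
  · refine Finset.eq_of_subset_of_card_le (fun x hx => ?_) ?_
    · obtain ⟨a, rfl⟩ := σ.surjective x
      rw [apply_mem_headSet] at hx
      rw [hl a hx]
      exact Finset.orderEmbOfFin_mem _ _ _
    · rw [headSet, Finset.card_map, Fin.card_filter_val_lt]
      omega

theorem card_headSet {n i : ℕ} (hi : i ≤ n) (σ : Equiv.Perm (Fin n)) :
    (headSet i σ).card = i := by
  rw [headSet, Finset.card_map, Fin.card_filter_val_lt]; omega

open Classical in
/-- Sums over all shuffles are sums over the nonempty subsets. -/
theorem sum_isShuffle {V : Type*} [AddCommMonoid V] {n : ℕ} (F : Finset (Fin n) → V) :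
    ∑ i : Fin n, ∑ σ ∈ (Finset.univ : Finset (Equiv.Perm (Fin n))).filter (IsShuffle (i.val + 1)),
      F (headSet (i.val + 1) σ) = ∑ S ∈ Finset.univ.filter (·.Nonempty), F S := by
  rw [Finset.sum_sigma']
  refine Finset.sum_bij (fun p _ => headSet (p.1.val + 1) p.2) ?_ ?_ ?_ (fun _ _ => rfl)
  · intro p hp
    rw [Finset.mem_filter, ← Finset.card_pos, card_headSet p.1.isLt]
    simp
  · rintro ⟨i, σ⟩ hp ⟨j, τ⟩ hq h
    have hij : i = j := by
      have := congrArg Finset.card h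
      simp only [card_headSet i.isLt, card_headSet j.isLt] at this
      exact Fin.ext (by omega)
    subst hij
    simp only [Finset.mem_sigma, Finset.mem_filter, Finset.mem_univ, true_and] at hp hq
    rw [isShuffle_ext hp hq h]
  · intro S hS
    simp only [Finset.mem_filter, Finset.mem_univ, true_and] at hS
    obtain ⟨σ, h1, h2⟩ := exists_isShuffle S
    have hpos := Finset.card_pos.2 hS
    have hle : S.card ≤ n := by simpa using Finset.card_le_univ S
    have he : S.card - 1 + 1 = S.card := by omega
    refine ⟨⟨⟨S.card - 1, by omega⟩, σ⟩, ?_, ?_⟩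
    · simpa [he] using h1
    · simpa [he] using h2

end Shuffle

/-! ### Products with one factor replaced -/

section Replace

variable {B : Type*} [Ring B]

/-- The sum over `l` of the ordered products in which the `l`-th factor is `z l`, the earlier
factors are taken from `y'` and the later ones from `y`. -/
def replaceSum : (n : ℕ) → (y' y z : Fin n → B) → B
  | 0, _, _, _ => 0
  | n + 1, y', y, z =>
    y' 0 * replaceSum n (fun k => y' k.succ) (fun k => y k.succ) (fun k => z k.succ) +
      z 0 * (List.ofFn fun k : Fin n => y k.succ).prod

theorem replaceSum_add {n : ℕ} (y' y z z' : Fin n → B) :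
    replaceSum n y' y (z + z') = replaceSum n y' y z + replaceSum n y' y z' := by
  induction n with
  | zero => simp [replaceSum]
  | succ n ih =>
    have := ih (fun k => y' k.succ) (fun k => y k.succ) (fun k => z k.succ) (fun k => z' k.succ)
    simp only [replaceSum, Pi.add_apply] at this ⊢
    rw [← Pi.add_def, this, mul_add, add_mul]
    abel

/-- `replaceSum` as an additive map in the replaced factors. -/
def replaceSumHom {n : ℕ} (y' y : Fin n → B) : (Fin n → B) →+ B :=
  AddMonoidHom.mk' (replaceSum n y' y) (replaceSum_add y' y)

/-- If only the `l`-th factor is replaced, the original values of that factor do not matter. -/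
theorem replaceSum_congr_single {n : ℕ} (y' y v' v : Fin n → B) (l : Fin n) (b : B)
    (h' : ∀ k, k ≠ l → y' k = v' k) (h : ∀ k, k ≠ l → y k = v k) :
    replaceSum n y' y (Pi.single l b) = replaceSum n v' v (Pi.single l b) := by
  induction n with
  | zero => rfl
  | succ n ih =>
    induction l using Fin.cases with
    | zero =>
      have hz : (fun k : Fin n => (Pi.single 0 b : Fin (n + 1) → B) k.succ) = 0 := by
        funext k; simp [Fin.succ_ne_zero]
      have h0 : ∀ u' u : Fin n → B, replaceSum n u' u 0 = 0 := fun u' u =>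
        (replaceSumHom u' u).map_zero
      have hy : (fun k : Fin n => y k.succ) = fun k => v k.succ :=
        funext fun k => h _ (Fin.succ_ne_zero k)
      simp only [replaceSum, hz, h0, hy, mul_zero]
    | succ l =>
      have hz : (fun k : Fin n => (Pi.single l.succ b : Fin (n + 1) → B) k.succ) =
          Pi.single l b := by
        funext k; simp [Pi.single_apply]
      have h0 : (Pi.single l.succ b : Fin (n + 1) → B) 0 = 0 := by
        simp [(Fin.succ_ne_zero l).symm]
      simp only [replaceSum, hz, h0, zero_mul, add_zero]
      rw [h' 0 (Fin.succ_ne_zero l).symm]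
      congr 1
      exact ih _ _ _ _ l (fun k hk => h' _ fun e => hk (Fin.succ_injective _ e))
        (fun k hk => h _ fun e => hk (Fin.succ_injective _ e))

theorem prod_ofFn_upperTriangular {n : ℕ} (y' y z : Fin n → B) :
    (List.ofFn fun k => (!![y' k, z k; 0, y k] : Matrix (Fin 2) (Fin 2) B)).prod =
      !![(List.ofFn y').prod, replaceSum n y' y z; 0, (List.ofFn y).prod] := by
  induction n with
  | zero => ext i j; fin_cases i <;> fin_cases j <;> simp [replaceSum]
  | succ n ih =>
    rw [List.ofFn_succ, List.prod_cons, ih]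
    simp [replaceSum]

end Replace

/-! ### The untruncated brackets -/

section Untruncated

variable {d : ℕ}

/-- Partial derivatives commute, which allows to iterate them along a multiset. -/
instance leftCommutative_pderiv :
    LeftCommutative fun (j : Fin d) (f : PolyFun d) => pderiv j f :=
  ⟨fun i j f => pderiv_pderiv_comm i j f⟩

/-- The iterated partial derivative of `φ` along a multiset of coordinates. -/
def multiPartial (φ : PolyFun d) (s : Multiset (Fin d)) : PolyFun d :=
  s.foldr (fun j f => pderiv j f) φ

theorem multiPartial_cons (φ : PolyFun d) (j : Fin d) (s : Multiset (Fin d)) :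
    multiPartial φ (j ::ₘ s) = pderiv j (multiPartial φ s) :=
  Multiset.foldr_cons _ _ _ _

theorem iterPartial_eq_multiPartial {n : ℕ} (φ : PolyFun d) (w : Fin n → Fin d) :
    iterPartial φ w = multiPartial φ (Finset.univ.val.map w) := by
  rw [Fin.univ_val_map]
  exact (Multiset.coe_foldr _ _ _).symm

theorem iterPartial_cons {n : ℕ} (φ : PolyFun d) (j : Fin d) (w : Fin n → Fin d) :
    iterPartial φ (Fin.cons j w : Fin (n + 1) → Fin d) = pderiv j (iterPartial φ w) := by
  simp [iterPartial, List.ofFn_succ]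

theorem iterPartial_comp_perm {n : ℕ} (φ : PolyFun d) (w : Fin n → Fin d)
    (σ : Equiv.Perm (Fin n)) : iterPartial φ (fun k => w (σ k)) = iterPartial φ w := by
  rw [iterPartial_eq_multiPartial, iterPartial_eq_multiPartial]
  congr 1
  have : (Finset.univ : Finset (Fin n)).val = Finset.univ.val.map σ := by
    conv_lhs => rw [← Finset.map_univ_equiv σ]
    rfl
  conv_rhs => rw [this, Multiset.map_map]
  rfl

/-- The bracket `(P₁, …, Pₙ) ↦ ∑ φ_{i₁ ⋯ iₙ} (ι_{dx_{i₁}} P₁) ∧ ⋯ ∧ (ι_{dx_{iₙ}} Pₙ)` on all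
polyvector fields, without projection on the components of order at least two. -/
def fullBracket (φ : PolyFun d) (n : ℕ) (x : Fin n → PV d) : PV d :=
  ∑ w : Fin n → Fin d, iterPartial φ w • (List.ofFn fun k => contract (X (w k)) (x k)).prod

/-- Graded commutativity, with the orders known only modulo two. -/
theorem exteriorPower_mul_comm_of_even {p q : ℕ} {a b : ℤ} (hp : Even (p - a)) (hq : Even (q - b))
    {P Q : PV d} (hP : P ∈ ⋀[PolyFun d]^p (VF d)) (hQ : Q ∈ ⋀[PolyFun d]^q (VF d)) :
    P * Q = Int.negOnePow (a * b) • (Q * P) := by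
  rw [exteriorPower_mul_comm hP hQ]
  congr 1
  rw [Int.negOnePow_eq_iff]
  obtain ⟨r, hr⟩ := hp
  obtain ⟨s, hs⟩ := hq
  refine ⟨r * b + a * s + 2 * r * s, ?_⟩
  rw [show (p : ℤ) = a + (r + r) by omega, show (q : ℤ) = b + (s + s) by omega]
  ring

/-- `P` is a polyvector field of order `|e + 1| + 2`. For `e ≤ -1` this is the order `1 - e` of the
elements of degree `e`; for the other values of `e` it is an order of the same parity that is at
least two, so that the sign rules hold for all integers `e`. -/
def HasDeg (P : PV d) (e : ℤ) : Prop := P ∈ ⋀[PolyFun d]^((e + 1).natAbs + 2) (VF d)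

theorem HasDeg.contract_mem {P : PV d} {e : ℤ} (h : HasDeg P e) (f : PolyFun d) :
    contract f P ∈ ⋀[PolyFun d]^((e + 1).natAbs + 1) (VF d) :=
  _root_.contract_mem f h

theorem HasDeg.contract_contract_mem {P : PV d} {e : ℤ} (h : HasDeg P e) (f g : PolyFun d) :
    contract f (contract g P) ∈ ⋀[PolyFun d]^((e + 1).natAbs) (VF d) :=
  _root_.contract_mem f (h.contract_mem g)

theorem even_natAbs_sub (e : ℤ) : Even (((e + 1).natAbs : ℤ) - (e + 1)) := by
  rw [Int.natCast_natAbs]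
  rcases abs_choice (e + 1) with h | h
  · exact ⟨0, by rw [h]; ring⟩
  · exact ⟨-(e + 1), by rw [h]; ring⟩

theorem even_natAbs_add_one_sub (e : ℤ) : Even ((((e + 1).natAbs + 1 : ℕ) : ℤ) - e) := by
  obtain ⟨r, hr⟩ := even_natAbs_sub e
  exact ⟨r + 1, by push_cast at hr ⊢; omega⟩

theorem HasDeg.involute_contract {P : PV d} {e : ℤ} (h : HasDeg P e) (f : PolyFun d) :
    CliffordAlgebra.involute (contract f P) = Int.negOnePow e • contract f P := by
  rw [involute_exteriorPower (h.contract_mem f)]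
  congr 1
  rw [Int.negOnePow_eq_iff]
  exact even_natAbs_add_one_sub e

variable {n : ℕ} {x : Fin n → PV d} {deg : Fin n → ℤ}

theorem contract_mul_comm (hx : ∀ k, HasDeg (x k) (deg k)) (w : Fin n → Fin d) (a b : Fin n) :
    contract (X (w a)) (x a) * contract (X (w b)) (x b) =
      Int.negOnePow (deg a * deg b) • (contract (X (w b)) (x b) * contract (X (w a)) (x a)) :=
  exteriorPower_mul_comm_of_even (even_natAbs_add_one_sub _) (even_natAbs_add_one_sub _)
    ((hx a).contract_mem _) ((hx b).contract_mem _)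

theorem fullBracket_comp_perm (φ : PolyFun d) (hx : ∀ k, HasDeg (x k) (deg k))
    (σ : Equiv.Perm (Fin n)) :
    fullBracket φ n (fun k => x (σ k)) = koszulSign σ deg • fullBracket φ n x := by
  unfold fullBracket
  rw [Finset.smul_sum]
  refine (Fintype.sum_equiv (Equiv.arrowCongr σ.symm (Equiv.refl (Fin d))) _ _ fun w => ?_).symm
  have h := prod_ofFn_comp_perm _ deg (contract_mul_comm hx w) σ
  have h2 : (Equiv.arrowCongr σ.symm (Equiv.refl (Fin d))) w = fun k => w (σ k) := rfl
  rw [h2, iterPartial_comp_perm, h, smul_comm]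

/-- The block matrix that turns the contraction by `f` into the upper right entry of a ring
homomorphism. -/
def contractMatrix (f : PolyFun d) (P : PV d) : Matrix (Fin 2) (Fin 2) (PV d) :=
  !![CliffordAlgebra.involute P, contract f P; 0, P]

theorem prod_ofFn_contractMatrix (f : PolyFun d) (y : Fin n → PV d) :
    (List.ofFn fun k => contractMatrix f (y k)).prod = contractMatrix f (List.ofFn y).prod := by
  induction n with
  | zero =>
    have : contract f (1 : PV d) = 0 := by
      simpa using contract_algebraMap f (1 : PolyFun d)
    ext i j; fin_cases i <;> fin_cases j <;> simp [contractMatrix, this]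
  | succ n ih =>
    rw [List.ofFn_succ, List.prod_cons, ih, List.ofFn_succ (f := y), List.prod_cons]
    simp [contractMatrix, contract_mul]
    abel

theorem prod_ofFn_diagonal (y : Fin n → PV d) :
    (List.ofFn fun k =>
      (!![CliffordAlgebra.involute (y k), 0; 0, y k] : Matrix (Fin 2) (Fin 2) (PV d))).prod =
      !![CliffordAlgebra.involute (List.ofFn y).prod, 0; 0, (List.ofFn y).prod] := by
  induction n with
  | zero => ext i j; fin_cases i <;> fin_cases j <;> simp
  | succ n ih =>
    rw [List.ofFn_succ, List.prod_cons, ih, List.ofFn_succ (f := y), List.prod_cons]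
    simp

/-- The sum over `l ∈ S` of the products of the `ι_{dx_{w k}} x_k` in which `ι_{dx_j}` is applied to
the `l`-th factor; the grading involution of the earlier factors accounts for the sign of moving the
odd operator `ι_{dx_j}` past them. -/
def contractOn (x : Fin n → PV d) (S : Finset (Fin n)) (j : Fin d) (w : Fin n → Fin d) : PV d :=
  replaceSum n (fun k => CliffordAlgebra.involute (contract (X (w k)) (x k)))
    (fun k => contract (X (w k)) (x k))
    (fun k => if k ∈ S then contract (X j) (contract (X (w k)) (x k)) else 0)

/-- The upper triangular matrices with diagonal entries `± ι_{dx_{w k}} x_k` and `ι_{dx_{w k}} x_k`, and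
with upper right entry `ι_{dx_j} ι_{dx_{w k}} x_k` or `0`, commute up to the same signs as the
`ι_{dx_{w k}} x_k`. -/
theorem contractMatrix_mul_comm (hx : ∀ k, HasDeg (x k) (deg k)) (S : Finset (Fin n)) (j : Fin d)
    (w : Fin n → Fin d) :
    let Y : Fin n → Matrix (Fin 2) (Fin 2) (PV d) := fun k =>
      !![CliffordAlgebra.involute (contract (X (w k)) (x k)),
        if k ∈ S then contract (X j) (contract (X (w k)) (x k)) else 0;
        0, contract (X (w k)) (x k)]
    ∀ a b, Y a * Y b = Int.negOnePow (deg a * deg b) • (Y b * Y a) := by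
  intro Y a b
  have hz : ∀ k, (if k ∈ S then contract (X j) (contract (X (w k)) (x k)) else 0) ∈
      ⋀[PolyFun d]^((deg k + 1).natAbs) (VF d) := fun k => by
    split_ifs
    · exact (hx k).contract_contract_mem _ _
    · exact zero_mem _
  have hyy := contract_mul_comm hx w a b
  have hyz : ∀ a b, contract (X (w a)) (x a) *
      (if b ∈ S then contract (X j) (contract (X (w b)) (x b)) else 0) =
      Int.negOnePow (deg a * (deg b + 1)) •
        ((if b ∈ S then contract (X j) (contract (X (w b)) (x b)) else 0) *
          contract (X (w a)) (x a)) := fun a b =>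
    exteriorPower_mul_comm_of_even (even_natAbs_add_one_sub _) (even_natAbs_sub _)
      ((hx a).contract_mem _) (hz b)
  have hs : ∀ s t : ℤ, Int.negOnePow (s * (t + 1)) = Int.negOnePow (s * t) * Int.negOnePow s :=
    fun s t => by rw [mul_add, mul_one, Int.negOnePow_add]
  simp only [Y, (hx _).involute_contract]
  simp only [Matrix.mul_fin_two, zero_mul, mul_zero, add_zero, zero_add, smul_mul_assoc,
    mul_smul_comm]
  rw [hyz a b, hyz b a, hyy, hs, hs, mul_comm (deg b) (deg a)]
  generalize (if a ∈ S then contract (X j) (contract (X (w a)) (x a)) else 0) *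
    contract (X (w b)) (x b) = A
  generalize (if b ∈ S then contract (X j) (contract (X (w b)) (x b)) else 0) *
    contract (X (w a)) (x a) = A'
  generalize contract (X (w b)) (x b) * contract (X (w a)) (x a) = A''
  rcases Int.units_eq_one_or (deg a).negOnePow with h1 | h1 <;>
    rcases Int.units_eq_one_or (deg b).negOnePow with h2 | h2 <;>
    rcases Int.units_eq_one_or (deg a * deg b).negOnePow with h3 | h3 <;>
    rw [h1, h2, h3] <;> ext i k <;> fin_cases i <;> fin_cases k <;> simp <;> abel

end Untruncated

/-! ### The Jacobi identity of the untruncated brackets -/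

section FullJacobi

variable {d : ℕ} {n : ℕ}

theorem fullBracket_cons (φ : PolyFun d) (r : ℕ) (P : PV d) (y : Fin r → PV d) :
    fullBracket φ (r + 1) (Fin.cons P y) =
      ∑ j, ∑ v : Fin r → Fin d, pderiv j (iterPartial φ v) •
        (contract (X j) P * (List.ofFn fun k => contract (X (v k)) (y k)).prod) := by
  unfold fullBracket
  rw [← (Fin.consEquiv fun _ => Fin d).sum_comp, Fintype.sum_prod_type]
  refine Finset.sum_congr rfl fun j _ => Finset.sum_congr rfl fun v _ => ?_
  simp [Fin.consEquiv, iterPartial_cons, List.ofFn_succ]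

/-- The term of the Jacobi identity attached to a set `S` of inner arguments. -/
def jacobiTerm (φ : PolyFun d) (x : Fin n → PV d) (S : Finset (Fin n)) : PV d :=
  ∑ j, ∑ w : Fin n → Fin d, (pderiv j (multiPartial φ (Sᶜ.val.map w)) *
    multiPartial φ (S.val.map w)) • contractOn x S j w

theorem headSet_add (m r : ℕ) (σ : Equiv.Perm (Fin (m + r))) :
    headSet m σ = Finset.univ.map ((Fin.castAddEmb r).trans σ.toEmbedding) := by
  ext a
  obtain ⟨a, rfl⟩ := σ.surjective a
  rw [apply_mem_headSet]
  simp only [Finset.mem_map, Finset.mem_univ, true_and, Function.Embedding.trans_apply,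
    Equiv.coe_toEmbedding, EmbeddingLike.apply_eq_iff_eq]
  exact ⟨fun h => ⟨⟨a, h⟩, rfl⟩, by rintro ⟨b, rfl⟩; exact b.isLt⟩

theorem compl_headSet_add (m r : ℕ) (σ : Equiv.Perm (Fin (m + r))) :
    (headSet m σ)ᶜ = Finset.univ.map ((Fin.natAddEmb m).trans σ.toEmbedding) := by
  ext a
  obtain ⟨a, rfl⟩ := σ.surjective a
  rw [Finset.mem_compl, apply_mem_headSet]
  simp only [Finset.mem_map, Finset.mem_univ, true_and, Function.Embedding.trans_apply,
    Equiv.coe_toEmbedding, EmbeddingLike.apply_eq_iff_eq]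
  refine ⟨fun h => ⟨⟨a - m, by omega⟩, Fin.ext ?_⟩, by rintro ⟨b, rfl⟩; simp⟩
  simp; omega

/-- Splitting a multi-index along a permutation. -/
def splitEquiv (m r : ℕ) (σ : Equiv.Perm (Fin (m + r))) :
    (Fin (m + r) → Fin d) ≃ (Fin m → Fin d) × (Fin r → Fin d) :=
  (Equiv.arrowCongr (finSumFinEquiv.trans σ).symm (Equiv.refl _)).trans
    (Equiv.sumArrowEquivProdArrow _ _ _)

/-- The `ι_{dx_j}`-derivative of the product of the first `m` factors of a permuted product, times the
remaining factors, put back in the original order. -/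
theorem koszulSign_smul_contractOn (m r : ℕ) {x : Fin (m + r) → PV d} {deg : Fin (m + r) → ℤ}
    (hx : ∀ k, HasDeg (x k) (deg k)) (σ : Equiv.Perm (Fin (m + r))) (j : Fin d)
    (w : Fin (m + r) → Fin d) :
    koszulSign σ deg • (contract (X j) (List.ofFn fun a : Fin m =>
        contract (X (w (σ (Fin.castAdd r a)))) (x (σ (Fin.castAdd r a)))).prod *
      (List.ofFn fun b : Fin r =>
        contract (X (w (σ (Fin.natAdd m b)))) (x (σ (Fin.natAdd m b)))).prod) =
    contractOn x (headSet m σ) j w := by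
  have h := prod_ofFn_comp_perm _ deg (contractMatrix_mul_comm hx (headSet m σ) j w) σ
  have h2 : (List.ofFn fun k : Fin (m + r) =>
      (!![CliffordAlgebra.involute (contract (X (w (σ k))) (x (σ k))),
        if σ k ∈ headSet m σ then contract (X j) (contract (X (w (σ k))) (x (σ k))) else 0;
        0, contract (X (w (σ k))) (x (σ k))] : Matrix (Fin 2) (Fin 2) (PV d))).prod =
      contractMatrix (X j) (List.ofFn fun a : Fin m =>
        contract (X (w (σ (Fin.castAdd r a)))) (x (σ (Fin.castAdd r a)))).prod *
      !![CliffordAlgebra.involute (List.ofFn fun b : Fin r =>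
        contract (X (w (σ (Fin.natAdd m b)))) (x (σ (Fin.natAdd m b)))).prod, 0; 0,
        (List.ofFn fun b : Fin r =>
        contract (X (w (σ (Fin.natAdd m b)))) (x (σ (Fin.natAdd m b)))).prod] := by
    rw [List.ofFn_add, List.prod_append, ← prod_ofFn_contractMatrix, ← prod_ofFn_diagonal]
    congr 3
    · funext a
      simp only [apply_mem_headSet, Fin.val_castLE, Fin.is_lt, if_true]
      rfl
    · funext a
      simp [apply_mem_headSet]
  rw [h2, prod_ofFn_upperTriangular] at h
  have h3 := congrFun (congrFun h 0) 1
  have hu : ∀ (s : ℤˣ) (A : PV d), s • (s • A) = A := fun s A => by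
    rw [smul_smul, Int.units_mul_self, one_smul]
  rw [contractOn, ← hu (koszulSign σ deg) (replaceSum _ _ _ _)]
  congr 1
  simpa [contractMatrix] using h3

/-- A nested untruncated bracket, with its Koszul sign, depends only on the set of inner arguments. -/
theorem koszulSign_smul_fullBracket_add (φ : PolyFun d) (m r : ℕ) {x : Fin (m + r) → PV d}
    {deg : Fin (m + r) → ℤ} (hx : ∀ k, HasDeg (x k) (deg k)) (σ : Equiv.Perm (Fin (m + r))) :
    koszulSign σ deg • fullBracket φ (r + 1)
      (Fin.cons (fullBracket φ m fun a => x (σ (Fin.castAdd r a))) fun b => x (σ (Fin.natAdd m b)))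
      = jacobiTerm φ x (headSet m σ) := by
  rw [fullBracket_cons, jacobiTerm, Finset.smul_sum]
  refine Finset.sum_congr rfl fun j _ => ?_
  rw [← (splitEquiv m r σ).symm.sum_comp, Fintype.sum_prod_type_right, Finset.smul_sum]
  refine Finset.sum_congr rfl fun v _ => ?_
  rw [fullBracket, map_sum, Finset.sum_mul, Finset.smul_sum, Finset.smul_sum]
  refine Finset.sum_congr rfl fun u _ => ?_
  obtain ⟨w, hw⟩ := (splitEquiv m r σ).surjective (u, v)
  have hu : u = fun a => w (σ (Fin.castAdd r a)) := (congrArg Prod.fst hw).symm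
  have hv : v = fun b => w (σ (Fin.natAdd m b)) := (congrArg Prod.snd hw).symm
  rw [← hw, Equiv.symm_apply_apply, ← koszulSign_smul_contractOn m r hx, compl_headSet_add,
    headSet_add, Finset.map_val, Finset.map_val, Multiset.map_map, Multiset.map_map]
  have hu' : iterPartial φ u = multiPartial φ (Finset.univ.val.map
      (w ∘ ⇑((Fin.castAddEmb r).trans σ.toEmbedding))) := by
    rw [iterPartial_eq_multiPartial, hu]; rfl
  have hv' : iterPartial φ v = multiPartial φ (Finset.univ.val.map
      (w ∘ ⇑((Fin.natAddEmb m).trans σ.toEmbedding))) := by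
    rw [iterPartial_eq_multiPartial, hv]; rfl
  rw [← hu', ← hv', mul_smul, hu, hv, map_smul, smul_mul_assoc]
  simp only [smul_comm (koszulSign σ deg)]

theorem koszulSign_smul_fullBracket (φ : PolyFun d) {x : Fin n → PV d} {deg : Fin n → ℤ}
    (hx : ∀ k, HasDeg (x k) (deg k)) (m : ℕ) (h : m ≤ n) (σ : Equiv.Perm (Fin n)) :
    koszulSign σ deg • fullBracket φ (n - m + 1)
      (Fin.cons (fullBracket φ m fun a => x (σ (Fin.castLE h a)))
        fun b : Fin (n - m) => x (σ ⟨m + b.val, by omega⟩)) = jacobiTerm φ x (headSet m σ) := by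
  obtain ⟨r, rfl⟩ := Nat.exists_eq_add_of_le h
  have key : ∀ r' (hr : r' = r), koszulSign σ deg • fullBracket φ (r' + 1)
      (Fin.cons (fullBracket φ m fun a => x (σ (Fin.castLE h a)))
        fun b : Fin r' => x (σ ⟨m + b.val, by omega⟩)) = jacobiTerm φ x (headSet m σ) := by
    rintro r' rfl
    exact koszulSign_smul_fullBracket_add φ m r' hx σ
  exact key _ (by omega)

/-- The part of `contractOn` in which the `l`-th factor is contracted twice. -/
def contractAt (x : Fin n → PV d) (l : Fin n) (j : Fin d) (w : Fin n → Fin d) : PV d :=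
  replaceSum n (fun k => CliffordAlgebra.involute (contract (X (w k)) (x k)))
    (fun k => contract (X (w k)) (x k))
    (Pi.single l (contract (X j) (contract (X (w l)) (x l))))

theorem contractOn_eq_sum (x : Fin n → PV d) (S : Finset (Fin n)) (j : Fin d)
    (w : Fin n → Fin d) : contractOn x S j w = ∑ l ∈ S, contractAt x l j w := by
  have : (fun k => if k ∈ S then contract (X j) (contract (X (w k)) (x k)) else 0) =
      ∑ l ∈ S, Pi.single l (contract (X j) (contract (X (w l)) (x l))) := by
    funext k
    simp [Finset.sum_apply, Pi.single_apply]
  rw [contractOn, this]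
  exact map_sum (replaceSumHom _ _) _ _

/-- Two contractions of the same factor anticommute. -/
theorem contractAt_swap (x : Fin n → PV d) (l : Fin n) (j : Fin d) (w : Fin n → Fin d) :
    contractAt x l (w l) (Function.update w l j) = -contractAt x l j w := by
  rw [contractAt, Function.update_self, contract_contract, contractAt]
  refine (replaceSum_congr_single _ _ (fun k => CliffordAlgebra.involute (contract (X (w k)) (x k)))
    (fun k => contract (X (w k)) (x k)) _ _ (fun k hk => ?_) (fun k hk => ?_)).trans ?_
  · rw [Function.update_of_ne hk]
  · rw [Function.update_of_ne hk]
  · rw [Pi.single_neg]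
    exact map_neg (replaceSumHom _ _) _

/-- Exchanging the roles of the inner and of the outer arguments other than `l` matches the
coefficients of the two ways of contracting the `l`-th argument twice. -/
theorem sum_coeff_swap (φ : PolyFun d) (l : Fin n) (j : Fin d) (w : Fin n → Fin d) :
    ∑ S ∈ Finset.univ.filter (fun S : Finset (Fin n) => l ∈ S),
      pderiv (w l) (multiPartial φ (Sᶜ.val.map (Function.update w l j))) *
        multiPartial φ (S.val.map (Function.update w l j)) =
    ∑ S ∈ Finset.univ.filter (fun S : Finset (Fin n) => l ∈ S),
      pderiv j (multiPartial φ (Sᶜ.val.map w)) * multiPartial φ (S.val.map w) := by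
  have hins : ∀ (T : Finset (Fin n)) (w : Fin n → Fin d), l ∉ T →
      multiPartial φ ((insert l T).val.map w) = pderiv (w l) (multiPartial φ (T.val.map w)) := by
    intro T w hT
    rw [Finset.insert_val_of_notMem hT, Multiset.map_cons, multiPartial_cons]
  have hupd : ∀ T : Finset (Fin n), l ∉ T →
      T.val.map (Function.update w l j) = T.val.map w := fun T hT =>
    Multiset.map_congr rfl fun k hk => Function.update_of_ne (by rintro rfl; exact hT hk) _ _
  refine Finset.sum_nbij' (fun S => insert l Sᶜ) (fun S => insert l Sᶜ) ?_ ?_ ?_ ?_ ?_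
  · intro S _; simp
  · intro S _; simp
  · intro S hS
    ext a; by_cases h : a = l <;> simp_all
  · intro S hS
    ext a; by_cases h : a = l <;> simp_all
  · intro S hS
    have hS : l ∈ S := by simpa using hS
    have h1 : l ∉ Sᶜ := by simpa using hS
    have hc : (insert l Sᶜ)ᶜ = S.erase l := by
      ext a; by_cases h : a = l <;> simp_all
    have h2 : ∀ w : Fin n → Fin d, multiPartial φ (S.val.map w) =
        pderiv (w l) (multiPartial φ ((S.erase l).val.map w)) := fun w => by
      conv_lhs => rw [← Finset.insert_erase hS]
      exact hins _ _ (Finset.notMem_erase l S)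
    rw [hc, hupd _ h1, hins _ _ h1, h2, hupd _ (Finset.notMem_erase l S), Function.update_self,
      mul_comm]

/-- The sum of all terms of the Jacobi identity is its own opposite: exchange `j` and `w l`. -/
theorem sum_jacobiTerm (φ : PolyFun d) (x : Fin n → PV d) :
    ∑ S ∈ Finset.univ.filter (fun S : Finset (Fin n) => S.Nonempty), jacobiTerm φ x S = 0 := by
  have h1 : ∑ S ∈ Finset.univ.filter (fun S : Finset (Fin n) => S.Nonempty), jacobiTerm φ x S =
      ∑ S, jacobiTerm φ x S := by
    refine Finset.sum_subset (Finset.filter_subset _ _) fun S _ hS => ?_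
    have : S = ∅ := by simpa using hS
    subst this
    simp [jacobiTerm, contractOn_eq_sum]
  have h2 : ∑ S, jacobiTerm φ x S = ∑ l, ∑ p : Fin d × (Fin n → Fin d),
      (∑ S ∈ Finset.univ.filter (fun S : Finset (Fin n) => l ∈ S),
        pderiv p.1 (multiPartial φ (Sᶜ.val.map p.2)) * multiPartial φ (S.val.map p.2)) •
          contractAt x l p.1 p.2 := by
    have h3 : ∀ S, jacobiTerm φ x S = ∑ l ∈ S, ∑ p : Fin d × (Fin n → Fin d),
        (pderiv p.1 (multiPartial φ (Sᶜ.val.map p.2)) * multiPartial φ (S.val.map p.2)) •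
          contractAt x l p.1 p.2 := fun S => by
      rw [Finset.sum_comm, jacobiTerm, Fintype.sum_prod_type]
      simp only [contractOn_eq_sum, Finset.smul_sum]
    simp only [h3, Finset.sum_smul]
    rw [Finset.sum_comm' (t' := Finset.univ)
      (s' := fun l => Finset.univ.filter (fun S : Finset (Fin n) => l ∈ S)) (by simp)]
    exact Finset.sum_congr rfl fun l _ => Finset.sum_comm
  rw [h1, h2]
  refine Finset.sum_eq_zero fun l _ => ?_
  -- The sum over `(j, w)` is mapped to its opposite by the exchange of `j` and `w l`.
  let _ : Module ℚ (PV d) := Module.compHom (PV d) (algebraMap ℚ ℂ)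
  have : IsAddTorsionFree (PV d) := .of_module_rat _
  refine (self_eq_neg (G := PV d)).1 ?_
  rw [← Finset.sum_neg_distrib]
  let e : Fin d × (Fin n → Fin d) ≃ Fin d × (Fin n → Fin d) :=
    { toFun := fun p => (p.2 l, Function.update p.2 l p.1)
      invFun := fun p => (p.2 l, Function.update p.2 l p.1)
      left_inv := fun p => by simp
      right_inv := fun p => by simp }
  refine (Fintype.sum_equiv e _ _ fun p => ?_).symm
  rw [show e p = (p.2 l, Function.update p.2 l p.1) from rfl, contractAt_swap, sum_coeff_swap,
    smul_neg]

open Classical in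
/-- The higher Jacobi identities of the untruncated brackets. -/
theorem fullBracket_jacobi (φ : PolyFun d) {x : Fin n → PV d} {deg : Fin n → ℤ}
    (hx : ∀ k, HasDeg (x k) (deg k)) :
    ∑ i : Fin n, ∑ σ ∈ (Finset.univ : Finset (Equiv.Perm (Fin n))).filter (IsShuffle (i.val + 1)),
      koszulSign σ deg • fullBracket φ (n - (i.val + 1) + 1)
        (Fin.cons (fullBracket φ (i.val + 1) fun a => x (σ (Fin.castLE i.isLt a)))
          fun b : Fin (n - (i.val + 1)) =>
            x (σ ⟨i.val + 1 + b.val, by have := b.isLt; omega⟩)) = 0 := by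
  rw [← sum_jacobiTerm φ x, ← sum_isShuffle]
  exact Finset.sum_congr rfl fun i _ => Finset.sum_congr rfl fun σ _ =>
    koszulSign_smul_fullBracket φ hx _ i.isLt σ

end FullJacobi

/-! ### Derivatives and degrees of the untruncated brackets -/

section FullBracket

variable {d : ℕ} {n : ℕ}

theorem coeffDeriv_prod_ofFn (Y : VF d) (y : Fin n → PV d) :
    coeffDeriv Y (List.ofFn y).prod =
      ∑ k, (List.ofFn (Function.update y k (coeffDeriv Y (y k)))).prod := by
  induction n with
  | zero =>
    have := coeffDeriv_algebraMap Y (1 : PolyFun d)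
    simpa using this
  | succ n ih =>
    rw [List.ofFn_succ, List.prod_cons, coeffDeriv_mul, ih, Fin.sum_univ_succ, Finset.mul_sum]
    congr 1
    · simp [List.ofFn_succ]
    · refine Finset.sum_congr rfl fun k _ => ?_
      rw [List.ofFn_succ, List.prod_cons, Function.update_of_ne (Fin.succ_ne_zero k).symm]
      congr 3
      funext i
      by_cases h : i = k
      · subst h; simp
      · rw [Function.update_of_ne h, Function.update_of_ne (fun e => h (Fin.succ_injective _ e))]

/-- Inserting a vector field into the untruncated bracket amounts to differentiating the
coefficients of the bracket with one argument less. -/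
theorem fullBracket_cons_ι (φ : PolyFun d) (Y : VF d) (y : Fin n → PV d) :
    fullBracket φ (n + 1) (Fin.cons (ExteriorAlgebra.ι (PolyFun d) Y) y) =
      coeffDeriv Y (fullBracket φ n y) -
        ∑ k, fullBracket φ n (Function.update y k (coeffDeriv Y (y k))) := by
  have h1 : fullBracket φ (n + 1) (Fin.cons (ExteriorAlgebra.ι (PolyFun d) Y) y) =
      ∑ v : Fin n → Fin d, Y (iterPartial φ v) •
        (List.ofFn fun k => contract (X (v k)) (y k)).prod := by
    rw [fullBracket_cons, Finset.sum_comm]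
    refine Finset.sum_congr rfl fun v _ => ?_
    rw [derivation_eq_sum Y, Finset.sum_smul]
    refine Finset.sum_congr rfl fun j _ => ?_
    rw [contract_ι, ← Algebra.smul_def, smul_smul, mul_comm]
  have h2 : ∑ k, fullBracket φ n (Function.update y k (coeffDeriv Y (y k))) =
      ∑ v : Fin n → Fin d, iterPartial φ v •
        coeffDeriv Y (List.ofFn fun k => contract (X (v k)) (y k)).prod := by
    unfold fullBracket
    rw [Finset.sum_comm]
    refine Finset.sum_congr rfl fun v _ => ?_
    rw [← Finset.smul_sum, coeffDeriv_prod_ofFn]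
    congr 1
    refine Finset.sum_congr rfl fun k _ => ?_
    congr 2
    funext i
    by_cases h : i = k
    · subst h; simp [coeffDeriv_contract]
    · simp [Function.update_of_ne h]
  rw [h1, h2, fullBracket, map_sum, ← Finset.sum_sub_distrib]
  refine Finset.sum_congr rfl fun v _ => ?_
  rw [coeffDeriv_smul, add_sub_cancel_right]

theorem prod_ofFn_mem {p : Fin n → ℕ} {y : Fin n → PV d}
    (hy : ∀ k, y k ∈ ⋀[PolyFun d]^(p k) (VF d)) :
    (List.ofFn y).prod ∈ ⋀[PolyFun d]^(∑ k, p k) (VF d) := by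
  induction n with
  | zero =>
    simp only [List.ofFn_zero, List.prod_nil, Finset.univ_eq_empty, Finset.sum_empty]
    rw [ExteriorAlgebra.exteriorPower, pow_zero]
    exact Submodule.one_le.1 le_rfl
  | succ n ih =>
    rw [List.ofFn_succ, List.prod_cons, Fin.sum_univ_succ]
    exact exteriorPower_mul_mem (hy 0) (ih fun k => hy k.succ)

theorem fullBracket_mem (φ : PolyFun d) {p : Fin n → ℕ} {y : Fin n → PV d}
    (hy : ∀ k, y k ∈ ⋀[PolyFun d]^(p k) (VF d)) :
    fullBracket φ n y ∈ ⋀[PolyFun d]^(∑ k, (p k - 1)) (VF d) :=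
  Submodule.sum_mem _ fun _ _ => Submodule.smul_mem _ _
    (prod_ofFn_mem fun k => contract_mem _ (hy k))

theorem fullBracket_one (φ : PolyFun d) (y : Fin 1 → PV d) :
    fullBracket φ 1 y = contract φ (y 0) := by
  unfold fullBracket
  rw [contract_eq_sum, ← (Equiv.funUnique (Fin 1) (Fin d)).symm.sum_comp]
  refine Finset.sum_congr rfl fun i _ => ?_
  simp [iterPartial]

theorem fullBracket_cons_add (φ : PolyFun d) (P Q : PV d) (y : Fin n → PV d) :
    fullBracket φ (n + 1) (Fin.cons (P + Q) y) =
      fullBracket φ (n + 1) (Fin.cons P y) + fullBracket φ (n + 1) (Fin.cons Q y) := by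
  simp only [fullBracket_cons, map_add, add_mul, smul_add, Finset.sum_add_distrib]

theorem fullBracket_cons_units_smul (φ : PolyFun d) (s : ℤˣ) (P : PV d) (y : Fin n → PV d) :
    fullBracket φ (n + 1) (Fin.cons (s • P) y) = s • fullBracket φ (n + 1) (Fin.cons P y) := by
  have h : ∀ j, contract (X j) (s • P) = s • contract (X j) P := fun j => by
    rcases Int.units_eq_one_or s with h | h <;> simp [h]
  simp only [fullBracket_cons, h, smul_mul_assoc, Finset.smul_sum]
  exact Finset.sum_congr rfl fun j _ => Finset.sum_congr rfl fun v _ => smul_comm _ _ _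

theorem koszulBracketLin_apply (φ : PolyFun d) (P : Fin n → koszulModule d) :
    koszulBracketLin φ n P = koszulProj d (fullBracket φ n fun k => (P k).1) := by
  simp [koszulBracketLin, fullBracket]

end FullBracket

/-! ### Polyvector fields of order at least two -/

section KoszulModule

variable {d : ℕ}

/-- A property of `p`-vector fields stable under linear combinations holds everywhere if it holds for
the `∂_I` with `|I| = p`. -/
theorem exteriorPower_basis_induction {p : ℕ} {C : PV d → Prop}
    (basis : ∀ I : Finset (Fin d), I.card = p → C (pvBasis d I)) (zero : C 0)
    (add : ∀ P Q, C P → C Q → C (P + Q)) (smul : ∀ (f : PolyFun d) P, C P → C (f • P)) {P : PV d}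
    (hP : P ∈ ⋀[PolyFun d]^p (VF d)) : C P := by
  have h := congrArg Subtype.val (((vfBasis d).exteriorPower p).sum_repr ⟨P, hP⟩)
  change _ = P at h
  rw [← h, AddSubmonoidClass.coe_finsetSum]
  refine Finset.sum_induction _ C add zero fun s _ => ?_
  refine smul _ _ ?_
  have := ExteriorAlgebra.basis_eq_coe_basis (vfBasis d) s
  change C (((vfBasis d).exteriorPower p s : _) : PV d)
  rw [← this]
  exact basis s.1 s.2

theorem koszulProj_of_mem {p : ℕ} (hp : 2 ≤ p) {P : PV d} (hP : P ∈ ⋀[PolyFun d]^p (VF d)) :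
    (koszulProj d P : PV d) = P := by
  refine exteriorPower_basis_induction (C := fun P => (koszulProj d P : PV d) = P)
    (fun I hI => ?_) ?_ (fun P Q h1 h2 => ?_) (fun f P h => ?_) hP
  · refine (congrArg Subtype.val ((pvBasis d).constr_basis (PolyFun d) _ I)).trans ?_
    rw [dif_pos (by omega)]
  · simp
  · rw [map_add, Submodule.coe_add, h1, h2]
  · rw [map_smul, Submodule.coe_smul, h]

theorem koszulProj_of_lt {p : ℕ} (hp : p < 2) {P : PV d} (hP : P ∈ ⋀[PolyFun d]^p (VF d)) :
    koszulProj d P = 0 := by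
  refine exteriorPower_basis_induction (C := fun P => koszulProj d P = 0)
    (fun I hI => ?_) ?_ (fun P Q h1 h2 => ?_) (fun f P h => ?_) hP
  · refine ((pvBasis d).constr_basis (PolyFun d) _ I).trans ?_
    rw [dif_neg (by omega)]
  · simp
  · rw [map_add, h1, h2, add_zero]
  · rw [map_smul, h, smul_zero]

theorem koszulProj_coe (P : koszulModule d) : koszulProj d P.1 = P := by
  obtain ⟨P, hP⟩ := P
  refine Subtype.ext ?_
  change (koszulProj d P : PV d) = P
  induction hP using Submodule.iSup_induction' with
  | mem k P hP => exact koszulProj_of_mem (by omega) hP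
  | zero => simp
  | add P Q _ _ h1 h2 => rw [map_add, Submodule.coe_add, h1, h2]

theorem algebraMapInv_of_mem {p : ℕ} (hp : p ≠ 0) {P : PV d} (hP : P ∈ ⋀[PolyFun d]^p (VF d)) :
    ExteriorAlgebra.algebraMapInv P = 0 := by
  induction hP using exteriorPower_induction with
  | algebraMap r => exact absurd rfl hp
  | add p P Q _ _ h1 h2 => rw [map_add, h1 hp, h2 hp, add_zero]
  | ι_mul p m P _ _ => simp [ExteriorAlgebra.algebraMapInv]

theorem ιInv_of_mem {p : ℕ} (hp : p ≠ 1) {P : PV d} (hP : P ∈ ⋀[PolyFun d]^p (VF d)) :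
    (ExteriorAlgebra.ιInv P : VF d) = 0 := by
  induction hP using exteriorPower_induction with
  | algebraMap r => exact ιInv_algebraMap r
  | add p P Q _ _ h1 h2 => rw [map_add, h1 hp, h2 hp, add_zero]
  | ι_mul p m P hP _ =>
    rw [ιInv_ι_mul, algebraMapInv_of_mem (by omega) hP, zero_smul]

theorem ι_ιInv_of_mem {P : PV d} (hP : P ∈ ⋀[PolyFun d]^1 (VF d)) :
    ExteriorAlgebra.ι (PolyFun d) (ExteriorAlgebra.ιInv P : VF d) = P := by
  rw [ExteriorAlgebra.exteriorPower, pow_one] at hP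
  obtain ⟨m, rfl⟩ := hP
  exact congrArg _ (ExteriorAlgebra.ι_leftInverse m)

theorem koszulAnchor_of_mem (φ : PolyFun d) {p : ℕ} (hp : p ≠ 2) {P : koszulModule d}
    (hP : P.1 ∈ ⋀[PolyFun d]^p (VF d)) : koszulAnchor φ P = 0 := by
  change -ExteriorAlgebra.ιInv (contract φ P.1) = (0 : VF d)
  rcases Nat.eq_zero_or_pos p with rfl | h
  · have : contract φ P.1 = 0 := by
      obtain ⟨r, hr⟩ := Submodule.mem_one.1 (by simpa [ExteriorAlgebra.exteriorPower] using hP)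
      rw [← hr]
      exact contract_algebraMap _ _
    rw [this, map_zero, neg_zero]
  · rw [ιInv_of_mem (by omega) (contract_mem φ hP), neg_zero]

theorem ι_koszulAnchor (φ : PolyFun d) {P : koszulModule d}
    (hP : P.1 ∈ ⋀[PolyFun d]^2 (VF d)) :
    ExteriorAlgebra.ι (PolyFun d) (koszulAnchor φ P) = -contract φ P.1 := by
  change ExteriorAlgebra.ι (PolyFun d) (-ExteriorAlgebra.ιInv (contract φ P.1)) = _
  rw [map_neg, ι_ιInv_of_mem (contract_mem φ hP)]

theorem mem_grading_iff (φ : PolyFun d) {e : ℤ} (he : e ≤ -1) {P : koszulModule d} :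
    P ∈ (koszulLieInfty φ).grading e ↔ P.1 ∈ ⋀[PolyFun d]^(1 - e).toNat (VF d) := by
  simp only [koszulLieInfty, if_pos he, Submodule.mem_comap, Submodule.subtype_apply]

theorem grading_eq_bot (φ : PolyFun d) {e : ℤ} (he : 0 ≤ e) :
    (koszulLieInfty φ).grading e = ⊥ := by
  simp only [koszulLieInfty, if_neg (show ¬ e ≤ -1 by omega)]

theorem hasDeg_of_mem_grading {φ : PolyFun d} {e : ℤ} {P : koszulModule d}
    (hP : P ∈ (koszulLieInfty φ).grading e) : HasDeg P.1 e := by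
  by_cases he : e ≤ -1
  · rw [mem_grading_iff φ he] at hP
    rwa [HasDeg, show (e + 1).natAbs + 2 = (1 - e).toNat by omega]
  · rw [grading_eq_bot φ (by omega), Submodule.mem_bot] at hP
    rw [hP]
    exact zero_mem _

theorem anchor_of_mem_grading (φ : PolyFun d) {e : ℤ} (he : e ≠ -1) {P : koszulModule d}
    (hP : P ∈ (koszulLieInfty φ).grading e) : koszulAnchor φ P = 0 := by
  by_cases h : e ≤ -1
  · exact koszulAnchor_of_mem φ (by omega) ((mem_grading_iff φ h).1 hP)
  · rw [grading_eq_bot φ (by omega), Submodule.mem_bot] at hP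
    rw [hP, map_zero]

end KoszulModule

/-! ### The brackets of the Lie ∞-algebroid -/

section Brackets

variable {d : ℕ} {n : ℕ}

theorem bracket_of_ne_two (φ : PolyFun d) (hn : n ≠ 2) (x : Fin n → koszulModule d) :
    (koszulLieInfty φ).bracket n x = koszulProj d (fullBracket φ n fun k => (x k).1) := by
  rw [← koszulBracketLin_apply]
  match n, hn with
  | 0, _ => rfl
  | 1, _ => rfl
  | n + 3, _ => rfl

theorem bracket_two (φ : PolyFun d) (x : Fin 2 → koszulModule d) :
    (koszulLieInfty φ).bracket 2 x = koszulProj d (fullBracket φ 2 fun k => (x k).1) +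
      koszulProj d (coeffDeriv (koszulAnchor φ (x 0)) (x 1).1
        - coeffDeriv (koszulAnchor φ (x 1)) (CliffordAlgebra.involute (x 0).1)) := by
  rw [← koszulBracketLin_apply]
  rfl

/-- The difference between the bracket and the untruncated bracket: the anchor for `n = 1`, the
part that differentiates coefficients for `n = 2`, and zero otherwise. -/
def correction (φ : PolyFun d) : (n : ℕ) → (Fin n → koszulModule d) → PV d
  | 1, x => ExteriorAlgebra.ι (PolyFun d) (koszulAnchor φ (x 0))
  | 2, x => coeffDeriv (koszulAnchor φ (x 0)) (x 1).1
      - coeffDeriv (koszulAnchor φ (x 1)) (CliffordAlgebra.involute (x 0).1)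
  | _, _ => 0

theorem correction_of_three_le (φ : PolyFun d) (hn : 3 ≤ n) (x : Fin n → koszulModule d) :
    correction φ n x = 0 := by
  match n, hn with
  | n + 3, _ => rfl

theorem units_smul_mem {M : Type*} [AddCommGroup M] [Module (PolyFun d) M]
    (S : Submodule (PolyFun d) M) (s : ℤˣ) {P : M} (hP : P ∈ S) : s • P ∈ S := by
  rcases Int.units_eq_one_or s with h | h <;> simpa [h] using hP

theorem HasDeg.involute_mem {P : PV d} {e : ℤ} (h : HasDeg P e) :
    HasDeg (CliffordAlgebra.involute P) e := by
  rw [HasDeg, involute_exteriorPower h]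
  exact units_smul_mem _ _ h

theorem HasDeg.involute_eq {P : PV d} {e : ℤ} (h : HasDeg P e) :
    CliffordAlgebra.involute P = -(Int.negOnePow e • P) := by
  rw [involute_exteriorPower h, ← Units.neg_smul, ← Int.negOnePow_succ]
  congr 1
  rw [Int.negOnePow_eq_iff]
  obtain ⟨r, hr⟩ := even_natAbs_sub e
  exact ⟨r + 1, by push_cast at hr ⊢; omega⟩

/-- The projection on `E` is only visible for `n = 1`, on bivector fields, where it removes
`ι_{dφ} P = -ρ(P)`. -/
theorem coe_bracket (φ : PolyFun d) (hn : 1 ≤ n) {x : Fin n → koszulModule d} {deg : Fin n → ℤ}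
    (hx : ∀ k, HasDeg (x k).1 (deg k)) :
    ((koszulLieInfty φ).bracket n x : PV d) =
      fullBracket φ n (fun k => (x k).1) + correction φ n x := by
  have hmem := fullBracket_mem φ (fun k => hx k)
  have hcard : n ≤ ∑ k, ((deg k + 1).natAbs + 2 - 1) := by
    have : ∑ _k : Fin n, 1 ≤ ∑ k, ((deg k + 1).natAbs + 2 - 1) :=
      Finset.sum_le_sum fun k _ => by omega
    simpa using this
  match n, hn with
  | 1, _ =>
    rw [bracket_of_ne_two φ (by omega), correction]
    by_cases h : (deg 0 + 1).natAbs = 0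
    · have h0 := hx 0
      rw [HasDeg, h] at h0
      rw [koszulProj_of_lt (by simp [h]) hmem, ι_koszulAnchor φ h0, fullBracket_one]
      simp
    · rw [koszulProj_of_mem (by simp; omega) hmem, koszulAnchor_of_mem φ (by omega) (hx 0),
        map_zero, add_zero]
  | 2, _ =>
    have h1 : HasDeg (coeffDeriv (koszulAnchor φ (x 0)) (x 1).1) (deg 1) :=
      coeffDeriv_mem _ (hx 1)
    have h2 : HasDeg (coeffDeriv (koszulAnchor φ (x 1)) (CliffordAlgebra.involute (x 0).1))
      (deg 0) := coeffDeriv_mem _ (hx 0).involute_mem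
    rw [bracket_two, correction, Submodule.coe_add, koszulProj_of_mem hcard hmem, map_sub,
      Submodule.coe_sub, koszulProj_of_mem (by omega) h1, koszulProj_of_mem (by omega) h2]
  | n + 3, _ =>
    rw [bracket_of_ne_two φ (by omega), correction_of_three_le φ (by omega),
      koszulProj_of_mem (by omega) hmem, add_zero]

theorem koszulProj_mem_grading (φ : PolyFun d) {q : ℕ} {e : ℤ} (h : (q : ℤ) = 1 - e) {P : PV d}
    (hP : P ∈ ⋀[PolyFun d]^q (VF d)) : koszulProj d P ∈ (koszulLieInfty φ).grading e := by
  by_cases hq : 2 ≤ q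
  · rw [mem_grading_iff φ (by omega), koszulProj_of_mem hq hP, ← h]
    exact hP
  · rw [koszulProj_of_lt (by omega) hP]
    exact zero_mem _

theorem bracket_mem_grading (φ : PolyFun d) {x : Fin n → koszulModule d} {deg : Fin n → ℤ}
    (hx : ∀ k, x k ∈ (koszulLieInfty φ).grading (deg k)) :
    (koszulLieInfty φ).bracket n x ∈ (koszulLieInfty φ).grading ((∑ i, deg i) + 1) := by
  by_cases hdeg : ∃ k, ¬ deg k ≤ -1
  · obtain ⟨k, hk⟩ := hdeg
    have h0 := hx k
    rw [grading_eq_bot φ (by omega), Submodule.mem_bot] at h0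
    rw [MultilinearMap.map_coord_zero _ k h0]
    exact zero_mem _
  push Not at hdeg
  have hmem := fullBracket_mem φ fun k => (mem_grading_iff φ (hdeg k)).1 (hx k)
  have hq : ((∑ k, ((1 - deg k).toNat - 1) : ℕ) : ℤ) = 1 - ((∑ i, deg i) + 1) := by
    rw [Nat.cast_sum, show (1 : ℤ) - ((∑ i, deg i) + 1) = -∑ i, deg i by ring,
      ← Finset.sum_neg_distrib]
    exact Finset.sum_congr rfl fun k _ => by have := hdeg k; omega
  by_cases hn : n = 2
  · subst hn
    have key : ∀ a b : Fin 2, a ≠ b → ∀ P : PV d, P ∈ ⋀[PolyFun d]^(1 - deg b).toNat (VF d) →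
        koszulProj d (coeffDeriv (koszulAnchor φ (x a)) P) ∈
          (koszulLieInfty φ).grading ((∑ i, deg i) + 1) := by
      intro a b hab P hP
      by_cases ha : deg a = -1
      · refine koszulProj_mem_grading φ ?_ (coeffDeriv_mem _ hP)
        have hb := hdeg b
        have : ∑ i, deg i = deg a + deg b := by
          rw [Fin.sum_univ_two]
          fin_cases a <;> fin_cases b <;> first | exact absurd rfl hab | simp [add_comm]
        omega
      · rw [anchor_of_mem_grading φ ha (hx a), map_zero, LinearMap.zero_apply, map_zero]
        exact zero_mem _
    rw [bracket_two, map_sub]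
    refine add_mem (koszulProj_mem_grading φ hq hmem) (sub_mem (key 0 1 (by simp) _ ?_)
      (key 1 0 (by simp) _ ?_))
    · exact (mem_grading_iff φ (hdeg 1)).1 (hx 1)
    · have := (mem_grading_iff φ (hdeg 0)).1 (hx 0)
      rw [involute_exteriorPower this]
      exact units_smul_mem _ _ this
  · rw [bracket_of_ne_two φ hn]
    exact koszulProj_mem_grading φ hq hmem

/-- The anchor is only nonzero in degree `-1`. -/
theorem anchor_eq_zero_or_eq_neg_one (φ : PolyFun d) {e : ℤ} {P : koszulModule d}
    (hP : P ∈ (koszulLieInfty φ).grading e) :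
    koszulAnchor φ P = 0 ∨ e = -1 := by
  by_cases h : e = -1
  · exact Or.inr h
  · exact Or.inl (anchor_of_mem_grading φ h hP)

theorem correction_two (φ : PolyFun d) {x : Fin 2 → koszulModule d} {e : ℤ}
    (hx : HasDeg (x 0).1 e) :
    correction φ 2 x = coeffDeriv (koszulAnchor φ (x 0)) (x 1).1 +
      Int.negOnePow e • coeffDeriv (koszulAnchor φ (x 1)) (x 0).1 := by
  rw [correction, hx.involute_eq, map_neg, sub_neg_eq_add]
  rcases Int.units_eq_one_or e.negOnePow with h | h <;> simp [h]

theorem correction_comp_perm (φ : PolyFun d) {x : Fin n → koszulModule d} {deg : Fin n → ℤ}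
    (hx : ∀ k, x k ∈ (koszulLieInfty φ).grading (deg k)) (σ : Equiv.Perm (Fin n)) :
    correction φ n (fun k => x (σ k)) = koszulSign σ deg • correction φ n x := by
  match n with
  | 0 => rw [Subsingleton.elim σ 1]; simp
  | 1 => rw [Subsingleton.elim σ 1]; simp
  | 2 =>
    obtain ⟨m, τ, rfl⟩ := exists_eq_consPerm σ
    obtain rfl : τ = 1 := Subsingleton.elim _ _
    rw [koszulSign_consPerm, koszulSign_one, mul_one]
    have h0 : consPerm m (1 : Equiv.Perm (Fin 1)) 0 = m := consPerm_zero _ _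
    have h1 : consPerm m (1 : Equiv.Perm (Fin 1)) 1 = m.succAbove 0 := consPerm_succ _ _ 0
    rw [correction_two φ (hasDeg_of_mem_grading (hx 0)), correction_two φ (e := deg m)
      (by rw [h0]; exact hasDeg_of_mem_grading (hx m)), h0, h1]
    fin_cases m
    · simp [frontSign]
    · simp only [frontSign, Fin.mk_one, Fin.isValue, Finset.univ_unique, Fin.default_eq_zero,
        Finset.prod_singleton]
      have h2 : (1 : Fin 2).succAbove 0 = 0 := rfl
      simp only [h2, Fin.isValue, Fin.zero_lt_one, if_true]
      have hA : coeffDeriv (koszulAnchor φ (x 0)) (x 1).1 = 0 ∨ deg 0 = -1 :=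
        (anchor_eq_zero_or_eq_neg_one φ (hx 0)).imp_left fun h => by rw [h]; simp
      have hB : coeffDeriv (koszulAnchor φ (x 1)) (x 0).1 = 0 ∨ deg 1 = -1 :=
        (anchor_eq_zero_or_eq_neg_one φ (hx 1)).imp_left fun h => by rw [h]; simp
      generalize coeffDeriv (koszulAnchor φ (x 0)) (x 1).1 = A at hA ⊢
      generalize coeffDeriv (koszulAnchor φ (x 1)) (x 0).1 = B at hB ⊢
      rcases hA with rfl | hA <;> rcases hB with rfl | hB
      · simp
      · rw [hB]
        rcases Int.units_eq_one_or (deg 0).negOnePow with h | h <;> simp [h, Int.negOnePow_neg]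
      · rw [hA]
        rcases Int.units_eq_one_or (deg 1).negOnePow with h | h <;> simp [h, Int.negOnePow_neg]
      · rw [hA, hB]
        simp only [Int.negOnePow_neg, Int.negOnePow_one, mul_neg, mul_one, neg_neg, Units.neg_smul,
          one_smul, smul_add]
        abel
  | n + 3 =>
    rw [correction_of_three_le φ (by omega), correction_of_three_le φ (by omega), smul_zero]

theorem bracket_comp_perm (φ : PolyFun d) {x : Fin n → koszulModule d} {deg : Fin n → ℤ}
    (hx : ∀ k, x k ∈ (koszulLieInfty φ).grading (deg k)) (σ : Equiv.Perm (Fin n)) :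
    (koszulLieInfty φ).bracket n (fun k => x (σ k)) =
      koszulSign σ deg • (koszulLieInfty φ).bracket n x := by
  rcases Nat.eq_zero_or_pos n with rfl | hn
  · rw [Subsingleton.elim σ 1]; simp
  · have hd := fun k => hasDeg_of_mem_grading (hx k)
    refine Subtype.ext ?_
    have hs : ∀ (s : ℤˣ) (P : koszulModule d), ((s • P : koszulModule d) : PV d) = s • P.1 :=
      fun s P => by rcases Int.units_eq_one_or s with h | h <;> simp [h]
    rw [hs, coe_bracket φ hn hd, coe_bracket φ hn (fun k => hd (σ k)), smul_add,
      correction_comp_perm φ hx σ]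
    congr 1
    exact fullBracket_comp_perm φ hd σ

theorem bracket_two_leibniz (φ : PolyFun d) (x y : koszulModule d) (f : PolyFun d) :
    (koszulLieInfty φ).bracket 2 ![x, f • y] =
      koszulAnchor φ x f • y + f • (koszulLieInfty φ).bracket 2 ![x, y] := by
  have h : koszulBracketLin φ 2 ![x, f • y] = f • koszulBracketLin φ 2 ![x, y] := by
    have h1 : ∀ z, ![x, z] = Function.update ![x, y] 1 z := fun z => by
      funext i; fin_cases i <;> rfl
    rw [h1, MultilinearMap.map_update_smul, ← h1]
  rw [bracket_two, bracket_two, ← koszulBracketLin_apply, ← koszulBracketLin_apply, h]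
  simp only [Matrix.cons_val_zero, Matrix.cons_val_one, Submodule.coe_smul, coeffDeriv_smul,
    map_smul, smul_coeffDeriv, map_add, map_sub, koszulProj_coe, smul_add, smul_sub]
  abel

theorem coe_bracket_one (φ : PolyFun d) {e : ℤ} (he : e ≤ -2) {x : koszulModule d}
    (hx : x ∈ (koszulLieInfty φ).grading e) :
    ((koszulLieInfty φ).bracket 1 ![x] : PV d) = contract φ x.1 := by
  rw [coe_bracket φ le_rfl (deg := fun _ => e) (fun k => by
    rw [Subsingleton.elim k 0]; exact hasDeg_of_mem_grading hx), fullBracket_one]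
  simp [correction, anchor_of_mem_grading φ (by omega) hx]

theorem anchor_bracket_one (φ : PolyFun d) {x : koszulModule d}
    (hx : x ∈ (koszulLieInfty φ).grading (-2)) :
    koszulAnchor φ ((koszulLieInfty φ).bracket 1 ![x]) = 0 := by
  change -ExteriorAlgebra.ιInv (contract φ ((koszulLieInfty φ).bracket 1 ![x] : PV d)) = (0 : VF d)
  rw [coe_bracket_one φ le_rfl hx]
  have : contract φ (contract φ x.1) = 0 :=
    CliffordAlgebra.contractLeft_contractLeft (Q := (0 : QuadraticForm (PolyFun d) (VF d))) _ _
  rw [this, map_zero, neg_zero]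

/-- Contracting the untruncated binary bracket of two bivector fields with `dφ`. -/
theorem contract_fullBracket_two (φ : PolyFun d) {x y : koszulModule d}
    (hx : x.1 ∈ ⋀[PolyFun d]^2 (VF d)) (hy : y.1 ∈ ⋀[PolyFun d]^2 (VF d)) :
    contract φ (fullBracket φ 2 ![x.1, y.1]) =
      fullBracket φ 2 (Fin.cons (ExteriorAlgebra.ι (PolyFun d) (koszulAnchor φ x)) ![y.1]) -
        fullBracket φ 2 (Fin.cons (ExteriorAlgebra.ι (PolyFun d) (koszulAnchor φ y)) ![x.1]) := by
  have hc : ∀ (z : koszulModule d) (i : Fin d), z.1 ∈ ⋀[PolyFun d]^2 (VF d) →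
      contract φ (contract (X i) z.1) =
        algebraMap (PolyFun d) (PV d) (koszulAnchor φ z (X i)) := fun z i hz => by
    rw [contract_contract, ← contract_ι, ι_koszulAnchor φ hz, map_neg]
  have hi : ∀ (z : koszulModule d) (i : Fin d), z.1 ∈ ⋀[PolyFun d]^2 (VF d) →
      CliffordAlgebra.involute (contract (X i) z.1) = -contract (X i) z.1 := fun z i hz => by
    rw [involute_exteriorPower (contract_mem _ hz)]; simp
  have hv : ∀ F : (Fin 1 → Fin d) → PV d, ∑ v, F v = ∑ j, F ![j] := fun F =>
    Fintype.sum_equiv (Equiv.funUnique (Fin 1) (Fin d)) _ _ fun v => by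
      congr 1; funext k; rw [Subsingleton.elim k 0]; rfl
  have h2 : ![x.1, y.1] = Fin.cons x.1 ![y.1] := rfl
  rw [h2, fullBracket_cons, fullBracket_cons, fullBracket_cons]
  simp only [hv, map_sum, map_smul, contract_mul]
  simp only [List.ofFn_succ, List.ofFn_zero, List.prod_cons, List.prod_nil, mul_one,
    Matrix.cons_val_zero, hc _ _ hx, hc _ _ hy, hi _ _ hx, contract_ι]
  conv_rhs => rw [sub_eq_add_neg]; arg 2; rw [Finset.sum_comm]
  rw [← sub_eq_add_neg, ← Finset.sum_sub_distrib]
  refine Finset.sum_congr rfl fun i _ => ?_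
  rw [← Finset.sum_sub_distrib]
  refine Finset.sum_congr rfl fun j _ => ?_
  have hsymm : pderiv j (iterPartial φ ![i]) = pderiv i (iterPartial φ ![j]) := by
    simp [iterPartial, pderiv_pderiv_comm]
  rw [hsymm, ← smul_sub]
  congr 1
  rw [neg_mul, ← sub_eq_add_neg, ← Algebra.commutes (koszulAnchor φ y (X j))]

/-- The anchor is compatible with the binary bracket: contract the bracket with `dφ`, and insert the
resulting vector fields `ρ(x)`, `ρ(y)` in the untruncated binary bracket. -/
theorem anchor_bracket_two (φ : PolyFun d) {x y : koszulModule d}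
    (hx : x ∈ (koszulLieInfty φ).grading (-1)) (hy : y ∈ (koszulLieInfty φ).grading (-1)) :
    koszulAnchor φ ((koszulLieInfty φ).bracket 2 ![x, y]) =
      ⁅koszulAnchor φ x, koszulAnchor φ y⁆ := by
  have hx2 := (mem_grading_iff φ le_rfl).1 hx
  have hy2 := (mem_grading_iff φ le_rfl).1 hy
  change x.1 ∈ ⋀[PolyFun d]^2 (VF d) at hx2
  change y.1 ∈ ⋀[PolyFun d]^2 (VF d) at hy2
  have hxy : ∀ k, ![x, y] k ∈ (koszulLieInfty φ).grading (-1) := fun k => by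
    fin_cases k; exacts [hx, hy]
  have hb := (mem_grading_iff φ (by norm_num)).1 (bracket_mem_grading φ (deg := fun _ => -1) hxy)
  change ((koszulLieInfty φ).bracket 2 ![x, y] : PV d) ∈ ⋀[PolyFun d]^2 (VF d) at hb
  have hv : ∀ (a : PV d) (k : Fin 1) (b : PV d), Function.update ![a] k b = ![b] := fun a k b => by
    funext i; rw [Subsingleton.elim k 0, Subsingleton.elim i 0]; simp
  rw [← ExteriorAlgebra.ι_inj (PolyFun d), ι_koszulAnchor φ hb,
    coe_bracket φ (by norm_num) (fun k => hasDeg_of_mem_grading (hxy k)),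
    correction_two φ (hasDeg_of_mem_grading (hxy 0)), map_add]
  have h2 : (fun k => (![x, y] k).1) = ![x.1, y.1] := by
    funext k; fin_cases k <;> rfl
  rw [h2, contract_fullBracket_two φ hx2 hy2, fullBracket_cons_ι, fullBracket_cons_ι]
  simp only [Fin.sum_univ_one, hv, fullBracket_one, Matrix.cons_val_zero, Matrix.cons_val_one,
    Matrix.cons_val_fin_one, Int.negOnePow_neg, Int.negOnePow_one, Units.neg_smul, one_smul,
    map_add, map_neg]
  rw [← neg_neg (contract φ y.1), ← neg_neg (contract φ x.1), ← ι_koszulAnchor φ hx2,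
    ← ι_koszulAnchor φ hy2, map_neg, map_neg, coeffDeriv_ι, coeffDeriv_ι, ← vfDeriv_sub_vfDeriv,
    map_sub]
  abel

end Brackets

/-! ### Shuffles of one and two entries -/

section SmallShuffles

/-- The permutation with `k ↦ m.succAbove k` for `k < n` and `n ↦ m`. -/
def snocPerm {n : ℕ} (m : Fin (n + 1)) : Equiv.Perm (Fin (n + 1)) :=
  (finRotate (n + 1)).trans (consPerm m 1)

@[simp] theorem snocPerm_castSucc {n : ℕ} (m : Fin (n + 1)) (k : Fin n) :
    snocPerm m k.castSucc = m.succAbove k := by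
  have : finRotate (n + 1) k.castSucc = k.succ := by
    rw [finRotate_apply, Fin.coeSucc_eq_succ]
  simp [snocPerm, this]

@[simp] theorem snocPerm_last {n : ℕ} (m : Fin (n + 1)) : snocPerm m (Fin.last n) = m := by
  simp [snocPerm]

theorem koszulSign_snocPerm_eq_prod {n : ℕ} (deg : Fin (n + 1) → ℤ) (m : Fin (n + 1)) :
    koszulSign (snocPerm m) deg = ∏ k : Fin n,
      if m < m.succAbove k then Int.negOnePow (deg m * deg (m.succAbove k)) else 1 := by
  unfold koszulSign
  rw [Fin.prod_univ_castSucc]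
  have h2 : (∏ b : Fin (n + 1), if Fin.last n < b ∧ snocPerm m b < snocPerm m (Fin.last n) then
      Int.negOnePow (deg (snocPerm m (Fin.last n)) * deg (snocPerm m b)) else 1) = 1 :=
    Finset.prod_eq_one fun b _ => if_neg fun h => absurd h.1 (not_lt.2 (Fin.le_last b))
  rw [h2, mul_one]
  refine Finset.prod_congr rfl fun k _ => ?_
  rw [Fin.prod_univ_castSucc]
  have h3 : (∏ b : Fin n, if k.castSucc < b.castSucc ∧
      snocPerm m b.castSucc < snocPerm m k.castSucc then Int.negOnePow
        (deg (snocPerm m k.castSucc) * deg (snocPerm m b.castSucc)) else 1) = 1 :=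
    Finset.prod_eq_one fun b _ => if_neg fun h => by
      rw [snocPerm_castSucc, snocPerm_castSucc, Fin.succAbove_lt_succAbove_iff] at h
      exact lt_asymm h.1 h.2
  rw [h3, one_mul, snocPerm_castSucc, snocPerm_last, mul_comm (deg m)]
  simp [Fin.castSucc_lt_last]

/-- If the `m`-th entry has degree `-1`, moving it to the last place and then across an operation
of degree `1` gives the opposite of the sign for moving it to the first place. -/
theorem koszulSign_snocPerm {n : ℕ} {deg : Fin (n + 1) → ℤ} {m : Fin (n + 1)} (hm : deg m = -1) :
    koszulSign (snocPerm m) deg * Int.negOnePow ((∑ k, deg (m.succAbove k)) + 1) =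
      -frontSign deg m := by
  have h2 : koszulSign (snocPerm m) deg * frontSign deg m =
      Int.negOnePow (∑ k, deg (m.succAbove k)) := by
    rw [koszulSign_snocPerm_eq_prod, frontSign, ← Finset.prod_mul_distrib]
    have h3 : ∀ s : Finset (Fin n), ∏ k ∈ s, Int.negOnePow (deg (m.succAbove k)) =
        Int.negOnePow (∑ k ∈ s, deg (m.succAbove k)) := fun s => by
      induction s using Finset.cons_induction with
      | empty => simp
      | cons a s h ih => rw [Finset.prod_cons, Finset.sum_cons, Int.negOnePow_add, ih]
    rw [← h3]
    refine Finset.prod_congr rfl fun k _ => ?_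
    rw [hm, neg_one_mul, Int.negOnePow_neg]
    rcases lt_or_gt_of_ne (Fin.ne_succAbove m k) with h | h
    · rw [if_pos h, if_neg (lt_asymm h), mul_one]
    · rw [if_neg (lt_asymm h), if_pos h, one_mul]
  rw [Int.negOnePow_succ, ← h2, mul_neg, ← mul_assoc, Int.units_mul_self, one_mul]

/-- Exchanging the first two entries of a permutation. -/
theorem koszulSign_swap {n : ℕ} {σ τ : Equiv.Perm (Fin (n + 2))} (deg : Fin (n + 2) → ℤ)
    (h0 : τ 0 = σ 1) (h1 : τ 1 = σ 0) (h : ∀ k : Fin n, τ k.succ.succ = σ k.succ.succ) :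
    koszulSign τ deg = Int.negOnePow (deg (σ 0) * deg (σ 1)) * koszulSign σ deg := by
  have hne : σ 0 ≠ σ 1 := fun h => by simpa using σ.injective h
  unfold koszulSign
  simp only [Fin.prod_univ_succ, Fin.succ_zero_eq_one, h, h0, h1]
  simp only [lt_self_iff_false, false_and, if_false, one_mul, Fin.zero_lt_one, true_and,
    Fin.succ_pos, Fin.not_lt_zero, Fin.one_lt_succ_succ, mul_comm (deg (σ 1)) (deg (σ 0))]
  have h10 : ∀ k : Fin n, ¬ k.succ.succ < 1 := fun k => not_lt.2 (Fin.one_lt_succ_succ k).le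
  simp only [h10, false_and, if_false, one_mul]
  rcases lt_or_gt_of_ne hne with hlt | hlt
  · rw [if_pos hlt, if_neg (lt_asymm hlt), one_mul]
    ac_rfl
  · rw [if_neg (lt_asymm hlt), if_pos hlt, one_mul]
    generalize (deg (σ 0) * deg (σ 1)).negOnePow = s
    rcases Int.units_eq_one_or s with rfl | rfl <;> simp <;> ac_rfl

theorem isShuffle_consPerm {n : ℕ} (m : Fin (n + 1)) : IsShuffle 1 (consPerm m 1) := by
  intro a b hab h
  induction a using Fin.cases with
  | zero =>
    have : 0 < b.val := hab
    rcases h with h | h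
    · omega
    · simp at h
  | succ a =>
    induction b using Fin.cases with
    | zero => exact absurd hab (Fin.not_lt_zero _)
    | succ b =>
      rw [consPerm_succ, consPerm_succ, Fin.succAbove_lt_succAbove_iff]
      exact Fin.succ_lt_succ_iff.1 hab

theorem isShuffle_snocPerm {n : ℕ} (m : Fin (n + 1)) : IsShuffle n (snocPerm m) := by
  intro a b hab h
  induction a using Fin.lastCases with
  | last => exact absurd hab (not_lt.2 (Fin.le_last b))
  | cast a =>
    induction b using Fin.lastCases with
    | last => rcases h with h | h <;> simp at h; omega
    | cast b =>
      rw [snocPerm_castSucc, snocPerm_castSucc, Fin.succAbove_lt_succAbove_iff]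
      exact hab

theorem isShuffle_consPerm_consPerm {n : ℕ} {m : Fin (n + 2)} {k : Fin (n + 1)}
    (h : m ≤ k.castSucc) : IsShuffle 2 (consPerm m (consPerm k 1)) := by
  intro a b hab hb
  induction a using Fin.cases with
  | zero =>
    have hb' : b.val < 2 := by
      rcases hb with h | h
      · exact h
      · simp at h
    have : b = Fin.succ 0 := Fin.ext (by
      have : 0 < b.val := hab
      simp; omega)
    rw [this, consPerm_zero, consPerm_succ, consPerm_zero]
    exact (Fin.lt_succAbove_iff_le_castSucc _ _).2 h
  | succ a =>
    induction b using Fin.cases with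
    | zero => exact absurd hab (Fin.not_lt_zero _)
    | succ b =>
      rw [consPerm_succ, consPerm_succ, Fin.succAbove_lt_succAbove_iff]
      refine isShuffle_consPerm k a b (Fin.succ_lt_succ_iff.1 hab) ?_
      simpa [Nat.succ_le_iff] using hb

variable {V : Type*} [AddCommMonoid V]

open Classical in
theorem sum_isShuffle_one {n : ℕ} (F : Equiv.Perm (Fin (n + 1)) → V) :
    ∑ σ ∈ Finset.univ.filter (IsShuffle 1), F σ = ∑ m, F (consPerm m 1) := by
  symm
  refine Finset.sum_bij (fun m _ => consPerm m 1) (fun m _ => ?_) (fun a _ b _ h => ?_)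
    (fun σ hσ => ⟨σ 0, Finset.mem_univ _, ?_⟩) (fun _ _ => rfl)
  · simpa using isShuffle_consPerm m
  · simpa using congrArg (fun σ => σ 0) h
  · refine isShuffle_ext (isShuffle_consPerm _) (by simpa using hσ) ?_
    have : ∀ σ : Equiv.Perm (Fin (n + 1)), headSet 1 σ = {σ 0} := fun σ => by
      ext a
      obtain ⟨a, rfl⟩ := σ.surjective a
      rw [apply_mem_headSet, Finset.mem_singleton, EmbeddingLike.apply_eq_iff_eq, Fin.ext_iff]
      simp
    rw [this, this, consPerm_zero]

open Classical in
theorem sum_isShuffle_pred {n : ℕ} (F : Equiv.Perm (Fin (n + 1)) → V) :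
    ∑ σ ∈ Finset.univ.filter (IsShuffle n), F σ = ∑ m, F (snocPerm m) := by
  symm
  refine Finset.sum_bij (fun m _ => snocPerm m) (fun m _ => ?_) (fun a _ b _ h => ?_)
    (fun σ hσ => ⟨σ (Fin.last n), Finset.mem_univ _, ?_⟩) (fun _ _ => rfl)
  · simpa using isShuffle_snocPerm m
  · simpa using congrArg (fun σ => σ (Fin.last n)) h
  · refine isShuffle_ext (isShuffle_snocPerm _) (by simpa using hσ) ?_
    have : ∀ σ : Equiv.Perm (Fin (n + 1)), headSet n σ = {σ (Fin.last n)}ᶜ := fun σ => by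
      ext a
      obtain ⟨a, rfl⟩ := σ.surjective a
      rw [apply_mem_headSet, Finset.mem_compl, Finset.mem_singleton, EmbeddingLike.apply_eq_iff_eq,
        Fin.ext_iff, Fin.val_last]
      omega
    rw [this, this, snocPerm_last]

open Classical in
theorem sum_isShuffle_self {n : ℕ} (F : Equiv.Perm (Fin n) → V) :
    ∑ σ ∈ Finset.univ.filter (IsShuffle n), F σ = F 1 := by
  have h1 : IsShuffle n (1 : Equiv.Perm (Fin n)) := fun a b hab _ => hab
  have : Finset.univ.filter (IsShuffle n) = {(1 : Equiv.Perm (Fin n))} := by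
    ext σ
    rw [Finset.mem_filter, Finset.mem_singleton]
    refine ⟨fun h => isShuffle_ext h.2 h1 ?_, fun h => ⟨Finset.mem_univ _, h ▸ h1⟩⟩
    ext a
    obtain ⟨b, hb⟩ := σ.surjective a
    rw [← hb, apply_mem_headSet]
    have : σ b = (1 : Equiv.Perm (Fin n)) (σ b) := rfl
    rw [this, apply_mem_headSet]
    simp
  rw [this, Finset.sum_singleton]

open Classical in
/-- The `(2, n)`-shuffles put the entry `m` first and the entry `m.succAbove k` second, where
`m < m.succAbove k`. -/
theorem sum_isShuffle_two {n : ℕ} (F : Equiv.Perm (Fin (n + 2)) → V) :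
    ∑ σ ∈ Finset.univ.filter (IsShuffle 2), F σ =
      ∑ p ∈ Finset.univ.filter (fun p : Fin (n + 2) × Fin (n + 1) => p.1 ≤ p.2.castSucc),
        F (consPerm p.1 (consPerm p.2 1)) := by
  symm
  refine Finset.sum_bij (fun p _ => consPerm p.1 (consPerm p.2 1)) (fun p hp => ?_)
    (fun p _ q _ h => ?_) (fun σ hσ => ?_) (fun _ _ => rfl)
  · simpa using isShuffle_consPerm_consPerm (by simpa using hp)
  · have h1 : p.1 = q.1 := by simpa using congrArg (fun σ => σ 0) h
    have h2 := congrArg (fun σ => σ (Fin.succ 0)) h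
    simp only [consPerm_succ, consPerm_zero, h1] at h2
    exact Prod.ext h1 (Fin.succAbove_right_injective h2)
  · obtain ⟨m, τ, rfl⟩ := exists_eq_consPerm σ
    obtain ⟨k, τ, rfl⟩ := exists_eq_consPerm τ
    have hs : IsShuffle 2 (consPerm m (consPerm k τ)) := by simpa using hσ
    have hmk : m ≤ k.castSucc := by
      have := hs 0 (Fin.succ 0) (Fin.succ_pos _) (Or.inl (by simp))
      rw [consPerm_zero, consPerm_succ, consPerm_zero] at this
      exact (Fin.lt_succAbove_iff_le_castSucc _ _).1 this
    refine ⟨(m, k), by simpa using hmk, isShuffle_ext (isShuffle_consPerm_consPerm hmk) hs ?_⟩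
    have : ∀ σ : Equiv.Perm (Fin (n + 2)), headSet 2 σ = {σ 0, σ (Fin.succ 0)} := fun σ => by
      ext a
      obtain ⟨a, rfl⟩ := σ.surjective a
      rw [apply_mem_headSet, Finset.mem_insert, Finset.mem_singleton, EmbeddingLike.apply_eq_iff_eq,
        EmbeddingLike.apply_eq_iff_eq, Fin.ext_iff, Fin.ext_iff, Fin.val_succ, Fin.val_zero,
        Fin.val_zero]
      omega
    rw [this, this, consPerm_zero, consPerm_succ, consPerm_zero, consPerm_zero, consPerm_succ,
      consPerm_zero]

end SmallShuffles

/-! ### The Jacobi identities -/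

section Jacobi

variable {d : ℕ} {n : ℕ}

theorem coe_units_smul (s : ℤˣ) (P : koszulModule d) :
    ((s • P : koszulModule d) : PV d) = s • P.1 := by
  rcases Int.units_eq_one_or s with h | h <;> simp [h]

open Classical in
/-- By the Jacobi identities of the untruncated brackets, only the terms that involve a correction
of the inner or of the outer bracket contribute to the Jacobiator. -/
theorem coe_jacobiator (φ : PolyFun d) {x : Fin n → koszulModule d} {deg : Fin n → ℤ}
    (hx : ∀ k, x k ∈ (koszulLieInfty φ).grading (deg k)) :
    ((koszulLieInfty φ).jacobiator x deg : PV d) =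
      (∑ i : Fin n, ∑ σ ∈ (Finset.univ : Finset (Equiv.Perm (Fin n))).filter
        (IsShuffle (i.val + 1)), koszulSign σ deg • fullBracket φ (n - (i.val + 1) + 1)
          (Fin.cons (correction φ (i.val + 1) fun a => x (σ (Fin.castLE i.isLt a)))
            fun b : Fin (n - (i.val + 1)) =>
              (x (σ ⟨i.val + 1 + b.val, by have := b.isLt; omega⟩)).1)) +
      ∑ i : Fin n, ∑ σ ∈ (Finset.univ : Finset (Equiv.Perm (Fin n))).filter
        (IsShuffle (i.val + 1)), koszulSign σ deg • correction φ (n - (i.val + 1) + 1)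
          (Fin.cons ((koszulLieInfty φ).bracket (i.val + 1) fun a => x (σ (Fin.castLE i.isLt a)))
            fun b : Fin (n - (i.val + 1)) =>
              x (σ ⟨i.val + 1 + b.val, by have := b.isLt; omega⟩)) := by
  have hd : ∀ k, HasDeg (x k).1 (deg k) := fun k => hasDeg_of_mem_grading (hx k)
  rw [← zero_add (∑ i : Fin n, ∑ σ ∈ _, koszulSign σ deg • fullBracket φ _ _),
    ← fullBracket_jacobi φ hd, ← Finset.sum_add_distrib, ← Finset.sum_add_distrib,
    LieInftyData.jacobiator, AddSubmonoidClass.coe_finsetSum]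
  refine Finset.sum_congr rfl fun i _ => ?_
  rw [← Finset.sum_add_distrib, ← Finset.sum_add_distrib, AddSubmonoidClass.coe_finsetSum]
  refine Finset.sum_congr rfl fun σ _ => ?_
  rw [coe_units_smul, ← smul_add, ← smul_add]
  congr 1
  have hinner := bracket_mem_grading φ fun a => hx (σ (Fin.castLE i.isLt a))
  have hy : ∀ k, HasDeg ((Fin.cons ((koszulLieInfty φ).bracket (i.val + 1)
      fun a => x (σ (Fin.castLE i.isLt a))) fun b : Fin (n - (i.val + 1)) =>
        x (σ ⟨i.val + 1 + b.val, by have := b.isLt; omega⟩) :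
          Fin (n - (i.val + 1) + 1) → koszulModule d) k).1
      ((Fin.cons ((∑ a : Fin (i.val + 1), deg (σ (Fin.castLE i.isLt a))) + 1)
        fun b : Fin (n - (i.val + 1)) =>
          deg (σ ⟨i.val + 1 + b.val, by have := b.isLt; omega⟩) :
            Fin (n - (i.val + 1) + 1) → ℤ) k) := fun k => by
    induction k using Fin.cases with
    | zero => exact hasDeg_of_mem_grading hinner
    | succ k => exact hd _
  rw [coe_bracket φ (by omega) hy, ← fullBracket_cons_add, ← coe_bracket φ (by omega)
    (fun a => hd (σ (Fin.castLE i.isLt a)))]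
  congr 2
  funext k
  induction k using Fin.cases with
  | zero => rfl
  | succ k => rfl

variable {r : ℕ}

open Classical in
/-- The terms in which the inner bracket is the correction `c₁ = ι ∘ ρ`. The arities `m` and `s` are
variables because they are given by arithmetic expressions in the Jacobiator. -/
theorem sum_correction_one (φ : PolyFun d) (x : Fin (r + 2) → koszulModule d)
    (deg : Fin (r + 2) → ℤ) (m s : ℕ) (hm : m = 1) (hs : s = r + 1) (h : m ≤ r + 2)
    (hb : ∀ b : Fin s, m + b.val < r + 2) :
    ∑ σ ∈ (Finset.univ : Finset (Equiv.Perm (Fin (r + 2)))).filter (IsShuffle m),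
      koszulSign σ deg • fullBracket φ (s + 1)
        (Fin.cons (correction φ m fun a => x (σ (Fin.castLE h a)))
          fun b : Fin s => (x (σ ⟨m + b.val, hb b⟩)).1) =
    ∑ m, frontSign deg m • fullBracket φ (r + 2)
      (Fin.cons (ExteriorAlgebra.ι (PolyFun d) (koszulAnchor φ (x m)))
        fun k => (x (m.succAbove k)).1) := by
  subst hm hs
  rw [sum_isShuffle_one]
  refine Finset.sum_congr rfl fun m _ => ?_
  rw [koszulSign_consPerm, koszulSign_one, mul_one, correction]
  have h0 : Fin.castLE h 0 = 0 := rfl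
  have h1 : ∀ b : Fin (r + 1), (⟨1 + b.val, hb b⟩ : Fin (r + 2)) = b.succ := fun b =>
    Fin.ext (by simp [add_comm])
  simp only [h0, h1, consPerm_zero, consPerm_succ, Equiv.Perm.coe_one, id_eq]

/-- The term of the Jacobi identity in which the `m`-th argument acts by its anchor on the argument
`m.succAbove k`, the result being moved to the first place. -/
def anchorTerm (φ : PolyFun d) (x : Fin (r + 2) → koszulModule d) (deg : Fin (r + 2) → ℤ)
    (p : Fin (r + 2) × Fin (r + 1)) : PV d :=
  koszulSign (consPerm p.1 (consPerm p.2 1)) deg • fullBracket φ (r + 1)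
    (Fin.cons (coeffDeriv (koszulAnchor φ (x p.1)) (x (p.1.succAbove p.2)).1)
      fun j => (x (p.1.succAbove (p.2.succAbove j))).1)

theorem anchorTerm_eq (φ : PolyFun d) {x : Fin (r + 2) → koszulModule d} {deg : Fin (r + 2) → ℤ}
    (hx : ∀ k, HasDeg (x k).1 (deg k)) (p : Fin (r + 2) × Fin (r + 1)) :
    anchorTerm φ x deg p = frontSign deg p.1 • fullBracket φ (r + 1)
      (Function.update (fun k => (x (p.1.succAbove k)).1) p.2
        (coeffDeriv (koszulAnchor φ (x p.1)) (x (p.1.succAbove p.2)).1)) := by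
  obtain ⟨m, k⟩ := p
  have hz : ∀ j, HasDeg (Function.update (fun k => (x (m.succAbove k)).1) k
      (coeffDeriv (koszulAnchor φ (x m)) (x (m.succAbove k)).1) j) (deg (m.succAbove j)) :=
    fun j => by
      by_cases h : j = k
      · subst h
        rw [Function.update_self]
        exact coeffDeriv_mem _ (hx _)
      · rw [Function.update_of_ne h]
        exact hx _
  have h := fullBracket_comp_perm φ hz (consPerm k 1)
  have h2 : (fun j => Function.update (fun k => (x (m.succAbove k)).1) k
      (coeffDeriv (koszulAnchor φ (x m)) (x (m.succAbove k)).1) (consPerm k 1 j)) =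
      Fin.cons (coeffDeriv (koszulAnchor φ (x m)) (x (m.succAbove k)).1)
        fun j => (x (m.succAbove (k.succAbove j))).1 := by
    funext j
    induction j using Fin.cases with
    | zero => simp
    | succ j => simp
  rw [h2] at h
  rw [anchorTerm, h, koszulSign_consPerm, smul_smul, mul_assoc, Int.units_mul_self, mul_one]

/-- The pair `(m, k)` encodes the ordered pair `(m, m.succAbove k)` of distinct arguments; this
exchanges the two. -/
def swapPair : Fin (r + 2) × Fin (r + 1) ≃ Fin (r + 2) × Fin (r + 1) where
  toFun p := (p.1.succAbove p.2, p.2.predAbove p.1)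
  invFun p := (p.1.succAbove p.2, p.2.predAbove p.1)
  left_inv _ := Prod.ext (Fin.succAbove_succAbove_predAbove _ _)
    (Fin.predAbove_predAbove_succAbove _ _)
  right_inv _ := Prod.ext (Fin.succAbove_succAbove_predAbove _ _)
    (Fin.predAbove_predAbove_succAbove _ _)

theorem anchorTerm_swapPair (φ : PolyFun d) {x : Fin (r + 2) → koszulModule d}
    {deg : Fin (r + 2) → ℤ} (hx : ∀ k, x k ∈ (koszulLieInfty φ).grading (deg k))
    (p : Fin (r + 2) × Fin (r + 1)) :
    anchorTerm φ x deg (swapPair p) =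
      (koszulSign (consPerm p.1 (consPerm p.2 1)) deg * Int.negOnePow (deg p.1)) •
        fullBracket φ (r + 1)
          (Fin.cons (coeffDeriv (koszulAnchor φ (x (p.1.succAbove p.2))) (x p.1).1)
            fun j => (x (p.1.succAbove (p.2.succAbove j))).1) := by
  obtain ⟨m, k⟩ := p
  simp only [anchorTerm, swapPair, Equiv.coe_fn_mk, Fin.succAbove_succAbove_predAbove,
    Fin.succAbove_succAbove_succAbove_predAbove]
  rcases anchor_eq_zero_or_eq_neg_one φ (hx (m.succAbove k)) with h | h
  · simp [h, fullBracket_cons]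
  · congr 1
    rw [koszulSign_swap (σ := consPerm m (consPerm k 1)) deg]
    · have h1 : consPerm m (consPerm k 1) 1 = m.succAbove k := by
        rw [← Fin.succ_zero_eq_one, consPerm_succ, consPerm_zero]
      rw [h1, consPerm_zero, h, mul_neg_one, Int.negOnePow_neg, mul_comm]
    · rw [← Fin.succ_zero_eq_one, consPerm_succ, consPerm_zero, consPerm_zero]
    · rw [← Fin.succ_zero_eq_one, consPerm_succ, consPerm_zero, consPerm_zero,
        Fin.succAbove_succAbove_predAbove]
    · intro j
      simp only [consPerm_succ, Equiv.Perm.coe_one, id_eq,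
        Fin.succAbove_succAbove_succAbove_predAbove]

open Classical in
/-- The terms in which the inner bracket is the correction `c₂`: its two summands together run over all
ordered pairs of distinct arguments. -/
theorem sum_correction_two (φ : PolyFun d) {x : Fin (r + 2) → koszulModule d}
    {deg : Fin (r + 2) → ℤ} (hx : ∀ k, x k ∈ (koszulLieInfty φ).grading (deg k))
    (m s : ℕ) (hm : m = 2) (hs : s = r) (h : m ≤ r + 2)
    (hb : ∀ b : Fin s, m + b.val < r + 2) :
    ∑ σ ∈ (Finset.univ : Finset (Equiv.Perm (Fin (r + 2)))).filter (IsShuffle m),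
      koszulSign σ deg • fullBracket φ (s + 1)
        (Fin.cons (correction φ m fun a => x (σ (Fin.castLE h a)))
          fun b : Fin s => (x (σ ⟨m + b.val, hb b⟩)).1) = ∑ p, anchorTerm φ x deg p := by
  subst hm hs
  rw [sum_isShuffle_two]
  have h0 : Fin.castLE h 0 = 0 := rfl
  have h1 : Fin.castLE h 1 = Fin.succ 0 := rfl
  have h2 : ∀ b : Fin s, (⟨2 + b.val, hb b⟩ : Fin (s + 2)) = b.succ.succ := fun b =>
    Fin.ext (by simp only [Fin.val_succ]; omega)
  have hterm : ∀ p : Fin (s + 2) × Fin (s + 1),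
      koszulSign (consPerm p.1 (consPerm p.2 1)) deg • fullBracket φ (s + 1)
        (Fin.cons (correction φ 2 fun a => x (consPerm p.1 (consPerm p.2 1) (Fin.castLE h a)))
          fun b : Fin s => (x (consPerm p.1 (consPerm p.2 1) ⟨2 + b.val, hb b⟩)).1) =
      anchorTerm φ x deg p + anchorTerm φ x deg (swapPair p) := fun p => by
    rw [anchorTerm_swapPair φ hx, anchorTerm, correction_two φ (e := deg p.1)
      (by rw [h0, consPerm_zero]; exact hasDeg_of_mem_grading (hx _)), fullBracket_cons_add,
      fullBracket_cons_units_smul, smul_add, smul_smul]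
    simp only [h0, h1, h2, consPerm_zero, consPerm_succ, Equiv.Perm.coe_one, id_eq]
  rw [Finset.sum_congr rfl fun p _ => hterm p, Finset.sum_add_distrib,
    ← Finset.sum_filter_add_sum_filter_not Finset.univ
      (fun p : Fin (s + 2) × Fin (s + 1) => p.1 ≤ p.2.castSucc) (anchorTerm φ x deg)]
  refine congrArg₂ (· + ·) rfl ?_
  refine Finset.sum_equiv swapPair (fun p => ?_) (fun p _ => rfl)
  have : p.1 = (p.1.succAbove p.2).succAbove (p.2.predAbove p.1) :=
    (Fin.succAbove_succAbove_predAbove _ _).symm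
  simp only [Finset.mem_filter, Finset.mem_univ, true_and, swapPair, Equiv.coe_fn_mk, not_le]
  rw [← Fin.succAbove_lt_iff_castSucc_lt, ← this, Fin.lt_succAbove_iff_le_castSucc]

/-- All terms in which the inner bracket is corrected: the correction `c₂` compensates the derivatives
of the arguments that occur in `fullBracket_cons_ι`. -/
theorem sum_inner_correction (φ : PolyFun d) {x : Fin (r + 2) → koszulModule d}
    {deg : Fin (r + 2) → ℤ} (hx : ∀ k, x k ∈ (koszulLieInfty φ).grading (deg k)) :
    (∑ m, frontSign deg m • fullBracket φ (r + 2)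
      (Fin.cons (ExteriorAlgebra.ι (PolyFun d) (koszulAnchor φ (x m)))
        fun k => (x (m.succAbove k)).1)) + ∑ p, anchorTerm φ x deg p =
      ∑ m, frontSign deg m • coeffDeriv (koszulAnchor φ (x m))
        (fullBracket φ (r + 1) fun k => (x (m.succAbove k)).1) := by
  rw [Fintype.sum_prod_type, ← Finset.sum_add_distrib]
  refine Finset.sum_congr rfl fun m _ => ?_
  rw [fullBracket_cons_ι, smul_sub, Finset.smul_sum]
  simp only [anchorTerm_eq φ fun k => hasDeg_of_mem_grading (hx k)]
  exact sub_add_cancel _ _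

open Classical in
/-- The terms in which the outer bracket is the correction `c₁`. -/
theorem sum_outer_correction_one (φ : PolyFun d) (x : Fin (r + 2) → koszulModule d)
    (deg : Fin (r + 2) → ℤ) (m s : ℕ) (hm : m = r + 2) (hs : s = 0) (h : m ≤ r + 2)
    (hb : ∀ b : Fin s, m + b.val < r + 2) :
    ∑ σ ∈ (Finset.univ : Finset (Equiv.Perm (Fin (r + 2)))).filter (IsShuffle m),
      koszulSign σ deg • correction φ (s + 1)
        (Fin.cons ((koszulLieInfty φ).bracket m fun a => x (σ (Fin.castLE h a)))
          fun b : Fin s => x (σ ⟨m + b.val, hb b⟩)) =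
    ExteriorAlgebra.ι (PolyFun d) (koszulAnchor φ ((koszulLieInfty φ).bracket (r + 2) x)) := by
  subst hm hs
  rw [sum_isShuffle_self, koszulSign_one, one_smul]
  rfl

open Classical in
/-- The terms in which the outer bracket is the correction `c₂`. -/
theorem sum_outer_correction_two (φ : PolyFun d) {x : Fin (r + 2) → koszulModule d}
    {deg : Fin (r + 2) → ℤ} (hx : ∀ k, x k ∈ (koszulLieInfty φ).grading (deg k))
    (m s : ℕ) (hm : m = r + 1) (hs : s = 1) (h : m ≤ r + 2)
    (hb : ∀ b : Fin s, m + b.val < r + 2) :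
    ∑ σ ∈ (Finset.univ : Finset (Equiv.Perm (Fin (r + 2)))).filter (IsShuffle m),
      koszulSign σ deg • correction φ (s + 1)
        (Fin.cons ((koszulLieInfty φ).bracket m fun a => x (σ (Fin.castLE h a)))
          fun b : Fin s => x (σ ⟨m + b.val, hb b⟩)) =
    ∑ m, (koszulSign (snocPerm m) deg • coeffDeriv (koszulAnchor φ
          ((koszulLieInfty φ).bracket (r + 1) fun k => x (m.succAbove k))) (x m).1 -
        frontSign deg m • coeffDeriv (koszulAnchor φ (x m))
          ((koszulLieInfty φ).bracket (r + 1) fun k => x (m.succAbove k) : PV d)) := by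
  subst hm hs
  rw [sum_isShuffle_pred]
  refine Finset.sum_congr rfl fun m _ => ?_
  have h0 : ∀ a : Fin (r + 1), Fin.castLE h a = a.castSucc := fun a => rfl
  have h1 : ∀ b : Fin 1, (⟨r + 1 + b.val, hb b⟩ : Fin (r + 2)) = Fin.last _ := fun b =>
    Fin.ext (by simp)
  have hI := bracket_mem_grading φ fun a => hx (m.succAbove a)
  simp only [h0, h1, snocPerm_castSucc, snocPerm_last]
  rw [correction_two φ (e := (∑ k, deg (m.succAbove k)) + 1) (hasDeg_of_mem_grading hI), smul_add,
    smul_smul]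
  simp only [Fin.cons_zero, Fin.cons_one]
  rcases anchor_eq_zero_or_eq_neg_one φ (hx m) with h | h
  · simp [h]
  · rw [koszulSign_snocPerm h, Units.neg_smul, sub_eq_add_neg]

/-- The Jacobiator after the derivatives of the untruncated bracket `Λ_{r+1}` have cancelled. -/
theorem coe_jacobiator_add_two (φ : PolyFun d) {x : Fin (r + 2) → koszulModule d}
    {deg : Fin (r + 2) → ℤ} (hx : ∀ k, x k ∈ (koszulLieInfty φ).grading (deg k)) :
    ((koszulLieInfty φ).jacobiator x deg : PV d) =
      ∑ m, (koszulSign (snocPerm m) deg • coeffDeriv (koszulAnchor φ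
          ((koszulLieInfty φ).bracket (r + 1) fun k => x (m.succAbove k))) (x m).1 -
        frontSign deg m • coeffDeriv (koszulAnchor φ (x m))
          (correction φ (r + 1) fun k => x (m.succAbove k))) +
      ExteriorAlgebra.ι (PolyFun d) (koszulAnchor φ ((koszulLieInfty φ).bracket (r + 2) x)) := by
  have hzero : ∀ (s : ℕ) (y : Fin s → PV d), fullBracket φ (s + 1) (Fin.cons 0 y) = 0 :=
    fun s y => by simp [fullBracket_cons]
  rw [coe_jacobiator φ hx]
  refine (congrArg₂ (· + ·) (x' := ∑ m, frontSign deg m • coeffDeriv (koszulAnchor φ (x m))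
        (fullBracket φ (r + 1) fun k => (x (m.succAbove k)).1))
      (y' := ∑ m, (koszulSign (snocPerm m) deg • coeffDeriv (koszulAnchor φ
          ((koszulLieInfty φ).bracket (r + 1) fun k => x (m.succAbove k))) (x m).1 -
        frontSign deg m • coeffDeriv (koszulAnchor φ (x m))
          ((koszulLieInfty φ).bracket (r + 1) fun k => x (m.succAbove k) : PV d)) +
        ExteriorAlgebra.ι (PolyFun d) (koszulAnchor φ ((koszulLieInfty φ).bracket (r + 2) x)))
      ?_ ?_).trans ?_
  · rw [← sum_inner_correction φ hx, Fin.sum_univ_succ, Fin.sum_univ_succ]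
    refine congrArg₂ (· + ·) (sum_correction_one φ x deg _ _ (by simp) (by simp) _ _) ?_
    refine (congrArg₂ (· + ·) (sum_correction_two φ hx _ _ (by simp) (by simp) _ _)
      (Finset.sum_eq_zero fun i _ => Finset.sum_eq_zero fun σ _ => ?_)).trans (add_zero _)
    rw [correction_of_three_le φ (by simp), hzero, smul_zero]
  · rw [Fin.sum_univ_castSucc, Fin.sum_univ_castSucc]
    refine congrArg₂ (· + ·) ?_ (sum_outer_correction_one φ x deg _ _ (by simp) (by simp) _ _)
    refine (congrArg₂ (· + ·) (Finset.sum_eq_zero fun i _ => Finset.sum_eq_zero fun σ _ => ?_)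
      (sum_outer_correction_two φ hx _ _ (by simp) (by simp) _ _)).trans (zero_add _)
    rw [correction_of_three_le φ (by simp; omega), smul_zero]
  · rw [← add_assoc, ← Finset.sum_add_distrib]
    congr 1
    refine Finset.sum_congr rfl fun m _ => ?_
    rw [coe_bracket φ (by omega) fun k => hasDeg_of_mem_grading (hx (m.succAbove k)), map_add,
      smul_add]
    abel

end Jacobi

/-! ### Vanishing of the Jacobiator -/

section JacobiFinal

variable {d : ℕ} {n : ℕ}

theorem anchor_bracket_one_of_mem (φ : PolyFun d) {e : ℤ} {x : Fin 1 → koszulModule d}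
    (hx : x 0 ∈ (koszulLieInfty φ).grading e) :
    koszulAnchor φ ((koszulLieInfty φ).bracket 1 x) = 0 := by
  have hb := bracket_mem_grading φ (x := x) (deg := fun _ => e) fun k => by
    rwa [Subsingleton.elim k 0]
  by_contra h
  have he := (anchor_eq_zero_or_eq_neg_one φ hb).resolve_left h
  have he : e = -2 := by simp at he; omega
  subst he
  refine h ?_
  have : x = ![x 0] := by funext k; rw [Subsingleton.elim k 0]; rfl
  rw [this]
  exact anchor_bracket_one φ hx

theorem vf_lie_zero (D : VF d) : ⁅D, (0 : VF d)⁆ = 0 :=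
  Derivation.ext fun f => by simp [Derivation.commutator_apply]

theorem vf_zero_lie (D : VF d) : ⁅(0 : VF d), D⁆ = 0 :=
  Derivation.ext fun f => by simp [Derivation.commutator_apply]

theorem anchor_bracket_two_of_mem (φ : PolyFun d) {x : Fin 2 → koszulModule d} {deg : Fin 2 → ℤ}
    (hx : ∀ k, x k ∈ (koszulLieInfty φ).grading (deg k)) :
    koszulAnchor φ ((koszulLieInfty φ).bracket 2 x) =
      ⁅koszulAnchor φ (x 0), koszulAnchor φ (x 1)⁆ := by
  by_cases hdeg : ∃ k, ¬ deg k ≤ -1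
  · obtain ⟨k, hk⟩ := hdeg
    have h0 := hx k
    rw [grading_eq_bot φ (by omega), Submodule.mem_bot] at h0
    rw [MultilinearMap.map_coord_zero _ k h0, map_zero]
    obtain rfl | rfl : k = 0 ∨ k = 1 := by fin_cases k <;> simp
    · rw [h0, map_zero, vf_zero_lie]
    · rw [h0, map_zero, vf_lie_zero]
  push Not at hdeg
  by_cases h : deg 0 = -1 ∧ deg 1 = -1
  · have : x = ![x 0, x 1] := by funext k; fin_cases k <;> rfl
    conv_lhs => rw [this]
    exact anchor_bracket_two φ (h.1 ▸ hx 0) (h.2 ▸ hx 1)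
  · have h1 := hdeg 0
    have h2 := hdeg 1
    have hb := bracket_mem_grading φ hx
    rw [Fin.sum_univ_two] at hb
    rw [anchor_of_mem_grading φ (by omega) hb]
    by_cases h0 : deg 0 = -1
    · rw [anchor_of_mem_grading φ (by omega) (hx 1), vf_lie_zero]
    · rw [anchor_of_mem_grading φ h0 (hx 0), vf_zero_lie]

theorem anchor_bracket_of_three_le (φ : PolyFun d) (hn : 3 ≤ n) {x : Fin n → koszulModule d}
    {deg : Fin n → ℤ} (hx : ∀ k, x k ∈ (koszulLieInfty φ).grading (deg k)) :
    koszulAnchor φ ((koszulLieInfty φ).bracket n x) = 0 := by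
  have hd := fun k => hasDeg_of_mem_grading (hx k)
  have hmem := fullBracket_mem φ fun k => hd k
  have hcard : n ≤ ∑ k, ((deg k + 1).natAbs + 2 - 1) := by
    have : ∑ _k : Fin n, 1 ≤ ∑ k, ((deg k + 1).natAbs + 2 - 1) :=
      Finset.sum_le_sum fun k _ => by omega
    simpa using this
  refine koszulAnchor_of_mem φ (p := ∑ k, ((deg k + 1).natAbs + 2 - 1)) (by omega) ?_
  rw [coe_bracket φ (by omega) hd, correction_of_three_le φ hn, add_zero]
  exact hmem

theorem jacobiator_one (φ : PolyFun d) {x : Fin 1 → koszulModule d} {deg : Fin 1 → ℤ}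
    (hx : ∀ k, x k ∈ (koszulLieInfty φ).grading (deg k)) :
    (koszulLieInfty φ).jacobiator x deg = 0 := by
  refine Subtype.ext ?_
  have hanchor := anchor_bracket_one_of_mem φ (hx 0)
  have hc : ∀ P : PV d, contract φ (contract φ P) = 0 := fun P =>
    CliffordAlgebra.contractLeft_contractLeft (Q := (0 : QuadraticForm (PolyFun d) (VF d))) _ _
  have hι : contract φ (ExteriorAlgebra.ι (PolyFun d) (koszulAnchor φ (x 0))) = 0 := by
    have : koszulAnchor φ (x 0) φ = 0 := (koszulHook φ (x 0)).2
    rw [contract_ι, this, map_zero]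
  rw [coe_jacobiator φ hx]
  have h1 : (Finset.univ : Finset (Fin 1)) = {0} := rfl
  rw [h1, Finset.sum_singleton, Finset.sum_singleton]
  rw [Finset.sum_eq_zero, Finset.sum_eq_zero, add_zero]
  · rfl
  · intro σ _
    obtain rfl := Subsingleton.elim σ 1
    rw [koszulSign_one, one_smul]
    change ExteriorAlgebra.ι (PolyFun d) (koszulAnchor φ ((koszulLieInfty φ).bracket 1 x)) = 0
    rw [hanchor, map_zero]
  · intro σ _
    obtain rfl := Subsingleton.elim σ 1
    rw [koszulSign_one, one_smul]
    exact (fullBracket_one φ _).trans hι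

theorem neg_one_units_smul {M : Type*} [AddCommGroup M] (P : M) : (-1 : ℤˣ) • P = -P := by
  rw [Units.neg_smul, one_smul]

/-- The remainder is `ι` of `[ρ(x₀), ρ(x₁)]` minus its expression by the coefficientwise derivative,
which is torsion free. -/
theorem jacobiator_two (φ : PolyFun d) {x : Fin 2 → koszulModule d} {deg : Fin 2 → ℤ}
    (hx : ∀ k, x k ∈ (koszulLieInfty φ).grading (deg k)) :
    (koszulLieInfty φ).jacobiator x deg = 0 := by
  refine Subtype.ext ?_
  rw [coe_jacobiator_add_two φ hx, Fin.sum_univ_two]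
  have h1 : ∀ m : Fin 2, koszulAnchor φ ((koszulLieInfty φ).bracket (0 + 1)
      fun k => x (m.succAbove k)) = 0 := fun m => anchor_bracket_one_of_mem φ (hx _)
  have h01 : (0 : Fin 2).succAbove 0 = 1 := rfl
  have h10 : (1 : Fin 2).succAbove 0 = 0 := rfl
  have hs : frontSign deg 1 = Int.negOnePow (deg 1 * deg 0) := by
    change (∏ k : Fin 1, _) = _
    rw [Fin.prod_univ_one, if_pos (by decide)]
    rfl
  have hc : ∀ m : Fin 2, correction φ (0 + 1) (fun k => x (m.succAbove k)) =
      ExteriorAlgebra.ι (PolyFun d) (koszulAnchor φ (x (m.succAbove 0))) := fun m => rfl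
  rw [h1, h1, anchor_bracket_two_of_mem φ hx, ← vfDeriv_sub_vfDeriv, map_sub, ← coeffDeriv_ι,
    ← coeffDeriv_ι, hc, hc, h01, h10, frontSign_zero, hs, map_zero, LinearMap.zero_apply,
    LinearMap.zero_apply, smul_zero, smul_zero, ZeroMemClass.coe_zero, one_smul, zero_sub, zero_sub]
  rcases anchor_eq_zero_or_eq_neg_one φ (hx 0) with h | h
  · simp only [h, map_zero, LinearMap.zero_apply, smul_zero, neg_zero, add_zero, sub_zero]
  · rcases anchor_eq_zero_or_eq_neg_one φ (hx 1) with h' | h'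
    · simp only [h', map_zero, LinearMap.zero_apply, smul_zero, neg_zero, add_zero, sub_zero]
    · have hn : ∀ P : PV d, Int.negOnePow (deg 1 * deg 0) • P = -P := fun P => by
        rw [h, h', neg_one_mul, neg_neg, Int.negOnePow_one, neg_one_units_smul]
      rw [hn]
      abel

/-- The remainder vanishes because the coefficientwise derivative is flat. -/
theorem jacobiator_three (φ : PolyFun d) {x : Fin 3 → koszulModule d} {deg : Fin 3 → ℤ}
    (hx : ∀ k, x k ∈ (koszulLieInfty φ).grading (deg k)) :
    (koszulLieInfty φ).jacobiator x deg = 0 := by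
  refine Subtype.ext ?_
  rw [coe_jacobiator_add_two φ hx, Fin.sum_univ_three, anchor_bracket_of_three_le φ le_rfl hx,
    map_zero, add_zero]
  have h1 : ∀ m : Fin 3, koszulAnchor φ ((koszulLieInfty φ).bracket (1 + 1)
      fun k => x (m.succAbove k)) =
      ⁅koszulAnchor φ (x (m.succAbove 0)), koszulAnchor φ (x (m.succAbove 1))⁆ := fun m =>
    anchor_bracket_two_of_mem φ fun k => hx _
  have h2 : ∀ m : Fin 3, correction φ (1 + 1) (fun k => x (m.succAbove k)) =
      coeffDeriv (koszulAnchor φ (x (m.succAbove 0))) (x (m.succAbove 1)).1 +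
        Int.negOnePow (deg (m.succAbove 0)) •
          coeffDeriv (koszulAnchor φ (x (m.succAbove 1))) (x (m.succAbove 0)).1 := fun m =>
    correction_two φ (hasDeg_of_mem_grading (hx (m.succAbove 0)))
  have a00 : (0 : Fin 3).succAbove 0 = 1 := rfl
  have a01 : (0 : Fin 3).succAbove 1 = 2 := rfl
  have a10 : (1 : Fin 3).succAbove 0 = 0 := rfl
  have a11 : (1 : Fin 3).succAbove 1 = 2 := rfl
  have a20 : (2 : Fin 3).succAbove 0 = 0 := rfl
  have a21 : (2 : Fin 3).succAbove 1 = 1 := rfl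
  have f1 : frontSign deg 1 = Int.negOnePow (deg 1 * deg 0) := by
    simp [frontSign, Fin.prod_univ_two, a10, a11]
  have f2 : frontSign deg 2 = Int.negOnePow (deg 2 * deg 0) * Int.negOnePow (deg 2 * deg 1) := by
    rw [frontSign, Fin.prod_univ_two, a20, a21, if_pos (by decide), if_pos (by decide)]
  have k0 : koszulSign (snocPerm 0) deg =
      Int.negOnePow (deg 0 * deg 1) * Int.negOnePow (deg 0 * deg 2) := by
    rw [koszulSign_snocPerm_eq_prod, Fin.prod_univ_two, a00, a01, if_pos (by decide),
      if_pos (by decide)]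
  have k1 : koszulSign (snocPerm 1) deg = Int.negOnePow (deg 1 * deg 2) := by
    rw [koszulSign_snocPerm_eq_prod, Fin.prod_univ_two, a10, a11, if_neg (by decide),
      if_pos (by decide), one_mul]
  have k2 : koszulSign (snocPerm 2) deg = 1 := by
    rw [koszulSign_snocPerm_eq_prod, Fin.prod_univ_two, a20, a21, if_neg (by decide),
      if_neg (by decide), one_mul]
  -- The sign of `∇_{ρ i} ∇_{ρ j} P` only matters when `i` and `j` both have degree `-1`.
  have key : ∀ (i j : Fin 3) (u v : ℤˣ) (P : PV d), (deg i = -1 → deg j = -1 → u = v) →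
      u • coeffDeriv (koszulAnchor φ (x i)) (coeffDeriv (koszulAnchor φ (x j)) P) =
        v • coeffDeriv (koszulAnchor φ (x i)) (coeffDeriv (koszulAnchor φ (x j)) P) := by
    intro i j u v P h
    rcases anchor_eq_zero_or_eq_neg_one φ (hx i) with hi | hi
    · simp only [hi, map_zero, LinearMap.zero_apply, smul_zero]
    rcases anchor_eq_zero_or_eq_neg_one φ (hx j) with hj | hj
    · simp only [hj, map_zero, LinearMap.zero_apply, smul_zero]
    rw [h hi hj]
  have e1 := key 1 2 (koszulSign (snocPerm 0) deg) (frontSign deg 1 * Int.negOnePow (deg 0))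
    (x 0).1 fun h h' => by
      rw [k0, f1, h, h', mul_neg_one, neg_one_mul, Int.negOnePow_neg]
  have e2 := key 2 1 (koszulSign (snocPerm 0) deg) (-(frontSign deg 2 * Int.negOnePow (deg 0)))
    (x 0).1 fun h h' => by
      rw [k0, f2, h, h', mul_neg_one, neg_one_mul, neg_one_mul, neg_neg, Int.negOnePow_one,
        mul_neg_one, neg_mul, neg_neg, Int.negOnePow_neg]
  have e3 := key 0 2 (koszulSign (snocPerm 1) deg) (Int.negOnePow (deg 1)) (x 1).1 fun h h' => by
      rw [k1, h', mul_neg_one, Int.negOnePow_neg]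
  have e4 := key 2 0 (koszulSign (snocPerm 1) deg) (-frontSign deg 2) (x 1).1 fun h h' => by
      rw [k1, f2, h, h', mul_neg_one, neg_one_mul, neg_one_mul, neg_neg, Int.negOnePow_one,
        neg_one_mul, neg_neg]
  have e5 := key 1 0 (frontSign deg 1) (-1) (x 2).1 fun h h' => by
      rw [f1, h, h', neg_one_mul, neg_neg, Int.negOnePow_one]
  rw [neg_one_units_smul] at e5
  simp only [h1, h2, a00, a01, a10, a11, a20, a21, coeffDeriv_lie, map_add, smul_add, smul_sub, 
    frontSign_zero, k2, one_smul] at *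
  have hu : ∀ (X : VF d) (u : ℤˣ) (P : PV d), coeffDeriv X (u • P) = u • coeffDeriv X P := by
    intro X u P
    rcases Int.units_eq_one_or u with rfl | rfl <;> simp
  simp only [hu, smul_smul, Units.neg_smul] at *
  rw [e1, e2, e3, e4, e5, ZeroMemClass.coe_zero]
  abel

theorem jacobiator_eq_zero (φ : PolyFun d) (hn : 1 ≤ n) {x : Fin n → koszulModule d}
    {deg : Fin n → ℤ} (hx : ∀ k, x k ∈ (koszulLieInfty φ).grading (deg k)) :
    (koszulLieInfty φ).jacobiator x deg = 0 := by
  match n, hn with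
  | 1, _ => exact jacobiator_one φ hx
  | 2, _ => exact jacobiator_two φ hx
  | 3, _ => exact jacobiator_three φ hx
  | r + 4, _ =>
    refine Subtype.ext ?_
    rw [coe_jacobiator_add_two φ hx, anchor_bracket_of_three_le φ (by omega) hx, map_zero, add_zero]
    refine Finset.sum_eq_zero fun m _ => ?_
    rw [anchor_bracket_of_three_le φ (by omega) (fun k => hx (m.succAbove k)),
      correction_of_three_le φ (by omega)]
    simp

end JacobiFinal

/-! ### Internal direct sums and projections -/

section Internal

variable {A M ι : Type*} [CommRing A] [AddCommGroup M] [Module A M] [DecidableEq ι]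

theorem DirectSum.IsInternal.exists_projection {G : ι → Submodule A M}
    (h : DirectSum.IsInternal G) (e : ι) :
    ∃ p : M →ₗ[A] M, (∀ x, p x ∈ G e) ∧ (∀ x ∈ G e, p x = x) ∧
      ∀ e', e' ≠ e → ∀ x ∈ G e', p x = 0 := by
  let q := LinearEquiv.ofBijective (DirectSum.coeLinearMap G) h
  have hq : ∀ e' (x : G e'), q.symm x.1 = DirectSum.lof A ι (fun i => G i) e' x := fun e' x => by
    rw [LinearEquiv.symm_apply_eq]
    exact (DirectSum.coeLinearMap_lof G e' x).symm
  refine ⟨(G e).subtype ∘ₗ DirectSum.component A ι (fun i => G i) e ∘ₗ q.symm.toLinearMap,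
    fun x => Subtype.prop _, fun x hx => ?_, fun e' he x hx => ?_⟩
  · change ((DirectSum.component A ι (fun i => G i) e (q.symm x) : G e) : M) = x
    rw [hq e ⟨x, hx⟩, DirectSum.component.lof_self]
  · change ((DirectSum.component A ι (fun i => G i) e (q.symm x) : G e) : M) = 0
    rw [hq e' ⟨x, hx⟩, DirectSum.component.of, dif_neg he]
    rfl

theorem DirectSum.isInternal_of_exists_projection {G : ι → Submodule A M} (hG : iSup G = ⊤)
    (h : ∀ e, ∃ p : M →ₗ[A] M, (∀ x ∈ G e, p x = x) ∧ ∀ e', e' ≠ e → ∀ x ∈ G e', p x = 0) :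
    DirectSum.IsInternal G := by
  refine (DirectSum.isInternal_submodule_iff_iSupIndep_and_iSup_eq_top G).2 ⟨fun e => ?_, hG⟩
  obtain ⟨p, h1, h2⟩ := h e
  rw [Submodule.disjoint_def]
  intro x hx hx'
  have hle : (⨆ e', ⨆ (_ : e' ≠ e), G e') ≤ LinearMap.ker p :=
    iSup_le fun e' => iSup_le fun he y hy => h2 e' he y hy
  rw [← h1 x hx]
  exact hle hx'

theorem DirectSum.IsInternal.projective_component {G : ι → Submodule A M}
    (h : DirectSum.IsInternal G) [Module.Projective A M] (e : ι) : Module.Projective A (G e) := by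
  obtain ⟨p, h1, h2, -⟩ := h.exists_projection e
  exact Module.Projective.of_split (G e).subtype (p.codRestrict (G e) h1)
    (LinearMap.ext fun x => Subtype.ext (h2 x x.2))

end Internal

/-! ### The axioms of a Lie ∞-algebroid -/

section KoszulAlgebroid

variable {d : ℕ}

/-- `E` is a retract of the free module of all polyvector fields. -/
instance projective_koszulModule : Module.Projective (PolyFun d) (koszulModule d) :=
  have : Module.Projective (PolyFun d) (PV d) := Module.Projective.of_basis (pvBasis d)
  Module.Projective.of_split (koszulModule d).subtype (koszulProj d)
    (LinearMap.ext fun P => koszulProj_coe P)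

theorem koszulLieInfty_isInternal (φ : PolyFun d) :
    DirectSum.IsInternal (koszulLieInfty φ).grading := by
  refine DirectSum.isInternal_of_exists_projection ?_ fun e => ?_
  · refine Submodule.map_injective_of_injective (koszulModule d).subtype_injective ?_
    rw [Submodule.map_subtype_top]
    refine le_antisymm (Submodule.map_subtype_le _ _) (iSup_le fun k P hP => ?_)
    refine ⟨⟨P, Submodule.mem_iSup_of_mem k hP⟩, ?_, rfl⟩
    refine Submodule.mem_iSup_of_mem (-1 - (k : ℤ)) ((mem_grading_iff φ (by omega)).2 ?_)
    have : (1 - (-1 - (k : ℤ))).toNat = k + 2 := by omega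
    rw [this]
    exact hP
  · by_cases he : e ≤ -1
    · let 𝒜 : ℕ → Submodule (PolyFun d) (PV d) := fun i => ⋀[PolyFun d]^i (VF d)
      refine ⟨koszulProj d ∘ₗ GradedAlgebra.proj 𝒜 (1 - e).toNat ∘ₗ (koszulModule d).subtype,
        fun x hx => ?_, fun e' hne x hx => ?_⟩
      · have h := DirectSum.decompose_of_mem_same 𝒜 ((mem_grading_iff φ he).1 hx)
        change koszulProj d (GradedAlgebra.proj 𝒜 _ x.1) = x
        rw [GradedAlgebra.proj_apply, h, koszulProj_coe]
      · by_cases he' : e' ≤ -1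
        · have h := DirectSum.decompose_of_mem_ne 𝒜 ((mem_grading_iff φ he').1 hx)
            (j := (1 - e).toNat) (by omega)
          change koszulProj d (GradedAlgebra.proj 𝒜 _ x.1) = 0
          rw [GradedAlgebra.proj_apply, h, map_zero]
        · rw [grading_eq_bot φ (by omega), Submodule.mem_bot] at hx
          rw [hx, map_zero]
    · refine ⟨0, fun x hx => ?_, fun _ _ _ _ => rfl⟩
      rw [grading_eq_bot φ (by omega), Submodule.mem_bot] at hx
      rw [hx, map_zero]

theorem koszulLieInfty_bracket_smul (φ : PolyFun d) {n : ℕ} (hn : n ≠ 2)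
    (x : Fin n → koszulModule d) (i : Fin n) (f : PolyFun d) (y : koszulModule d) :
    (koszulLieInfty φ).bracket n (Function.update x i (f • y)) =
      f • (koszulLieInfty φ).bracket n (Function.update x i y) := by
  have h : ∀ z, (koszulLieInfty φ).bracket n z = koszulBracketLin φ n z := fun z => by
    rw [bracket_of_ne_two φ hn, koszulBracketLin_apply]
  rw [h, h, MultilinearMap.map_update_smul]

theorem koszulLieInfty_isLieInftyAlgebroid (φ : PolyFun d) :
    (koszulLieInfty φ).IsLieInftyAlgebroid where
  isInternal := koszulLieInfty_isInternal φ
  grading_nonneg _ he := grading_eq_bot φ he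
  projective e := (koszulLieInfty_isInternal φ).projective_component e
  bracket_mem _ _ _ hx := bracket_mem_grading φ hx
  bracket_perm _ _ _ hx σ := bracket_comp_perm φ hx σ
  jacobi _ _ _ hn hx := jacobiator_eq_zero φ hn hx
  bracket_smul _ hn := koszulLieInfty_bracket_smul φ hn
  leibniz := bracket_two_leibniz φ
  anchor_of_ne _ he _ hx := anchor_of_mem_grading φ he hx
  anchor_bracket_one _ hx := anchor_bracket_one φ hx
  anchor_bracket_two _ hx _ hy := anchor_bracket_two φ hx hy

/-! ### Universality over the polynomial ring -/

theorem koszulHook_eq_zero_iff (φ : PolyFun d) {P : koszulModule d} :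
    koszulHook φ P = 0 ↔ koszulAnchor φ P = 0 := by
  rw [← Subtype.coe_inj]
  rfl

theorem koszulHook_surjective {φ : PolyFun d} (hφ : IsKoszul φ) (Y : foliation φ) :
    ∃ P ∈ (koszulLieInfty φ).grading (-1), koszulHook φ P = Y := by
  have hY : Y.1 φ = 0 := Y.2
  have h0 : contract φ (ExteriorAlgebra.ι (PolyFun d) Y.1) = 0 := by
    rw [contract_ι, hY, map_zero]
  obtain ⟨Q, hQ, hQY⟩ := (hφ 0 _ (ι_mem_exteriorPower_one _)).1 h0
  have hmem : -Q ∈ koszulModule d := neg_mem (Submodule.mem_iSup_of_mem 0 hQ)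
  refine ⟨⟨-Q, hmem⟩, (mem_grading_iff φ le_rfl).2 (neg_mem hQ), Subtype.ext ?_⟩
  refine ExteriorAlgebra.ι_leftInverse.injective ((ι_koszulAnchor φ (neg_mem hQ)).trans ?_)
  rw [map_neg, neg_neg, hQY]

theorem koszulLieInfty_exact {φ : PolyFun d} (hφ : IsKoszul φ) {e : ℤ} (he : e ≤ -1)
    {P : koszulModule d} (hP : P ∈ (koszulLieInfty φ).grading e) :
    contract φ P.1 = 0 ↔
      ∃ Q ∈ (koszulLieInfty φ).grading (e - 1), (koszulLieInfty φ).bracket 1 ![Q] = P := by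
  obtain ⟨k, hk⟩ : ∃ k : ℕ, (1 - e).toNat = k + 1 := ⟨(1 - e).toNat - 1, by omega⟩
  have hk' : (1 - (e - 1)).toNat = k + 2 := by omega
  have hP' := (mem_grading_iff φ he).1 hP
  rw [hk] at hP'
  rw [hφ k P.1 hP']
  refine ⟨fun ⟨Q, hQ, h⟩ => ?_, fun ⟨Q, hQ, h⟩ => ⟨Q.1, ?_, ?_⟩⟩
  · have hQ' : (⟨Q, Submodule.mem_iSup_of_mem k hQ⟩ : koszulModule d) ∈
        (koszulLieInfty φ).grading (e - 1) := by
      rw [mem_grading_iff φ (by omega), hk']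
      exact hQ
    exact ⟨_, hQ', Subtype.ext ((coe_bracket_one φ (by omega) hQ').trans h)⟩
  · rw [mem_grading_iff φ (by omega), hk'] at hQ
    exact hQ
  · rw [← coe_bracket_one φ (by omega) hQ, h]

theorem koszulLieInfty_terminatesAt (φ : PolyFun d) :
    (koszulLieInfty φ).TerminatesAt (koszulHook φ) where
  hook_of_ne _ he _ hP := (koszulHook_eq_zero_iff φ).2 (anchor_of_mem_grading φ he hP)
  anchor_hook _ _ _ := rfl
  lie_hook _ hP _ hQ := Subtype.ext (anchor_bracket_two φ hP hQ).symm

theorem koszulLieInfty_isUniversal {φ : PolyFun d} (hφ : IsKoszul φ) :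
    (koszulLieInfty φ).IsUniversal (koszulHook φ) where
  isLieInftyAlgebroid := koszulLieInfty_isLieInftyAlgebroid φ
  terminatesAt := koszulLieInfty_terminatesAt φ
  hook_surjective := koszulHook_surjective hφ
  exact_hook P hP := by
    rw [koszulHook_eq_zero_iff, ← ExteriorAlgebra.ι_eq_zero_iff (R := PolyFun d),
      ι_koszulAnchor φ ((mem_grading_iff φ le_rfl).1 hP), neg_eq_zero,
      koszulLieInfty_exact hφ le_rfl hP]
    rfl
  exact_bracket e he P hP := by
    rw [← Subtype.coe_inj, coe_bracket_one φ he hP, ZeroMemClass.coe_zero,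
      koszulLieInfty_exact hφ (by omega) hP]

end KoszulAlgebroid

/-! ### Restriction of Lie ∞-algebroids along an ideal -/

section ModIdeal

variable {A E F : Type*} [CommRing A] [AddCommGroup E] [Module A E] [AddCommGroup F] [Module A F]

/-- The `A / I`-linear map `E / I E → F / I F` induced by an `A`-linear map `E → F`. -/
def LinearMap.modIdeal (I : Ideal A) (f : E →ₗ[A] F) :
    (E ⧸ (I • (⊤ : Submodule A E))) →ₗ[A ⧸ I] F ⧸ (I • (⊤ : Submodule A F)) :=
  (Submodule.mapQ _ _ f (Submodule.smul_top_le_comap_smul_top I f)).extendScalarsOfSurjective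
    Ideal.Quotient.mk_surjective

theorem LinearMap.modIdeal_mk (I : Ideal A) (f : E →ₗ[A] F) (x : E) :
    f.modIdeal I (Submodule.Quotient.mk x) = Submodule.Quotient.mk (f x) := rfl

theorem Module.Projective.quotient_smul_top (I : Ideal A) [Module.Projective A E] :
    Module.Projective (A ⧸ I) (E ⧸ (I • (⊤ : Submodule A E))) :=
  Module.Projective.of_equiv ((TensorProduct.quotTensorEquivQuotSMul E I).extendScalarsOfSurjective
    Ideal.Quotient.mk_surjective)

/-- The derivation of `A / I` induced by a derivation of `A` that preserves `I`. -/
def Derivation.modIdeal {K : Type*} [CommRing K] [Algebra K A] (D : Derivation K A A) (I : Ideal A)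
    (hD : ∀ f ∈ I, D f ∈ I) : Derivation K (A ⧸ I) (A ⧸ I) :=
  Derivation.liftOfSurjective (f := Ideal.Quotient.mkₐ K I) (Ideal.Quotient.mkₐ_surjective K I)
    (d := D) fun f hf => by
      rw [Ideal.Quotient.mkₐ_eq_mk, Ideal.Quotient.eq_zero_iff_mem] at hf ⊢
      exact hD f hf

theorem Derivation.modIdeal_mk {K : Type*} [CommRing K] [Algebra K A] (D : Derivation K A A)
    {I : Ideal A} (hD : ∀ f ∈ I, D f ∈ I) (f : A) :
    D.modIdeal I hD (Ideal.Quotient.mk I f) = Ideal.Quotient.mk I (D f) :=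
  Derivation.liftOfSurjective_apply (Ideal.Quotient.mkₐ_surjective K I) (d := D) (fun f hf => by
    rw [Ideal.Quotient.mkₐ_eq_mk, Ideal.Quotient.eq_zero_iff_mem] at hf ⊢
    exact hD f hf) f

end ModIdeal

namespace LieInftyData

variable {K A E : Type*} [CommRing K] [CommRing A] [Algebra K A]
  [AddCommGroup E] [Module K E] [Module A E]
  {E' : LieInftyData K A E} {I : Ideal A}

/-- The brackets of a Lie ∞-algebroid pass to the quotient by an ideal that is preserved by the
image of the anchor. For the first argument of the binary bracket, this uses the graded symmetry on
homogeneous components. -/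
theorem IsLieInftyAlgebroid.bracket_update_mem (h : E'.IsLieInftyAlgebroid)
    (hI : ∀ x, ∀ f ∈ I, E'.anchor x f ∈ I) (n : ℕ) (x : Fin n → E) (i : Fin n) {y : E}
    (hy : y ∈ I • (⊤ : Submodule A E)) :
    E'.bracket n (Function.update x i y) ∈ I • (⊤ : Submodule A E) := by
  have htop : ∀ z : E, z ∈ ⨆ e, E'.grading e := fun z => by
    rw [h.isInternal.submodule_iSup_eq_top]; trivial
  have hadd : ∀ z w w', E'.bracket 2 ![w + w', z] =
      E'.bracket 2 ![w, z] + E'.bracket 2 ![w', z] := fun z w w' => by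
    have h1 : ∀ w, ![w, z] = Function.update ![0, z] 0 w := fun w => by
      funext i; fin_cases i <;> rfl
    rw [h1, MultilinearMap.map_update_add, ← h1, ← h1]
  have hadd' : ∀ z w w', E'.bracket 2 ![z, w + w'] =
      E'.bracket 2 ![z, w] + E'.bracket 2 ![z, w'] := fun z w w' => by
    have h1 : ∀ w, ![z, w] = Function.update ![z, 0] 1 w := fun w => by
      funext i; fin_cases i <;> rfl
    rw [h1, MultilinearMap.map_update_add, ← h1, ← h1]
  have hr : ∀ (z : E) {w : E}, w ∈ I • (⊤ : Submodule A E) →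
      E'.bracket 2 ![z, w] ∈ I • (⊤ : Submodule A E) := fun z w hw => by
    induction hw using Submodule.smul_induction_on' with
    | smul f hf w _ =>
      rw [h.leibniz]
      exact add_mem (Submodule.smul_mem_smul (hI z f hf) trivial)
        (Submodule.smul_mem_smul hf trivial)
    | add w _ w' _ h1 h2 => rw [hadd']; exact add_mem h1 h2
  have hl : ∀ (z : E) {w : E}, w ∈ I • (⊤ : Submodule A E) →
      E'.bracket 2 ![w, z] ∈ I • (⊤ : Submodule A E) := fun z w hw => by
    have hzero : ∀ z, E'.bracket 2 ![0, z] = 0 := fun z =>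
      MultilinearMap.map_coord_zero _ 0 rfl
    have hzero' : ∀ z, E'.bracket 2 ![z, 0] = 0 := fun z =>
      MultilinearMap.map_coord_zero _ 1 rfl
    induction hw using Submodule.smul_induction_on' with
    | smul f hf w hw' =>
      clear hw'
      have hw := htop w
      have hz := htop z
      induction hw using Submodule.iSup_induction' with
      | mem e w hw =>
        induction hz using Submodule.iSup_induction' with
        | mem e' z hz =>
          have hdeg : ∀ i, ![z, f • w] i ∈ E'.grading (![e', e] i) := fun i => by
            fin_cases i
            · exact hz
            · exact Submodule.smul_mem _ _ hw
          have hs := h.bracket_perm 2 ![z, f • w] ![e', e] hdeg (Equiv.swap 0 1)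
          have hx : (fun i => ![z, f • w] (Equiv.swap 0 1 i)) = ![f • w, z] := by
            funext i; fin_cases i <;> simp
          rw [hx] at hs
          rw [hs]
          have hm := hr z (Submodule.smul_mem_smul hf (Submodule.mem_top (x := w)))
          rcases Int.units_eq_one_or (koszulSign (Equiv.swap 0 1) ![e', e]) with hu | hu
          · rw [hu, one_smul]; exact hm
          · rw [hu, neg_one_units_smul]; exact neg_mem hm
        | zero => rw [hzero']; exact zero_mem _
        | add z z' _ _ h1 h2 => rw [hadd']; exact add_mem h1 h2
      | zero => rw [smul_zero, hzero]; exact zero_mem _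
      | add w w' _ _ h1 h2 => rw [smul_add, hadd]; exact add_mem h1 h2
    | add w _ w' _ h1 h2 => rw [hadd]; exact add_mem h1 h2
  by_cases hn : n = 2
  · subst hn
    obtain rfl | rfl : i = 0 ∨ i = 1 := by fin_cases i <;> simp
    · have : Function.update x 0 y = ![y, x 1] := by funext i; fin_cases i <;> rfl
      rw [this]
      exact hl _ hy
    · have : Function.update x 1 y = ![x 0, y] := by funext i; fin_cases i <;> rfl
      rw [this]
      exact hr _ hy
  · induction hy using Submodule.smul_induction_on' with
    | smul f hf w _ =>
      rw [h.bracket_smul n hn]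
      exact Submodule.smul_mem_smul hf trivial
    | add w _ w' _ h1 h2 => rw [MultilinearMap.map_update_add]; exact add_mem h1 h2

theorem IsLieInftyAlgebroid.bracket_mk_congr (h : E'.IsLieInftyAlgebroid)
    (hI : ∀ x, ∀ f ∈ I, E'.anchor x f ∈ I) (n : ℕ) {x y : Fin n → E}
    (hxy : ∀ i, (Submodule.Quotient.mk (x i) : E ⧸ (I • (⊤ : Submodule A E))) =
      Submodule.Quotient.mk (y i)) :
    (Submodule.Quotient.mk (E'.bracket n x) : E ⧸ (I • (⊤ : Submodule A E))) =
      Submodule.Quotient.mk (E'.bracket n y) := by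
  have key : ∀ s : Finset (Fin n),
      (Submodule.Quotient.mk (E'.bracket n (s.piecewise x y)) : E ⧸ (I • (⊤ : Submodule A E))) =
        Submodule.Quotient.mk (E'.bracket n y) := fun s => by
    induction s using Finset.induction_on with
    | empty => rw [Finset.piecewise_empty]
    | insert i s hi ih =>
      rw [← ih, Finset.piecewise_insert, Submodule.Quotient.eq]
      have h1 : s.piecewise x y = Function.update (s.piecewise x y) i (y i) := by
        rw [← Finset.piecewise_eq_of_notMem s x y hi, Function.update_eq_self]
      conv => enter [2, 2]; rw [h1]
      rw [← MultilinearMap.map_update_sub]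
      exact h.bracket_update_mem hI n _ i ((Submodule.Quotient.eq _).1 (hxy i))
  simpa using key Finset.univ

theorem mk_out_update {n : ℕ} (z : Fin n → E ⧸ (I • (⊤ : Submodule A E))) (i : Fin n)
    (u : E ⧸ (I • (⊤ : Submodule A E))) (k : Fin n) :
    (Submodule.Quotient.mk (Function.update z i u k).out : E ⧸ (I • (⊤ : Submodule A E))) =
      Submodule.Quotient.mk (Function.update (fun j => (z j).out) i u.out k) := by
  by_cases hk : k = i
  · subst hk
    rw [Function.update_self, Function.update_self]
  · rw [Function.update_of_ne hk, Function.update_of_ne hk]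

variable [IsScalarTower K A E]

/-- The restriction of a Lie ∞-algebroid with respect to an ideal `I` that is preserved by the
image of the anchor. The brackets are evaluated on chosen representatives, the choice of which does
not matter by `IsLieInftyAlgebroid.bracket_mk_congr`. -/
def restriction (E' : LieInftyData K A E) (h : E'.IsLieInftyAlgebroid) (I : Ideal A)
    (hI : ∀ x, ∀ f ∈ I, E'.anchor x f ∈ I) :
    LieInftyData K (A ⧸ I) (E ⧸ (I • (⊤ : Submodule A E))) where
  grading e :=
    { carrier := {y | ∃ x ∈ E'.grading e, Submodule.Quotient.mk x = y}
      add_mem' := by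
        rintro _ _ ⟨x, hx, rfl⟩ ⟨y, hy, rfl⟩
        exact ⟨x + y, add_mem hx hy, rfl⟩
      zero_mem' := ⟨0, zero_mem _, rfl⟩
      smul_mem' := by
        rintro ⟨f⟩ _ ⟨x, hx, rfl⟩
        exact ⟨f • x, Submodule.smul_mem _ _ hx, rfl⟩ }
  bracket n :=
    { toFun := fun z => Submodule.Quotient.mk (E'.bracket n fun i => (z i).out)
      map_update_add' := fun z i u v => by
        rename_i inst
        obtain rfl := Subsingleton.elim (instDecidableEqFin n) inst
        rw [h.bracket_mk_congr hI n (mk_out_update z i u),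
          h.bracket_mk_congr hI n (mk_out_update z i v), ← Submodule.Quotient.mk_add,
          ← MultilinearMap.map_update_add]
        refine h.bracket_mk_congr hI n fun k => (mk_out_update z i (u + v) k).trans ?_
        by_cases hk : k = i
        · subst hk
          simp only [Function.update_self, Submodule.Quotient.mk_add, Submodule.Quotient.mk_out]
        · rw [Function.update_of_ne hk, Function.update_of_ne hk]
      map_update_smul' := fun z i c u => by
        rename_i inst
        obtain rfl := Subsingleton.elim (instDecidableEqFin n) inst
        rw [h.bracket_mk_congr hI n (mk_out_update z i u), ← Submodule.Quotient.mk_smul,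
          ← MultilinearMap.map_update_smul]
        refine h.bracket_mk_congr hI n fun k => (mk_out_update z i (c • u) k).trans ?_
        by_cases hk : k = i
        · subst hk
          simp only [Function.update_self, Submodule.Quotient.mk_smul, Submodule.Quotient.mk_out]
        · rw [Function.update_of_ne hk, Function.update_of_ne hk] }
  anchor := LinearMap.extendScalarsOfSurjective (Ideal.Quotient.mk_surjective (I := I))
    (Submodule.liftQ (I • (⊤ : Submodule A E))
      { toFun := fun x => (E'.anchor x).modIdeal I (hI x)
        map_add' := fun x y => Derivation.ext fun f => by
          obtain ⟨f, rfl⟩ := Ideal.Quotient.mk_surjective f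
          simp only [Derivation.add_apply, Derivation.modIdeal_mk, map_add]
        map_smul' := fun a x => Derivation.ext fun f => by
          obtain ⟨f, rfl⟩ := Ideal.Quotient.mk_surjective f
          refine ((E'.anchor (a • x)).modIdeal_mk (hI _) f).trans ?_
          refine Eq.trans ?_ (congrArg (a • ·) ((E'.anchor x).modIdeal_mk (hI x) f).symm)
          rw [map_smul]
          rfl }
      (Submodule.smul_le.2 fun a ha x _ => by
        refine Derivation.ext fun f => ?_
        obtain ⟨f, rfl⟩ := Ideal.Quotient.mk_surjective f
        refine ((E'.anchor (a • x)).modIdeal_mk (hI _) f).trans ?_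
        rw [map_smul, Derivation.smul_apply, smul_eq_mul, map_mul,
          Ideal.Quotient.eq_zero_iff_mem.2 ha, zero_mul]
        rfl))

theorem restriction_isRestriction (h : E'.IsLieInftyAlgebroid)
    (hI : ∀ x, ∀ f ∈ I, E'.anchor x f ∈ I) :
    E'.IsRestriction I (E'.restriction h I hI) where
  grading _ _ := Iff.rfl
  bracket n _ := h.bracket_mk_congr hI n fun _ => Submodule.Quotient.mk_out _
  anchor x f := (E'.anchor x).modIdeal_mk (hI x) f

end LieInftyData

/-! ### Axioms and universality of restrictions -/

namespace LieInftyData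

variable {K A E : Type*} [CommRing K] [CommRing A] [Algebra K A]
  [AddCommGroup E] [Module K E] [Module A E] {E' : LieInftyData K A E} {I : Ideal A}

theorem exists_smul_of_mem_span_smul_top {M : Type*} [AddCommGroup M] [Module A M] {φ : A} {x : M}
    (hx : x ∈ (Ideal.span {φ} : Ideal A) • (⊤ : Submodule A M)) : ∃ y, φ • y = x := by
  rw [Submodule.ideal_span_singleton_smul] at hx
  obtain ⟨y, -, hy⟩ := hx
  exact ⟨y, hy⟩

theorem mk_smul_eq_zero {M : Type*} [AddCommGroup M] [Module A M] (φ : A) (x : M) :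
    (Submodule.Quotient.mk (φ • x) : M ⧸ ((Ideal.span {φ} : Ideal A) • (⊤ : Submodule A M))) = 0 :=
  (Submodule.Quotient.mk_eq_zero _).2
    (Submodule.smul_mem_smul (Ideal.mem_span_singleton_self φ) trivial)

theorem IsLieInftyAlgebroid.bracket_one_smul (h : E'.IsLieInftyAlgebroid) (f : A) (y : E) :
    E'.bracket 1 ![f • y] = f • E'.bracket 1 ![y] := by
  have h1 : ∀ z : E, ![z] = Function.update ![0] 0 z := fun z => by
    funext i; fin_cases i; rfl
  rw [h1, h.bracket_smul 1 (by decide), ← h1]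

theorem bracket_one_sub (E' : LieInftyData K A E) (x y : E) :
    E'.bracket 1 ![x - y] = E'.bracket 1 ![x] - E'.bracket 1 ![y] := by
  have h1 : ∀ z : E, ![z] = Function.update ![0] 0 z := fun z => by
    funext i; fin_cases i; rfl
  rw [h1, MultilinearMap.map_update_sub, ← h1, ← h1]

theorem IsLieInftyAlgebroid.bracket_one_mem (h : E'.IsLieInftyAlgebroid) {e : ℤ} {x : E}
    (hx : x ∈ E'.grading e) : E'.bracket 1 ![x] ∈ E'.grading (e + 1) := by
  have := h.bracket_mem 1 ![x] ![e] fun i => by fin_cases i; exact hx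
  simpa using this

/-- A homogeneous element divisible by `φ` is `φ` times a homogeneous element. -/
theorem IsLieInftyAlgebroid.exists_homogeneous (h : E'.IsLieInftyAlgebroid) {φ : A} {e : ℤ} {x : E}
    (hx : x ∈ E'.grading e) (hφ : x ∈ (Ideal.span {φ} : Ideal A) • (⊤ : Submodule A E)) :
    ∃ y ∈ E'.grading e, φ • y = x := by
  obtain ⟨y, rfl⟩ := exists_smul_of_mem_span_smul_top hφ
  obtain ⟨p, h1, h2, -⟩ := h.isInternal.exists_projection e
  exact ⟨p y, h1 y, by rw [← map_smul, h2 _ hx]⟩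

variable [IsScalarTower K A E]
  {R : LieInftyData K (A ⧸ I) (E ⧸ (I • (⊤ : Submodule A E)))}

namespace IsRestriction

theorem exists_lift (hR : E'.IsRestriction I R) {n : ℕ}
    {y : Fin n → E ⧸ (I • (⊤ : Submodule A E))} {deg : Fin n → ℤ}
    (hy : ∀ i, y i ∈ R.grading (deg i)) :
    ∃ x : Fin n → E, (∀ i, x i ∈ E'.grading (deg i)) ∧
      y = fun i => Submodule.Quotient.mk (x i) := by
  choose x hx hxy using fun i => (hR.grading _ _).1 (hy i)
  exact ⟨x, hx, funext fun i => (hxy i).symm⟩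

theorem bracket_one (hR : E'.IsRestriction I R) (x : E) :
    R.bracket 1 ![Submodule.Quotient.mk x] = Submodule.Quotient.mk (E'.bracket 1 ![x]) := by
  rw [← hR.bracket]
  congr 1
  funext i; fin_cases i; rfl

theorem bracket_two (hR : E'.IsRestriction I R) (x y : E) :
    R.bracket 2 ![Submodule.Quotient.mk x, Submodule.Quotient.mk y] =
      Submodule.Quotient.mk (E'.bracket 2 ![x, y]) := by
  rw [← hR.bracket]
  congr 1
  funext i; fin_cases i <;> rfl

theorem mk_mem (hR : E'.IsRestriction I R) {e : ℤ} {x : E} (hx : x ∈ E'.grading e) :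
    Submodule.Quotient.mk x ∈ R.grading e :=
  (hR.grading _ _).2 ⟨x, hx, rfl⟩

theorem mk_units_smul (u : ℤˣ) (x : E) :
    (Submodule.Quotient.mk (u • x) : E ⧸ (I • (⊤ : Submodule A E))) =
      u • Submodule.Quotient.mk x := by
  rcases Int.units_eq_one_or u with rfl | rfl
  · rw [one_smul, one_smul]
  · rw [neg_one_units_smul, neg_one_units_smul]; rfl

theorem jacobiator (hR : E'.IsRestriction I R) {n : ℕ} (x : Fin n → E) (deg : Fin n → ℤ) :
    R.jacobiator (fun i => Submodule.Quotient.mk (x i)) deg =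
      Submodule.Quotient.mk (E'.jacobiator x deg) := by
  have hsum : ∀ {ι : Type} (s : Finset ι) (f : ι → E),
      (Submodule.Quotient.mk (∑ i ∈ s, f i) : E ⧸ (I • (⊤ : Submodule A E))) =
        ∑ i ∈ s, Submodule.Quotient.mk (f i) := fun s f =>
    map_sum (I • (⊤ : Submodule A E)).mkQ f s
  rw [LieInftyData.jacobiator, LieInftyData.jacobiator, hsum]
  refine Finset.sum_congr rfl fun i _ => ?_
  rw [hsum]
  refine Finset.sum_congr rfl fun σ _ => ?_
  rw [mk_units_smul, ← hR.bracket]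
  refine congrArg (_ • ·) (congrArg _ (funext fun k => ?_))
  refine Fin.cases ?_ (fun b => ?_) k
  · exact hR.bracket _ _
  · rfl

theorem isInternal (hR : E'.IsRestriction I R) (h : DirectSum.IsInternal E'.grading) :
    DirectSum.IsInternal R.grading := by
  refine DirectSum.isInternal_of_exists_projection (eq_top_iff.2 ?_) fun e => ?_
  · rintro ⟨x⟩ -
    change Submodule.Quotient.mk x ∈ _
    have hx : x ∈ ⨆ e, E'.grading e := by rw [h.submodule_iSup_eq_top]; trivial
    induction hx using Submodule.iSup_induction' with
    | mem e x hx => exact Submodule.mem_iSup_of_mem e (hR.mk_mem hx)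
    | zero => exact zero_mem _
    | add x y _ _ h1 h2 => exact add_mem h1 h2
  · obtain ⟨p, -, h1, h2⟩ := h.exists_projection e
    refine ⟨p.modIdeal I, fun y hy => ?_, fun e' he y hy => ?_⟩
    · obtain ⟨x, hx, rfl⟩ := (hR.grading _ _).1 hy
      rw [LinearMap.modIdeal_mk, h1 x hx]
    · obtain ⟨x, hx, rfl⟩ := (hR.grading _ _).1 hy
      rw [LinearMap.modIdeal_mk, h2 e' he x hx]
      rfl

theorem isLieInftyAlgebroid [Module.Projective A E] (hR : E'.IsRestriction I R)
    (h : E'.IsLieInftyAlgebroid) : R.IsLieInftyAlgebroid where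
  isInternal := hR.isInternal h.isInternal
  grading_nonneg e he := by
    refine eq_bot_iff.2 fun y hy => ?_
    obtain ⟨x, hx, rfl⟩ := (hR.grading _ _).1 hy
    rw [h.grading_nonneg e he, Submodule.mem_bot] at hx
    rw [hx]
    exact zero_mem _
  projective e :=
    have := Module.Projective.quotient_smul_top (E := E) I
    (hR.isInternal h.isInternal).projective_component e
  bracket_mem n y deg hy := by
    obtain ⟨x, hx, rfl⟩ := hR.exists_lift hy
    rw [hR.bracket]
    exact hR.mk_mem (h.bracket_mem n x deg hx)
  bracket_perm n y deg hy σ := by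
    obtain ⟨x, hx, rfl⟩ := hR.exists_lift hy
    rw [hR.bracket, hR.bracket n x, h.bracket_perm n x deg hx, mk_units_smul]
  jacobi n y deg hn hy := by
    obtain ⟨x, hx, rfl⟩ := hR.exists_lift hy
    rw [hR.jacobiator, h.jacobi n x deg hn hx]
    rfl
  bracket_smul n hn z i := by
    rintro ⟨f⟩ ⟨y⟩
    obtain ⟨x, rfl⟩ : ∃ x : Fin n → E, z = fun i => Submodule.Quotient.mk (x i) :=
      ⟨fun i => (z i).out, funext fun i => (Submodule.Quotient.mk_out _).symm⟩
    have hu : ∀ y : E, Function.update (fun i => (Submodule.Quotient.mk (x i) :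
        E ⧸ (I • (⊤ : Submodule A E)))) i (Submodule.Quotient.mk y) =
        fun k => Submodule.Quotient.mk (Function.update x i y k) := fun y => by
      funext k
      by_cases hk : k = i
      · subst hk; rw [Function.update_self, Function.update_self]
      · rw [Function.update_of_ne hk, Function.update_of_ne hk]
    change R.bracket n (Function.update _ i (Submodule.Quotient.mk (f • y))) =
      Ideal.Quotient.mk I f • R.bracket n (Function.update _ i (Submodule.Quotient.mk y))
    rw [hu, hu, hR.bracket, hR.bracket, h.bracket_smul n hn]
    rfl
  leibniz := by
    rintro ⟨x⟩ ⟨y⟩ ⟨f⟩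
    change R.bracket 2 ![Submodule.Quotient.mk x, Submodule.Quotient.mk (f • y)] =
      R.anchor (Submodule.Quotient.mk x) (Ideal.Quotient.mk I f) • Submodule.Quotient.mk y +
        Ideal.Quotient.mk I f • R.bracket 2 ![Submodule.Quotient.mk x, Submodule.Quotient.mk y]
    rw [hR.bracket_two, hR.bracket_two, hR.anchor, h.leibniz]
    rfl
  anchor_of_ne e he y hy := by
    obtain ⟨x, hx, rfl⟩ := (hR.grading _ _).1 hy
    refine Derivation.ext fun f => ?_
    obtain ⟨f, rfl⟩ := Ideal.Quotient.mk_surjective f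
    rw [hR.anchor, h.anchor_of_ne e he x hx]
    rfl
  anchor_bracket_one y hy := by
    obtain ⟨x, hx, rfl⟩ := (hR.grading _ _).1 hy
    refine Derivation.ext fun f => ?_
    obtain ⟨f, rfl⟩ := Ideal.Quotient.mk_surjective f
    rw [hR.bracket_one, hR.anchor, h.anchor_bracket_one x hx]
    rfl
  anchor_bracket_two y hy y' hy' := by
    obtain ⟨x, hx, rfl⟩ := (hR.grading _ _).1 hy
    obtain ⟨x', hx', rfl⟩ := (hR.grading _ _).1 hy'
    refine Derivation.ext fun f => ?_
    obtain ⟨f, rfl⟩ := Ideal.Quotient.mk_surjective f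
    rw [hR.bracket_two, hR.anchor, h.anchor_bracket_two x hx x' hx', Derivation.commutator_apply,
      Derivation.commutator_apply, hR.anchor, hR.anchor, hR.anchor, hR.anchor]
    rfl

variable {L : Type*} [LieRing L] [Module A L] [LieRingModule L A]
  [LieRinehartRing A L] [IsLieRinehartIdeal L I] {π : E →ₗ[A] L}

theorem terminatesAt (hR : E'.IsRestriction I R) (h : E'.TerminatesAt π) :
    R.TerminatesAt (L := LRRestriction L I) (π.modIdeal I) where
  hook_of_ne e he y hy := by
    obtain ⟨x, hx, rfl⟩ := (hR.grading _ _).1 hy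
    rw [LinearMap.modIdeal_mk, h.hook_of_ne e he x hx]
    rfl
  anchor_hook y hy f := by
    obtain ⟨x, hx, rfl⟩ := (hR.grading _ _).1 hy
    obtain ⟨f, rfl⟩ := Ideal.Quotient.mk_surjective f
    rw [LinearMap.modIdeal_mk, hR.anchor, ← h.anchor_hook x hx f]
    rfl
  lie_hook y hy y' hy' := by
    obtain ⟨x, hx, rfl⟩ := (hR.grading _ _).1 hy
    obtain ⟨x', hx', rfl⟩ := (hR.grading _ _).1 hy'
    rw [hR.bracket_two, LinearMap.modIdeal_mk, LinearMap.modIdeal_mk, LinearMap.modIdeal_mk,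
      ← h.lie_hook x hx x' hx']
    rfl

end IsRestriction

section Principal

variable {L : Type*} [LieRing L] [Module A L] [LieRingModule L A]
  [LieRinehartRing A L] {π : E →ₗ[A] L}

/-- Restriction to the zero locus of a function `φ` that is a nonzerodivisor on the
Lie ∞-algebroid and on the Lie-Rinehart algebra preserves universality: since `φ` is a
nonzerodivisor, the cycles modulo `φ` lift to cycles. -/
theorem IsUniversal.restrict_span_singleton [Module.Projective A E] {φ : A}
    [IsLieRinehartIdeal L (Ideal.span {φ} : Ideal A)]
    {R : LieInftyData K (A ⧸ Ideal.span {φ}) (E ⧸ (Ideal.span {φ} • (⊤ : Submodule A E)))}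
    (h : E'.IsUniversal π) (hR : E'.IsRestriction (Ideal.span {φ}) R)
    (hE : ∀ x : E, φ • x = 0 → x = 0) (hL : ∀ a : L, φ • a = 0 → a = 0) :
    R.IsUniversal (L := LRRestriction L (Ideal.span {φ})) (π.modIdeal (Ideal.span {φ})) where
  isLieInftyAlgebroid := hR.isLieInftyAlgebroid h.isLieInftyAlgebroid
  terminatesAt := hR.terminatesAt h.terminatesAt
  hook_surjective := by
    rintro ⟨a⟩
    obtain ⟨x, hx, rfl⟩ := h.hook_surjective a
    exact ⟨Submodule.Quotient.mk x, hR.mk_mem hx, rfl⟩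
  exact_hook y hy := by
    obtain ⟨x, hx, rfl⟩ := (hR.grading _ _).1 hy
    refine ⟨fun h0 => ?_, ?_⟩
    · rw [LinearMap.modIdeal_mk, Submodule.Quotient.mk_eq_zero] at h0
      obtain ⟨a, ha⟩ := exists_smul_of_mem_span_smul_top h0
      obtain ⟨z, hz, rfl⟩ := h.hook_surjective a
      have h1 : π (x - φ • z) = 0 := by rw [map_sub, map_smul, ha, sub_self]
      obtain ⟨w, hw, hwx⟩ := (h.exact_hook _ (sub_mem hx (Submodule.smul_mem _ φ hz))).1 h1
      refine ⟨Submodule.Quotient.mk w, hR.mk_mem hw, ?_⟩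
      rw [hR.bracket_one, hwx, Submodule.Quotient.mk_sub, mk_smul_eq_zero, sub_zero]
    · rintro ⟨w, hw, hwx⟩
      obtain ⟨w, hw', rfl⟩ := (hR.grading _ _).1 hw
      rw [← hwx, hR.bracket_one, LinearMap.modIdeal_mk,
        (h.exact_hook _ (h.isLieInftyAlgebroid.bracket_one_mem hw')).2 ⟨w, hw', rfl⟩]
      rfl
  exact_bracket e he y hy := by
    obtain ⟨x, hx, rfl⟩ := (hR.grading _ _).1 hy
    refine ⟨fun h0 => ?_, ?_⟩
    · rw [hR.bracket_one, Submodule.Quotient.mk_eq_zero] at h0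
      obtain ⟨y, hy, hyx⟩ := h.isLieInftyAlgebroid.exists_homogeneous
        (h.isLieInftyAlgebroid.bracket_one_mem hx) h0
      -- `φ • y` is a boundary, so `y` is a cycle, hence a boundary.
      obtain ⟨z, hz, hzy⟩ : ∃ z ∈ E'.grading e, E'.bracket 1 ![z] = y := by
        rcases he.lt_or_eq with he' | rfl
        · have h1 : E'.bracket 1 ![y] = 0 := hE _ (by
            rw [← h.isLieInftyAlgebroid.bracket_one_smul, hyx]
            refine (h.exact_bracket (e + 1) (by omega) _
              (h.isLieInftyAlgebroid.bracket_one_mem hx)).2 ⟨x, ?_, rfl⟩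
            rwa [add_sub_cancel_right])
          obtain ⟨z, hz, hzy⟩ := (h.exact_bracket (e + 1) (by omega) y hy).1 h1
          exact ⟨z, by rwa [add_sub_cancel_right] at hz, hzy⟩
        · have h1 : π y = 0 := hL _ (by
            rw [← map_smul, hyx]
            exact (h.exact_hook _ (h.isLieInftyAlgebroid.bracket_one_mem hx)).2 ⟨x, hx, rfl⟩)
          exact (h.exact_hook y hy).1 h1
      have h1 : E'.bracket 1 ![x - φ • z] = 0 := by
        rw [bracket_one_sub, h.isLieInftyAlgebroid.bracket_one_smul, hzy, hyx, sub_self]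
      obtain ⟨w, hw, hwx⟩ := (h.exact_bracket e he _ (sub_mem hx (Submodule.smul_mem _ φ hz))).1 h1
      refine ⟨Submodule.Quotient.mk w, hR.mk_mem hw, ?_⟩
      rw [hR.bracket_one, hwx, Submodule.Quotient.mk_sub, mk_smul_eq_zero, sub_zero]
    · rintro ⟨w, hw, hwx⟩
      obtain ⟨w, hw', rfl⟩ := (hR.grading _ _).1 hw
      have hm := h.isLieInftyAlgebroid.bracket_one_mem hw'
      rw [sub_add_cancel] at hm
      rw [← hwx, hR.bracket_one, hR.bracket_one, (h.exact_bracket e he _ hm).2 ⟨w, hw', rfl⟩]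
      rfl

end Principal

end LieInftyData

/-! ### Restriction to the zero locus of a Koszul polynomial -/

section KoszulRestriction

variable {d : ℕ}

theorem eq_zero_of_isKoszul_zero (hφ : IsKoszul (0 : PolyFun d)) {k : ℕ} {P : PV d}
    (hP : P ∈ ⋀[PolyFun d]^(k + 1) (VF d)) : P = 0 := by
  have h0 : ∀ Q : PV d, contract (0 : PolyFun d) Q = 0 := fun Q => by
    rw [contract_eq_sum]; simp
  obtain ⟨Q, -, hQ⟩ := (hφ k P hP).1 (h0 P)
  rw [← hQ, h0]

/-- A Koszul polynomial is a nonzerodivisor on polyvector fields of positive order: if it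
vanishes, the Koszul complex has zero differential, so that there are none but `0`. -/
theorem IsKoszul.eq_zero_of_smul_eq_zero {φ : PolyFun d} (hφ : IsKoszul φ) {k : ℕ} {P : PV d}
    (hP : P ∈ ⋀[PolyFun d]^(k + 1) (VF d)) (h : φ • P = 0) : P = 0 := by
  by_cases h0 : φ = 0
  · subst h0
    exact eq_zero_of_isKoszul_zero hφ hP
  · refine (pvBasis d).ext_elem fun J => ?_
    have h1 := congrArg (fun Q => (pvBasis d).repr Q J) h
    simpa [h0] using h1

/-- A Koszul polynomial is a nonzerodivisor on `E`. -/
theorem IsKoszul.koszulModule_regular {φ : PolyFun d} (hφ : IsKoszul φ) (P : koszulModule d)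
    (h : φ • P = 0) : P = 0 := by
  by_cases h0 : φ = 0
  · subst h0
    have hE : koszulModule d = ⊥ := by
      refine iSup_eq_bot.2 fun k => eq_bot_iff.2 fun P hP => ?_
      exact eq_zero_of_isKoszul_zero hφ (k := k + 1) hP
    exact Subtype.ext ((Submodule.mem_bot _).1 (hE.le P.2))
  · refine Subtype.ext ((pvBasis d).ext_elem fun J => ?_)
    have h1 := congrArg (fun Q : koszulModule d => (pvBasis d).repr Q.1 J) h
    simpa [h0] using h1

end KoszulRestriction

theorem mainTheorem10 (d : ℕ) (φ : PolyFun d) (hφ : IsKoszul φ) :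
    (koszulLieInfty φ).IsUniversal (koszulHook φ) ∧
    ∃ (R : LieInftyData ℂ (PolyFun d ⧸ Ideal.span {φ})
          (koszulModule d ⧸ (Ideal.span {φ} • (⊤ : Submodule (PolyFun d) (koszulModule d)))))
      (π : (koszulModule d ⧸ (Ideal.span {φ} • (⊤ : Submodule (PolyFun d) (koszulModule d))))
          →ₗ[PolyFun d ⧸ Ideal.span {φ}] LRRestriction (foliation φ) (Ideal.span {φ})),
      (koszulLieInfty φ).IsRestriction (Ideal.span {φ}) R ∧
      (∀ P : koszulModule d,
        π (Submodule.Quotient.mk P) = Submodule.Quotient.mk (koszulHook φ P)) ∧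
      R.IsUniversal π := by
  have h := koszulLieInfty_isUniversal hφ
  -- The anchor takes values in `𝓕_φ`, which preserves the ideal of `φ`.
  have hI : ∀ P, ∀ f ∈ (Ideal.span {φ} : Ideal (PolyFun d)),
      (koszulLieInfty φ).anchor P f ∈ (Ideal.span {φ} : Ideal (PolyFun d)) := fun P f hf =>
    IsLieRinehartIdeal.lie_mem (koszulHook φ P) f hf
  have hL : ∀ Y : foliation φ, φ • Y = 0 → Y = 0 := fun Y hY => by
    refine Subtype.ext ((ExteriorAlgebra.ι_leftInverse (R := PolyFun d)).injective ?_)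
    refine (hφ.eq_zero_of_smul_eq_zero (k := 0) (ι_mem_exteriorPower_one Y.1) ?_).trans
      (map_zero _).symm
    have h1 : φ • Y.1 = 0 := congrArg Subtype.val hY
    rw [← map_smul, h1, map_zero]
  have hR := LieInftyData.restriction_isRestriction h.isLieInftyAlgebroid hI
  exact ⟨h, _, (koszulHook φ).modIdeal _, hR, fun _ => rfl,
    h.restrict_span_singleton hR hφ.koszulModule_regular hL⟩

end
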